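/- Let $d\ge 1$ and consider real-valued solutions of $h_t=\Delta e^{-\Delta h}$ in $\mathbb R^d$. Write $\hat f(\xi)=(2\pi)^{-d/2}\int_{\mathbb R^d} f(x)e^{-ix\cdot\xi}\,dx$ and $$\|f\|_s=\int_{\mathbb R^d}|\xi|^s|\hat f(\xi)|\,d\xi,\qquad \|f\|_{\dot{\mathcal F}^{s,p}}=\Big(\int_{\mathbb R^d}|\xi|^{sp}|\hat f(\xi)|^p\,d\xi\Big)^{1/p},\qquad \|f\|_{s,\infty}=\sup_{k\in\mathbb Z}\int_{2^{k-1}\le|\xi|<2^k}|\xi|^s|\hat f(\xi)|\,d\xi ,$$ so that $\dot{\mathcal F}^{0,2}=L^2(\mathbb R^d)$ and $\|\cdot\|_{\dot{\mathcal F}^{s,1}}=\|\cdot\|_s$. Let $f_2(y)=\sum_{j\ge1}\frac{(j+1)^3}{j!}y^j$ and let $y_*>0$ be the number with $f_2(y_*)=1$. A (global) solution with initial data $h_0\in L^2(\mathbb R^d)$ is a function $h\in C^0([0,\infty);L^2(\mathbb R^d))$ with $h(0)=h_0$, with $\|h\|_2$ bounded and $\|h\|_6$ integrable on bounded time intervals,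 which satisfies $h_t=\Delta e^{-\Delta h}$ in the sense of distributions. Let $h_0\in L^2(\mathbb R^d)$ with $\|h_0\|_2<y_*$. Then there is a unique global solution $h$ with initial data $h_0$, and it satisfies $\|h(t)\|_2+\sigma\int_0^t\|h(\tau)\|_6\,d\tau\le\|h_0\|_2$ for all $t\ge0$, where $\sigma=1-f_2(\|h_0\|_2)>0$. Assume moreover that $\|h_0\|_{-d,\infty}<\infty$ (not necessarily small). Then: 1. For every $s>\max\{-2,-d\}$, if $\|h_0\|_s<\infty$, then $\|h(t)\|_s\le C\|h_0\|_s$ for all $t\ge0$. 2. For every $s\ge0$ and $p\in(1,2]$, if $\|h_0\|_{\dot{\mathcal F}^{s,p}}<\infty$, then $\|h(t)\|_{\dot{\mathcal F}^{s,p}}\le C\|h_0\|_{\dot{\mathcal F}^{s,p}}$ for all $t\ge0$. 3. For every $s>\max\{-2,-d\}$, if $h_0\in\dot{\mathcal F}^{s,1}\cap\dot{\mathcal F}^{2,2}$, then $\|h(t)\|_s\le C(1+t)^{-(s+d)/4}$ for all $t\ge0$. None of the norms of $h_0$ other than $\|h_0\|_2$ has to be small. In 1 and 2 the constant $C$ depends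 only on $d$, $s$ (and $p$ in 2), on an upper bound $A<y_*$ for $\|h_0\|_2$ and on an upper bound for $\|h_0\|_{-d,\infty}$; in 3 it depends only on $d$, $s$, such an $A$, and upper bounds for $\|h_0\|_{-d,\infty}$, $\|h_0\|_{\dot{\mathcal F}^{0,2}}$, $\|h_0\|_{\dot{\mathcal F}^{2,2}}$ and $\|h_0\|_s$. -/

import Mathlib

open MeasureTheory Set
open scoped ENNReal NNReal SchwartzMap BoundedContinuousFunction

noncomputable section

namespace ExpPDE

/-- The space `ℝ^d` with its Euclidean norm. -/
abbrev E (d : ℕ) : Type := EuclideanSpace ℝ (Fin d)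

/-- The real space `L²(ℝ^d)`. -/
abbrev L2 (d : ℕ) : Type := Lp ℝ 2 (volume : Measure (E d))

/-- A real `L²` function, regarded as a complex `L²` function. -/
def toComplex {d : ℕ} (f : L2 d) : Lp ℂ 2 (volume : Measure (E d)) :=
  Complex.ofRealCLM.compLp f

/-- The Fourier transform of an `L²` function, normalised as
`f̂(ξ) = (2π)^(-d/2) ∫ f(x) e^(-i x·ξ) dx`.
Mathlib's Plancherel transform `𝓕` has the kernel `e^(-2πi x·w)` and no prefactor, so
`f̂(ξ) = (2π)^(-d/2) (𝓕 f)(ξ / 2π)`. The function is determined almost everywhere. -/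
def fhat {d : ℕ} (f : L2 d) (ξ : E d) : ℂ :=
  (((2 * Real.pi) ^ (-(d : ℝ) / 2) : ℝ) : ℂ) *
    (FourierTransform.fourier (toComplex f) : Lp ℂ 2 (volume : Measure (E d)))
      ((2 * Real.pi)⁻¹ • ξ)

/-- The `s`-norm `‖f‖_s = ∫ |ξ|^s |f̂(ξ)| dξ`, with values in `[0, ∞]`. -/
def sNorm {d : ℕ} (s : ℝ) (f : L2 d) : ℝ≥0∞ :=
  ∫⁻ ξ : E d, ‖ξ‖ₑ ^ s * ‖fhat f ξ‖ₑ

/-- The norm of `Ḟ^{s,p}`: `(∫ |ξ|^(s p) |f̂(ξ)|^p dξ)^(1/p)`, with values in `[0, ∞]`. -/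
def fNorm {d : ℕ} (s p : ℝ) (f : L2 d) : ℝ≥0∞ :=
  (∫⁻ ξ : E d, ‖ξ‖ₑ ^ (s * p) * ‖fhat f ξ‖ₑ ^ p) ^ (1 / p)

/-- The dyadic shell `C_k = {ξ : 2^(k-1) ≤ |ξ| < 2^k}`. -/
def shell (d : ℕ) (k : ℤ) : Set (E d) :=
  {ξ | (2 : ℝ) ^ (k - 1) ≤ ‖ξ‖ ∧ ‖ξ‖ < (2 : ℝ) ^ k}

/-- The Besov-type norm `‖f‖_{s,∞} = sup_k ∫_{C_k} |ξ|^s |f̂(ξ)| dξ`, with values in `[0, ∞]`. -/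
def besovNorm {d : ℕ} (s : ℝ) (f : L2 d) : ℝ≥0∞ :=
  ⨆ k : ℤ, ∫⁻ ξ in shell d k, ‖ξ‖ₑ ^ s * ‖fhat f ξ‖ₑ

/-- The function `f₂(y) = ∑_{j ≥ 1} (j+1)³ / j! · y^j` (the summation index is shifted by one). -/
def f2 (y : ℝ) : ℝ :=
  ∑' j : ℕ, ((j : ℝ) + 2) ^ 3 / ((j + 1).factorial : ℝ) * y ^ (j + 1)

/-- `u = Δ f` in the sense of distributions, for `f ∈ L²` and `u` bounded and continuous. -/
def IsLaplacian {d : ℕ} (f : L2 d) (u : E d →ᵇ ℝ) : Prop :=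
  ∀ φ : 𝓢(E d, ℝ), ∫ x, u x * φ x = ∫ x, f x * Laplacian.laplacian φ x

/-- `h` is a global solution of `h_t = Δ e^{-Δ h}` on `[0, ∞) × ℝ^d` with initial data `h₀`
(only the values `h t` for `t ≥ 0` matter). -/
structure IsSolution {d : ℕ} (h₀ : L2 d) (h : ℝ → L2 d) : Prop where
  /-- `h ∈ C⁰([0, ∞); L²)`. -/
  continuousOn : ContinuousOn h (Ici 0)
  /-- The initial condition. -/
  initial : h 0 = h₀
  /-- `‖h(t)‖_2` is bounded on bounded time intervals. -/
  locally_bounded : ∀ T : ℝ, 0 ≤ T → ∃ M : ℝ≥0, ∀ t ∈ Icc 0 T, sNorm 2 (h t) ≤ M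
  /-- `‖h(t)‖_6` is integrable on bounded time intervals. -/
  locally_integrable : ∀ T : ℝ, 0 ≤ T → ∫⁻ t in Icc 0 T, sNorm 6 (h t) < ∞
  /-- The equation, in the sense of distributions and integrated in time; `u t` is `Δ h(t)`. -/
  equation : ∃ u : ℝ → (E d →ᵇ ℝ), (∀ t, 0 ≤ t → IsLaplacian (h t) (u t)) ∧
    ∀ φ : 𝓢(E d, ℝ), ∀ t : ℝ, 0 ≤ t →
      IntervalIntegrable
        (fun τ => ∫ x, Real.exp (-(u τ x)) * Laplacian.laplacian φ x) volume 0 t ∧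
      ∫ x, h t x * φ x = (∫ x, h₀ x * φ x) +
        ∫ τ in (0 : ℝ)..t, ∫ x, Real.exp (-(u τ x)) * Laplacian.laplacian φ x

end ExpPDE

end

open ExpPDE

/-!
On the Fourier side the equation `h_t = Δ e^{-Δh}` becomes
`g_t = -|2πξ|⁴ g - |2πξ|² ∑_{j ≥ 2} (|2πξ|² g)^{*j} / j!`: a biharmonic heat equation whose
nonlinearity is a power series in convolutions. All estimates are made for the *majorant*, the
solution of the same equation with every sign made favourable, hence with values in `[0, ∞]`. Its
Picard iteration increases, so all limits exist by monotone convergence, and it dominates the Picard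
iteration for the solution together with its increments (`Dom`), which gives convergence at almost
every frequency (`exists_mild`).

The critical norm of the majorant is controlled through the triangle inequality for `|ξ|`, applied to
the weight `|2πξ|⁴`: `∫ |2πξ|⁴ (nonlinearity) ≤ f₂(y) ∫ |2πξ|⁶ g` with `y = ∫ |2πξ|² g`
(`lintegral_wt_four_expTail_le`). If `f₂(y) < 1` the dissipation absorbs the nonlinearity and `y` does
not grow (`lintegral_wt_two_maj_le`); this is the dissipation inequality of the theorem.

For the other norms, the weighted `L^p` norm of the nonlinearity splits into a part that carries the
whole weight, with a coefficient that is small with the critical norm, and a part in which enough of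
the weight is moved to a second factor to be paid for by the dissipation of the critical norm
(`exists_lpn_wt_expTail_le`). Maximal regularity of the linear equation (`duhamel_rpow_le`) absorbs
the first part, and Gronwall's inequality takes care of the second, because that dissipation is
integrable over all times (`exists_energy_majLim_le`). This bounds the `s`-norms and the `Ḟ^{s,p}`
norms without any smallness of those norms.

The nonlinearity is a contraction in the critical norm, after integration in time. Hence two
solutions with the same data coincide as long as they are close, and by continuity in time they never
separate if one of them is small (`FourierSol.unique`). The Fourier transform of an arbitrary
distributional solution satisfies the integrated equation at almost every frequency
(`IsSolution.exists_fourierSol`), so uniqueness on the Fourier side is enough; it also transfers all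
bounds for the constructed solution to an arbitrary one.

For the decay, the nonlinear part of `ĥ(t)` is bounded pointwise, uniformly in time, through the
energies at `p = 2` (`exists_enorm_fhat_le`). A bounded function has a finite norm `‖·‖_{-d,∞}`, so
this norm of `h(t)` stays bounded. Splitting the frequencies at `|ξ| = 2^K` gives
`‖h‖_s ≤ C 2^{K(s+d)} + 2^{-4K} ‖h‖_{s+4}` (`exists_lintegral_rpow_mul_le`). Averaging over `[t/2, t]`
with the smoothing estimate, and choosing `2^{4K}` of the order of `1/t`, yields
`‖h(t)‖_s ≤ C t^{-(s+d)/4} + ε ‖h(t/2)‖_s`, which is iterated over dyadic times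
(`le_rpow_of_le_half`).
-/

open MeasureTheory Set
open scoped ENNReal NNReal SchwartzMap BoundedContinuousFunction

noncomputable section

namespace ExpPDE

section

/-! ### Convolution powers of nonnegative functions -/

/-- The convolution of two `[0, ∞]`-valued functions. -/
def conv {d : ℕ} (f g : E d → ℝ≥0∞) (x : E d) : ℝ≥0∞ := ∫⁻ y, f y * g (x - y)

/-- The convolution power `f^{*(n+1)}`. -/
def convPow {d : ℕ} (f : E d → ℝ≥0∞) : ℕ → E d → ℝ≥0∞
  | 0 => f
  | n + 1 => conv f (convPow f n)

/-- The nonlinear part `∑_{j ≥ 2} f^{*j} / j!` of the convolution exponential. -/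
def expTail {d : ℕ} (f : E d → ℝ≥0∞) (x : E d) : ℝ≥0∞ :=
  ∑' n : ℕ, ((n + 2).factorial : ℝ≥0∞)⁻¹ * convPow f (n + 1) x

section

variable {d : ℕ} {α : Type*} [MeasurableSpace α]

lemma measurable_conv_param {f g : α → E d → ℝ≥0∞} (hf : Measurable (Function.uncurry f))
    (hg : Measurable (Function.uncurry g)) :
    Measurable (Function.uncurry fun a => conv (f a) (g a)) := by
  unfold conv
  have h1 : Measurable fun p : (α × E d) × E d => f p.1.1 p.2 * g p.1.1 (p.1.2 - p.2) :=
    (hf.comp (by fun_prop : Measurable fun p : (α × E d) × E d => (p.1.1, p.2))).mul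
      (hg.comp (by fun_prop : Measurable fun p : (α × E d) × E d => (p.1.1, p.1.2 - p.2)))
  exact h1.lintegral_prod_right'

lemma measurable_convPow_param {f : α → E d → ℝ≥0∞} (hf : Measurable (Function.uncurry f))
    (n : ℕ) : Measurable (Function.uncurry fun a => convPow (f a) n) := by
  induction n with
  | zero => exact hf
  | succ n ih => exact measurable_conv_param hf ih

lemma measurable_expTail_param {f : α → E d → ℝ≥0∞} (hf : Measurable (Function.uncurry f)) :
    Measurable (Function.uncurry fun a => expTail (f a)) := by
  have : (Function.uncurry fun a => expTail (f a)) = fun p : α × E d =>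
      ∑' n : ℕ, ((n + 2).factorial : ℝ≥0∞)⁻¹ * convPow (f p.1) (n + 1) p.2 := by
    ext p; rfl
  rw [this]
  exact Measurable.tsum fun n =>
    ((measurable_convPow_param hf (n + 1)).const_mul _)

end

variable {d : ℕ}

lemma measurable_conv {f g : E d → ℝ≥0∞} (hf : Measurable f) (hg : Measurable g) :
    Measurable (conv f g) := by
  unfold conv
  have h1 : Measurable fun p : E d × E d => f p.2 * g (p.1 - p.2) := by fun_prop
  exact h1.lintegral_prod_right'

lemma measurable_convPow {f : E d → ℝ≥0∞} (hf : Measurable f) (n : ℕ) :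
    Measurable (convPow f n) := by
  induction n with
  | zero => exact hf
  | succ n ih => exact measurable_conv hf ih

lemma measurable_expTail {f : E d → ℝ≥0∞} (hf : Measurable f) : Measurable (expTail f) :=
  Measurable.tsum fun n => (measurable_convPow hf (n + 1)).const_mul _

lemma conv_mono {f f' g g' : E d → ℝ≥0∞} (hf : f ≤ f') (hg : g ≤ g') :
    conv f g ≤ conv f' g' := fun _ =>
  lintegral_mono fun _ => mul_le_mul' (hf _) (hg _)

lemma convPow_mono {f f' : E d → ℝ≥0∞} (hf : f ≤ f') (n : ℕ) : convPow f n ≤ convPow f' n := by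
  induction n with
  | zero => exact hf
  | succ n ih => exact conv_mono hf ih

lemma expTail_mono {f f' : E d → ℝ≥0∞} (hf : f ≤ f') : expTail f ≤ expTail f' := fun x =>
  ENNReal.tsum_le_tsum fun n => by gcongr; exact convPow_mono hf _ x

lemma iSup_mul_iSup_of_monotone {f g : ℕ → ℝ≥0∞} (hf : Monotone f) (hg : Monotone g) :
    (⨆ n, f n) * (⨆ n, g n) = ⨆ n, f n * g n := by
  refine le_antisymm ?_ (iSup_le fun n => mul_le_mul' (le_iSup f n) (le_iSup g n))
  simp_rw [ENNReal.iSup_mul, ENNReal.mul_iSup]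
  exact iSup_le fun i => iSup_le fun j => le_iSup_of_le (max i j)
    (mul_le_mul' (hf (le_max_left _ _)) (hg (le_max_right _ _)))

lemma tsum_iSup_of_monotone {f : ℕ → ℕ → ℝ≥0∞} (hf : Monotone f) :
    ∑' k, ⨆ n, f n k = ⨆ n, ∑' k, f n k := by
  simp_rw [← lintegral_count]
  exact lintegral_iSup (fun n => measurable_of_countable _) hf

/-- A monotone limit can be taken in both factors of a convolution. -/
lemma conv_iSup {f g : ℕ → E d → ℝ≥0∞} (hf : ∀ n, Measurable (f n)) (hg : ∀ n, Measurable (g n))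
    (mf : Monotone f) (mg : Monotone g) :
    conv (fun x => ⨆ n, f n x) (fun x => ⨆ n, g n x) = fun x => ⨆ n, conv (f n) (g n) x := by
  ext x
  unfold conv
  rw [← lintegral_iSup]
  · refine lintegral_congr fun y => ?_
    exact iSup_mul_iSup_of_monotone (fun a b h => mf h y) (fun a b h => mg h (x - y))
  · exact fun n => (hf n).mul ((hg n).comp (by fun_prop))
  · exact fun a b h y => mul_le_mul' (mf h y) (mg h _)

lemma convPow_iSup {f : ℕ → E d → ℝ≥0∞} (hf : ∀ n, Measurable (f n)) (mf : Monotone f) (k : ℕ) :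
    convPow (fun x => ⨆ n, f n x) k = fun x => ⨆ n, convPow (f n) k x := by
  induction k with
  | zero => rfl
  | succ k ih =>
    simp only [convPow, ih]
    exact conv_iSup hf (fun n => measurable_convPow (hf n) k) mf
      fun a b h => convPow_mono (mf h) k

lemma expTail_iSup {f : ℕ → E d → ℝ≥0∞} (hf : ∀ n, Measurable (f n)) (mf : Monotone f) :
    expTail (fun x => ⨆ n, f n x) = fun x => ⨆ n, expTail (f n) x := by
  ext x
  simp only [expTail, convPow_iSup hf mf, ENNReal.mul_iSup]
  exact tsum_iSup_of_monotone fun a b h k => by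
    dsimp only
    gcongr
    exact convPow_mono (mf h) _ x

/-! ### Integrals of convolutions -/

lemma lintegral_mul_conv {f g Φ : E d → ℝ≥0∞} (hf : Measurable f) (hg : Measurable g)
    (hΦ : Measurable Φ) :
    ∫⁻ x, Φ x * conv f g x = ∫⁻ y, ∫⁻ z, Φ (y + z) * (f y * g z) := by
  unfold conv
  have h1 : ∀ x, Φ x * ∫⁻ y, f y * g (x - y) = ∫⁻ y, Φ x * (f y * g (x - y)) := fun x => by
    rw [lintegral_const_mul]
    fun_prop
  simp_rw [h1]
  rw [lintegral_lintegral_swap (by fun_prop)]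
  refine lintegral_congr fun y => ?_
  rw [← lintegral_add_left_eq_self _ y]
  simp

lemma lintegral_conv {f g : E d → ℝ≥0∞} (hf : Measurable f) (hg : Measurable g) :
    ∫⁻ x, conv f g x = (∫⁻ x, f x) * ∫⁻ x, g x := by
  have := lintegral_mul_conv hf hg (measurable_const (a := (1 : ℝ≥0∞)))
  simp only [one_mul] at this
  rw [this]
  simp_rw [lintegral_const_mul _ hg]
  rw [lintegral_mul_const _ hf]

lemma lintegral_convPow {f : E d → ℝ≥0∞} (hf : Measurable f) (n : ℕ) :
    ∫⁻ x, convPow f n x = (∫⁻ x, f x) ^ (n + 1) := by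
  induction n with
  | zero => simp [convPow]
  | succ n ih =>
    simp only [convPow]
    rw [lintegral_conv hf (measurable_convPow hf n), ih, ← pow_succ']

lemma conv_comm (f g : E d → ℝ≥0∞) : conv f g = conv g f := by
  ext x
  unfold conv
  rw [← lintegral_sub_left_eq_self _ x]
  simp [mul_comm]

/-- Jensen's inequality in the form of Hölder's inequality for the weight `k`. -/
lemma lintegral_mul_rpow_le {α : Type*} [MeasurableSpace α] {μ : Measure α} {k n : α → ℝ≥0∞}
    (hk : AEMeasurable k μ) (hn : AEMeasurable n μ) {p : ℝ} (hp : 1 ≤ p) :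
    (∫⁻ x, k x * n x ∂μ) ^ p ≤ (∫⁻ x, k x ∂μ) ^ (p - 1) * ∫⁻ x, k x * n x ^ p ∂μ := by
  have hp0 : 0 < p := by linarith
  have h := ENNReal.lintegral_mul_norm_pow_le (μ := μ) (f := k) (g := fun x => k x * n x ^ p)
    hk (hk.mul (hn.pow_const p)) (p := 1 - 1 / p) (q := 1 / p)
    (by rw [sub_nonneg, div_le_one hp0]; exact hp) (by positivity) (by ring)
  have h2 : ∀ x, k x ^ (1 - 1 / p) * (k x * n x ^ p) ^ (1 / p) = k x * n x := fun x => by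
    rw [ENNReal.mul_rpow_of_nonneg _ _ (by positivity), ← ENNReal.rpow_mul,
      mul_one_div_cancel hp0.ne', ENNReal.rpow_one, ← mul_assoc, ← ENNReal.rpow_add_of_nonneg]
    · simp
    · rw [sub_nonneg, div_le_one hp0]; exact hp
    · positivity
  simp_rw [h2] at h
  calc (∫⁻ x, k x * n x ∂μ) ^ p
      ≤ ((∫⁻ x, k x ∂μ) ^ (1 - 1 / p) * (∫⁻ x, k x * n x ^ p ∂μ) ^ (1 / p)) ^ p := by gcongr
    _ = _ := by
      rw [ENNReal.mul_rpow_of_nonneg _ _ hp0.le, ← ENNReal.rpow_mul, ← ENNReal.rpow_mul,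
        one_div_mul_cancel hp0.ne', ENNReal.rpow_one]
      congr 2
      field_simp

/-- The `L^p` norm of a `[0, ∞]`-valued function. -/
def lpn {d : ℕ} (p : ℝ) (f : E d → ℝ≥0∞) : ℝ≥0∞ := (∫⁻ x, f x ^ p) ^ (1 / p)

lemma lpn_mono {p : ℝ} (hp : 0 < p) {f g : E d → ℝ≥0∞} (h : ∀ᵐ x, f x ≤ g x) :
    lpn p f ≤ lpn p g := by
  unfold lpn
  refine ENNReal.rpow_le_rpow (lintegral_mono_ae ?_) (by positivity)
  filter_upwards [h] with x hx using ENNReal.rpow_le_rpow hx hp.le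

lemma lpn_add_le {p : ℝ} (hp : 1 ≤ p) {f g : E d → ℝ≥0∞} (hf : Measurable f) (hg : Measurable g) :
    lpn p (fun x => f x + g x) ≤ lpn p f + lpn p g :=
  ENNReal.lintegral_Lp_add_le hf.aemeasurable hg.aemeasurable hp

lemma lpn_const_mul {p : ℝ} (hp : 0 < p) (c : ℝ≥0∞) {f : E d → ℝ≥0∞} (hf : Measurable f) :
    lpn p (fun x => c * f x) = c * lpn p f := by
  unfold lpn
  simp_rw [ENNReal.mul_rpow_of_nonneg _ _ hp.le]
  rw [lintegral_const_mul _ (hf.pow_const p), ENNReal.mul_rpow_of_nonneg _ _ (by positivity),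
    ← ENNReal.rpow_mul, mul_one_div_cancel hp.ne', ENNReal.rpow_one]

lemma lpn_tsum_le {p : ℝ} (hp : 1 ≤ p) {f : ℕ → E d → ℝ≥0∞} (hf : ∀ n, Measurable (f n)) :
    lpn p (fun x => ∑' n, f n x) ≤ ∑' n, lpn p (f n) := by
  have hp0 : 0 < p := by linarith
  have hfin : ∀ N : ℕ, lpn p (fun x => ∑ n ∈ Finset.range N, f n x) ≤
      ∑ n ∈ Finset.range N, lpn p (f n) := fun N => by
    induction N with
    | zero => simp [lpn, hp0]
    | succ N ih =>
      simp_rw [Finset.sum_range_succ]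
      exact (lpn_add_le hp (Finset.measurable_fun_sum _ fun i _ => hf i) (hf N)).trans
        (add_le_add_left ih _)
  have hmono : Monotone fun N : ℕ => fun x => (∑ n ∈ Finset.range N, f n x) ^ p :=
    fun a b h x => ENNReal.rpow_le_rpow
      (Finset.sum_le_sum_of_subset (Finset.range_mono h)) hp0.le
  have h1 : ∀ x, (∑' n, f n x) ^ p = ⨆ N, (∑ n ∈ Finset.range N, f n x) ^ p := fun x => by
    rw [ENNReal.tsum_eq_iSup_nat]
    exact (ENNReal.orderIsoRpow p hp0).map_iSup _
  unfold lpn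
  simp_rw [h1]
  rw [lintegral_iSup (fun N => (Finset.measurable_fun_sum _ fun i _ => hf i).pow_const p) hmono]
  have h2 : ∀ u : ℕ → ℝ≥0∞, (⨆ N, u N) ^ (1 / p) = ⨆ N, u N ^ (1 / p) := fun u =>
    (ENNReal.orderIsoRpow (1 / p) (by positivity)).map_iSup _
  rw [h2]
  exact iSup_le fun N => (hfin N).trans (ENNReal.sum_le_tsum _)

/-- Young's inequality. -/
lemma lpn_conv_le {p : ℝ} (hp : 1 ≤ p) {f g : E d → ℝ≥0∞} (hf : Measurable f)
    (hg : Measurable g) : lpn p (conv f g) ≤ (∫⁻ x, f x) * lpn p g := by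
  have hp0 : 0 < p := by linarith
  have h : ∫⁻ x, conv f g x ^ p ≤ (∫⁻ x, f x) ^ p * ∫⁻ x, g x ^ p := by
    calc ∫⁻ x, conv f g x ^ p
        ≤ ∫⁻ x, (∫⁻ y, f y) ^ (p - 1) * conv f (fun z => g z ^ p) x := by
          refine lintegral_mono fun x => ?_
          exact lintegral_mul_rpow_le hf.aemeasurable (by fun_prop) hp
      _ = (∫⁻ y, f y) ^ (p - 1) * ((∫⁻ x, f x) * ∫⁻ x, g x ^ p) := by
          rw [lintegral_const_mul _ (measurable_conv hf (hg.pow_const p)),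
            lintegral_conv hf (hg.pow_const p)]
      _ = _ := by
          rw [← mul_assoc]
          congr 1
          nth_rw 2 [← ENNReal.rpow_one (∫⁻ x, f x)]
          rw [← ENNReal.rpow_add_of_nonneg _ _ (by linarith) zero_le_one]
          simp
  unfold lpn
  calc _ ≤ ((∫⁻ x, f x) ^ p * ∫⁻ x, g x ^ p) ^ (1 / p) := by gcongr
    _ = _ := by
      rw [ENNReal.mul_rpow_of_nonneg _ _ (by positivity), ← ENNReal.rpow_mul,
        mul_one_div_cancel hp0.ne', ENNReal.rpow_one]

/-! ### Scalar inequalities for powers of sums -/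

/-- A quasi-triangle inequality for `q`-th powers: if neither summand dominates, they are
comparable, and the powers can be moved freely between them. -/
lemma exists_add_rpow_le (q θ : ℝ) (hq : 0 ≤ q) (hθ : 0 ≤ θ) :
    ∃ K : ℝ≥0, ∀ a b : ℝ≥0∞, a ≠ ⊤ → b ≠ ⊤ →
      (a + b) ^ q ≤ 2 * a ^ q + 2 * b ^ q + K * (a ^ (q - θ) * b ^ θ) := by
  -- `1 + ε` is chosen so that `(1 + ε) ^ q ≤ 2`
  obtain ⟨ε, hε0, hε⟩ : ∃ ε : ℝ≥0, 0 < ε ∧ (1 + ε : ℝ≥0) ^ q ≤ 2 := by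
    have h1 : (1 : ℝ≥0) < 2 ^ (1 / (q + 1)) :=
      NNReal.one_lt_rpow (by norm_num) (by positivity)
    refine ⟨2 ^ (1 / (q + 1)) - 1, tsub_pos_of_lt h1, ?_⟩
    rw [add_tsub_cancel_of_le h1.le, ← NNReal.rpow_mul]
    calc (2 : ℝ≥0) ^ (1 / (q + 1) * q) ≤ 2 ^ (1 : ℝ) := by
          refine NNReal.rpow_le_rpow_of_exponent_le (by norm_num) ?_
          rw [one_div_mul_eq_div, div_le_one (by positivity)]
          linarith
      _ = 2 := NNReal.rpow_one _
  have hε' : (1 + (ε : ℝ≥0∞)) ^ q ≤ 2 := by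
    have : ((1 + ε : ℝ≥0) : ℝ≥0∞) ^ q ≤ ((2 : ℝ≥0) : ℝ≥0∞) := by
      rw [← ENNReal.coe_rpow_of_nonneg _ hq]
      exact_mod_cast hε
    simpa using this
  have hεne : (ε : ℝ≥0∞) ≠ 0 := by exact_mod_cast hε0.ne'
  refine ⟨(1 + ε⁻¹) ^ q * (ε⁻¹) ^ θ, fun a b ha hb => ?_⟩
  by_cases h1 : a + b ≤ (1 + ε) * a
  · calc (a + b) ^ q ≤ ((1 + ε) * a) ^ q := by gcongr
      _ = (1 + ε) ^ q * a ^ q := ENNReal.mul_rpow_of_nonneg _ _ hq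
      _ ≤ 2 * a ^ q := by gcongr
      _ ≤ _ := by rw [add_assoc]; exact le_self_add
  by_cases h2 : a + b ≤ (1 + ε) * b
  · calc (a + b) ^ q ≤ ((1 + ε) * b) ^ q := by gcongr
      _ = (1 + ε) ^ q * b ^ q := ENNReal.mul_rpow_of_nonneg _ _ hq
      _ ≤ 2 * b ^ q := by gcongr
      _ ≤ _ := by rw [add_right_comm]; exact le_add_self
  push Not at h1 h2
  rw [add_mul, one_mul] at h1 h2
  have h1' : ε * a < b := lt_of_add_lt_add_left h1
  have h2' : ε * b < a := by rw [add_comm a b] at h2; exact lt_of_add_lt_add_left h2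
  have ha0 : a ≠ 0 := (pos_of_gt h2').ne'
  have key : ∀ u v : ℝ≥0∞, ε * u < v → u ≤ (ε⁻¹ : ℝ≥0) * v := fun u v h => by
    calc u = (ε⁻¹ : ℝ≥0) * (ε * u) := by
          rw [← mul_assoc, ← ENNReal.coe_mul, inv_mul_cancel₀ hε0.ne']; simp
      _ ≤ _ := by gcongr
  have hb1 := key b a h2'
  have ha1 := key a b h1'
  calc (a + b) ^ q ≤ (((1 + ε⁻¹ : ℝ≥0) : ℝ≥0∞) * a) ^ q := by
        gcongr
        rw [ENNReal.coe_add, ENNReal.coe_one, add_mul, one_mul]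
        gcongr
    _ = ((1 + ε⁻¹ : ℝ≥0) : ℝ≥0∞) ^ q * (a ^ (q - θ) * a ^ θ) := by
        rw [ENNReal.mul_rpow_of_nonneg _ _ hq, ← ENNReal.rpow_add _ _ ha0 ha]
        simp
    _ ≤ ((1 + ε⁻¹ : ℝ≥0) : ℝ≥0∞) ^ q * (a ^ (q - θ) * ((ε⁻¹ : ℝ≥0) * b) ^ θ) := by gcongr
    _ = (((1 + ε⁻¹) ^ q * (ε⁻¹) ^ θ : ℝ≥0) : ℝ≥0∞) * (a ^ (q - θ) * b ^ θ) := by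
        rw [ENNReal.mul_rpow_of_nonneg _ _ hθ, ENNReal.coe_mul, ENNReal.coe_rpow_of_nonneg _ hq,
          ENNReal.coe_rpow_of_nonneg _ hθ]
        ring
    _ ≤ _ := le_add_self

lemma add_rpow_le_of_le_four {q : ℝ} (hq1 : 1 ≤ q) (hq4 : q ≤ 4) (n : ℕ) (a b : ℝ≥0∞) :
    (a + b) ^ q ≤ ((n + 2 : ℝ≥0∞) / (n + 1)) ^ 3 * a ^ q + (n + 2 : ℝ≥0∞) ^ 3 * b ^ q := by
  have hn1 : (n + 1 : ℝ≥0∞) ≠ 0 := by simp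
  have hn2 : (n + 2 : ℝ≥0∞) ≠ 0 := by simp
  have hn1' : (n + 1 : ℝ≥0∞) ≠ ⊤ := by finiteness
  have hn2' : (n + 2 : ℝ≥0∞) ≠ ⊤ := by finiteness
  -- convexity with weights `(n + 1) / (n + 2)` and `1 / (n + 2)`
  set u : ℝ≥0∞ := (n + 2) / (n + 1) with hu
  have hu1 : 1 ≤ u := by
    rw [hu, ENNReal.le_div_iff_mul_le (Or.inl hn1) (Or.inl hn1'), one_mul]
    gcongr; norm_num
  have hu0 : u ≠ 0 := (lt_of_lt_of_le one_pos hu1).ne'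
  have hut : u ≠ ⊤ := ENNReal.div_ne_top hn2' hn1
  have hv1 : (1 : ℝ≥0∞) ≤ n + 2 := by
    calc (1 : ℝ≥0∞) ≤ 2 := by norm_num
      _ ≤ _ := le_add_self
  have hw : u⁻¹ + (n + 2 : ℝ≥0∞)⁻¹ = 1 := by
    rw [hu, ENNReal.inv_div (Or.inl hn1') (Or.inl hn1), ← one_div, ENNReal.div_add_div_same,
      add_assoc, one_add_one_eq_two]
    exact ENNReal.div_self hn2 hn2'
  have h := ENNReal.rpow_arith_mean_le_arith_mean2_rpow u⁻¹ (n + 2 : ℝ≥0∞)⁻¹ (u * a)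
    ((n + 2 : ℝ≥0∞) * b) hw hq1
  rw [← mul_assoc, ← mul_assoc, ENNReal.inv_mul_cancel hu0 hut, ENNReal.inv_mul_cancel hn2 hn2',
    one_mul, one_mul] at h
  have key : ∀ w c : ℝ≥0∞, 1 ≤ w → w ≠ ⊤ → w⁻¹ * (w * c) ^ q ≤ w ^ 3 * c ^ q := fun w c h1 h2 => by
    have h0 : w ≠ 0 := (lt_of_lt_of_le one_pos h1).ne'
    rw [ENNReal.mul_rpow_of_nonneg _ _ (by linarith), ← mul_assoc]
    gcongr
    calc w⁻¹ * w ^ q ≤ w⁻¹ * w ^ (4 : ℝ) := by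
          gcongr
      _ = w⁻¹ * (w * w ^ 3) := by
          rw [← pow_succ']
          norm_cast
      _ = w ^ 3 := by rw [← mul_assoc, ENNReal.inv_mul_cancel h0 h2, one_mul]
  exact h.trans (add_le_add (key u a hu1 hut) (key _ b hv1 hn2'))

end

section

variable {d : ℕ}

/-! ### Weighted bounds for the nonlinearity -/

/-- The frequency `2π|ξ|` with values in `[0, ∞]`. -/
def rho (ξ : E d) : ℝ≥0∞ := ENNReal.ofReal (2 * Real.pi * ‖ξ‖)

/-- The function `|2πξ|^s f(ξ)`. -/
def wt (s : ℝ) (f : E d → ℝ≥0∞) (ξ : E d) : ℝ≥0∞ := rho ξ ^ s * f ξ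

/-- The function `y ↦ ∑_{j ≥ 1} (j+1)³ / j! · y^j` on `[0, ∞]`. -/
def f2e (y : ℝ≥0∞) : ℝ≥0∞ :=
  ∑' n : ℕ, ((n : ℝ≥0∞) + 2) ^ 3 * ((n + 1).factorial : ℝ≥0∞)⁻¹ * y ^ (n + 1)

@[fun_prop]
lemma measurable_rho : Measurable (rho : E d → ℝ≥0∞) := by
  unfold rho; fun_prop

lemma measurable_wt (s : ℝ) {f : E d → ℝ≥0∞} (hf : Measurable f) : Measurable (wt s f) := by
  unfold wt; fun_prop

lemma rho_ne_top (ξ : E d) : rho ξ ≠ ⊤ := ENNReal.ofReal_ne_top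

lemma rho_add_le (ξ η : E d) : rho (ξ + η) ≤ rho ξ + rho η := by
  unfold rho
  rw [← ENNReal.ofReal_add (by positivity) (by positivity), ← mul_add]
  gcongr
  exact norm_add_le _ _

lemma rho_eq_zero_iff {ξ : E d} : rho ξ = 0 ↔ ξ = 0 := by
  unfold rho
  rw [ENNReal.ofReal_eq_zero]
  constructor
  · intro h
    have : ‖ξ‖ ≤ 0 := by
      by_contra hc
      push Not at hc
      have := mul_pos (mul_pos two_pos Real.pi_pos) hc
      linarith
    simpa using this
  · rintro rfl; simp

lemma ae_ne_zero (hd : 1 ≤ d) : ∀ᵐ ξ : E d, ξ ≠ 0 := by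
  have : Nonempty (Fin d) := ⟨⟨0, hd⟩⟩
  have : (volume : Measure (E d)) {0} = 0 := measure_singleton 0
  rw [ae_iff]
  simp

lemma ae_rho_ne_zero (hd : 1 ≤ d) : ∀ᵐ ξ : E d, rho ξ ≠ 0 := by
  filter_upwards [ae_ne_zero hd] with ξ hξ
  rwa [Ne, rho_eq_zero_iff]

lemma wt_mono (s : ℝ) {f g : E d → ℝ≥0∞} (h : f ≤ g) : wt s f ≤ wt s g := fun ξ =>
  mul_le_mul' le_rfl (h ξ)

lemma wt_wt {s r : ℝ} {f : E d → ℝ≥0∞} {ξ : E d} (h : rho ξ ≠ 0) :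
    wt s (wt r f) ξ = wt (s + r) f ξ := by
  unfold wt
  rw [ENNReal.rpow_add _ _ h (rho_ne_top _), mul_assoc]

/-- The weighted `L¹` bound for convolution powers, with the polynomial factor that produces `f₂`: the
pointwise inequality `(a + b)^q ≤ ((n+2)/(n+1))³ a^q + (n+2)³ b^q` makes the factor `(n+1)⁴` exact
along the induction. -/
lemma lintegral_wt_convPow_le {f : E d → ℝ≥0∞} (hf : Measurable f) {q : ℝ} (hq1 : 1 ≤ q)
    (hq4 : q ≤ 4) (n : ℕ) :
    ∫⁻ ξ, wt q (convPow f n) ξ ≤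
      ((n : ℝ≥0∞) + 1) ^ 4 * (∫⁻ ξ, wt q f ξ) * (∫⁻ ξ, f ξ) ^ n := by
  induction n with
  | zero => simp [convPow]
  | succ n ih =>
    set y := ∫⁻ ξ, f ξ
    set u : ℝ≥0∞ := (n + 2) / (n + 1) with hu
    have hF := measurable_convPow hf n
    have hn1 : (n + 1 : ℝ≥0∞) ≠ 0 := by simp
    have hn1' : (n + 1 : ℝ≥0∞) ≠ ⊤ := by finiteness
    have hun : u * (n + 1) = n + 2 := ENNReal.div_mul_cancel hn1 hn1'
    calc ∫⁻ ξ, wt q (convPow f (n + 1)) ξ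
        = ∫⁻ η, ∫⁻ ζ, rho (η + ζ) ^ q * (f η * convPow f n ζ) :=
          lintegral_mul_conv hf hF (by fun_prop)
      _ ≤ ∫⁻ η, ∫⁻ ζ, (u ^ 3 * (f η * wt q (convPow f n) ζ) +
            (n + 2) ^ 3 * (wt q f η * convPow f n ζ)) := by
          refine lintegral_mono fun η => lintegral_mono fun ζ => ?_
          calc rho (η + ζ) ^ q * (f η * convPow f n ζ)
              ≤ (rho ζ + rho η) ^ q * (f η * convPow f n ζ) := by
                gcongr
                rw [add_comm (rho ζ)]
                exact rho_add_le _ _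
            _ ≤ (u ^ 3 * rho ζ ^ q + (n + 2) ^ 3 * rho η ^ q) * (f η * convPow f n ζ) := by
                gcongr
                exact add_rpow_le_of_le_four hq1 hq4 n _ _
            _ = _ := by unfold wt; ring
      _ = u ^ 3 * (y * ∫⁻ ζ, wt q (convPow f n) ζ) +
            (n + 2) ^ 3 * ((∫⁻ η, wt q f η) * y ^ (n + 1)) := by
          have m1 := measurable_wt q hF
          have m2 := measurable_wt q hf
          have e1 : ∀ η, ∫⁻ ζ, (u ^ 3 * (f η * wt q (convPow f n) ζ) +
              (n + 2) ^ 3 * (wt q f η * convPow f n ζ)) =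
              u ^ 3 * (f η * ∫⁻ ζ, wt q (convPow f n) ζ) +
              (n + 2) ^ 3 * (wt q f η * y ^ (n + 1)) := fun η => by
            rw [lintegral_add_left (by fun_prop), lintegral_const_mul _ (by fun_prop),
              lintegral_const_mul _ (by fun_prop), lintegral_const_mul _ (by fun_prop),
              lintegral_const_mul _ (by fun_prop), lintegral_convPow hf]
          simp_rw [e1]
          rw [lintegral_add_left (by fun_prop), lintegral_const_mul _ (by fun_prop),
            lintegral_const_mul _ (by fun_prop), lintegral_mul_const _ (by fun_prop),
            lintegral_mul_const _ (by fun_prop)]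
      _ ≤ u ^ 3 * (y * (((n : ℝ≥0∞) + 1) ^ 4 * (∫⁻ ξ, wt q f ξ) * y ^ n)) +
            (n + 2) ^ 3 * ((∫⁻ η, wt q f η) * y ^ (n + 1)) := by gcongr
      _ = ((u * (n + 1)) ^ 3 * (n + 1) + (n + 2) ^ 3) * (∫⁻ η, wt q f η) * y ^ (n + 1) := by ring
      _ = _ := by
          rw [hun]
          push_cast
          ring

lemma wt_expTail (q : ℝ) (f : E d → ℝ≥0∞) (ξ : E d) :
    wt q (expTail f) ξ =
      ∑' n : ℕ, ((n + 2).factorial : ℝ≥0∞)⁻¹ * wt q (convPow f (n + 1)) ξ := by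
  unfold wt expTail
  rw [← ENNReal.tsum_mul_left]
  refine tsum_congr fun n => ?_
  ring

/-- The bound that links the threshold `f₂(y) = 1` to the equation: for `y = ∫ |2πξ|² g`, the
nonlinearity is at most `f₂(y)` times the dissipation. -/
lemma lintegral_wt_four_expTail_le {f : E d → ℝ≥0∞} (hf : Measurable f) :
    ∫⁻ ξ, wt 4 (expTail f) ξ ≤ f2e (∫⁻ ξ, f ξ) * ∫⁻ ξ, wt 4 f ξ := by
  simp_rw [wt_expTail]
  rw [lintegral_tsum fun n =>
    ((measurable_wt 4 (measurable_convPow hf (n + 1))).const_mul _).aemeasurable]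
  unfold f2e
  rw [← ENNReal.tsum_mul_right]
  refine ENNReal.tsum_le_tsum fun n => ?_
  rw [lintegral_const_mul _ (measurable_wt 4 (measurable_convPow hf (n + 1)))]
  calc _ ≤ ((n + 2).factorial : ℝ≥0∞)⁻¹ * ((((n + 1 : ℕ) : ℝ≥0∞) + 1) ^ 4 * (∫⁻ ξ, wt 4 f ξ) *
        (∫⁻ ξ, f ξ) ^ (n + 1)) := by
        gcongr
        exact lintegral_wt_convPow_le hf (by norm_num) le_rfl (n + 1)
    _ = _ := by
      have h2 : ((n + 2).factorial : ℝ≥0∞)⁻¹ * (n + 2) = ((n + 1).factorial : ℝ≥0∞)⁻¹ := by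
        rw [Nat.factorial_succ, Nat.cast_mul, ENNReal.mul_inv (by simp) (by simp)]
        push_cast
        rw [add_assoc, one_add_one_eq_two, mul_right_comm, ENNReal.inv_mul_cancel (by simp)
          (by finiteness), one_mul]
      rw [← h2]
      push_cast
      ring

/-- The product rule with weights: the full weight falls on either factor, up to a term in which it is
shared between the two. -/
lemma lpn_wt_conv_le {p q θ : ℝ} (hp : 1 ≤ p) {K : ℝ≥0}
    (hK : ∀ a b : ℝ≥0∞, a ≠ ⊤ → b ≠ ⊤ →
      (a + b) ^ q ≤ 2 * a ^ q + 2 * b ^ q + K * (a ^ (q - θ) * b ^ θ)) (hq : 0 ≤ q)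
    {f g : E d → ℝ≥0∞} (hf : Measurable f) (hg : Measurable g) :
    lpn p (wt q (conv f g)) ≤ 2 * (lpn p (wt q f) * ∫⁻ ξ, g ξ) +
      2 * ((∫⁻ ξ, f ξ) * lpn p (wt q g)) +
      K * (lpn p (wt (q - θ) f) * ∫⁻ ξ, wt θ g ξ) := by
  have hp0 : 0 < p := by linarith
  have m1 := measurable_wt q hf
  have m2 := measurable_wt q hg
  have m3 := measurable_wt (q - θ) hf
  have m4 := measurable_wt θ hg
  have h : ∀ ξ, wt q (conv f g) ξ ≤ 2 * conv (wt q f) g ξ + 2 * conv f (wt q g) ξ +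
      K * conv (wt (q - θ) f) (wt θ g) ξ := fun ξ => by
    unfold conv wt
    rw [← lintegral_const_mul _ (by fun_prop), ← lintegral_const_mul _ (by fun_prop),
      ← lintegral_const_mul _ (by fun_prop), ← lintegral_const_mul _ (by fun_prop),
      ← lintegral_add_left (by fun_prop), ← lintegral_add_left (by fun_prop)]
    refine lintegral_mono fun η => ?_
    dsimp only
    calc rho ξ ^ q * (f η * g (ξ - η)) ≤ (rho η + rho (ξ - η)) ^ q * (f η * g (ξ - η)) := by
          gcongr
          simpa using rho_add_le η (ξ - η)
      _ ≤ (2 * rho η ^ q + 2 * rho (ξ - η) ^ q + K * (rho η ^ (q - θ) * rho (ξ - η) ^ θ)) *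
            (f η * g (ξ - η)) := by
          gcongr
          exact hK _ _ (rho_ne_top _) (rho_ne_top _)
      _ = _ := by ring
  have c1 := measurable_conv m1 hg
  have c2 := measurable_conv hf m2
  have c3 := measurable_conv m3 m4
  calc lpn p (wt q (conv f g)) ≤ lpn p (fun ξ => 2 * conv (wt q f) g ξ + 2 * conv f (wt q g) ξ +
      K * conv (wt (q - θ) f) (wt θ g) ξ) := lpn_mono hp0 (ae_of_all _ h)
    _ ≤ lpn p (fun ξ => 2 * conv (wt q f) g ξ) + lpn p (fun ξ => 2 * conv f (wt q g) ξ) +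
        lpn p (fun ξ => K * conv (wt (q - θ) f) (wt θ g) ξ) :=
      (lpn_add_le hp (by fun_prop) (by fun_prop)).trans
        (add_le_add_left (lpn_add_le hp (by fun_prop) (by fun_prop)) _)
    _ = 2 * lpn p (conv g (wt q f)) + 2 * lpn p (conv f (wt q g)) +
        K * lpn p (conv (wt θ g) (wt (q - θ) f)) := by
      rw [lpn_const_mul hp0 _ c1, lpn_const_mul hp0 _ c2, lpn_const_mul hp0 _ c3,
        conv_comm (wt q f), conv_comm (wt (q - θ) f)]
    _ ≤ 2 * ((∫⁻ ξ, g ξ) * lpn p (wt q f)) + 2 * ((∫⁻ ξ, f ξ) * lpn p (wt q g)) +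
        K * ((∫⁻ ξ, wt θ g ξ) * lpn p (wt (q - θ) f)) := by
      gcongr
      · exact lpn_conv_le hp hg m1
      · exact lpn_conv_le hp hf m2
      · exact lpn_conv_le hp m4 m3
    _ = _ := by rw [mul_comm (∫⁻ ξ, g ξ), mul_comm (∫⁻ ξ, wt θ g ξ)]

/-- The weighted `L^p` bound for convolution powers: one term carries the full weight and a factor
that is small with `∫ f`; in the other term part of the weight has been moved to a second factor. -/
lemma lpn_wt_convPow_le {p q θ : ℝ} (hp : 1 ≤ p) {K : ℝ≥0}
    (hK : ∀ a b : ℝ≥0∞, a ≠ ⊤ → b ≠ ⊤ →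
      (a + b) ^ q ≤ 2 * a ^ q + 2 * b ^ q + K * (a ^ (q - θ) * b ^ θ)) (hq : 0 ≤ q)
    (hθ1 : 1 ≤ θ) (hθ4 : θ ≤ 4) {f : E d → ℝ≥0∞} (hf : Measurable f) (hf1 : ∫⁻ ξ, f ξ ≤ 1)
    (n : ℕ) :
    lpn p (wt q (convPow f n)) ≤ (n + 1) * (2 * ∫⁻ ξ, f ξ) ^ n * lpn p (wt q f) +
      16 ^ n * (K * (lpn p (wt (q - θ) f) * ∫⁻ ξ, wt θ f ξ)) := by
  induction n with
  | zero => simp [convPow]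
  | succ n ih =>
    set y := ∫⁻ ξ, f ξ
    set T := ∫⁻ ξ, wt θ f ξ
    set z := lpn p (wt (q - θ) f)
    set x := lpn p (wt q f)
    have hn4 : ((n : ℝ≥0∞) + 1) ^ 4 ≤ 16 ^ n := by
      have : (n + 1) ^ 4 ≤ 16 ^ n := by
        calc (n + 1) ^ 4 ≤ (2 ^ n) ^ 4 := by gcongr; exact Nat.lt_two_pow_self
          _ = 16 ^ n := by rw [← pow_mul, mul_comm, pow_mul]; norm_num
      exact_mod_cast this
    calc lpn p (wt q (convPow f (n + 1)))
        ≤ 2 * (x * ∫⁻ ξ, convPow f n ξ) + 2 * (y * lpn p (wt q (convPow f n))) +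
          K * (z * ∫⁻ ξ, wt θ (convPow f n) ξ) :=
          lpn_wt_conv_le hp hK hq hf (measurable_convPow hf n)
      _ ≤ 2 * (x * y ^ (n + 1)) + 2 * (y * ((n + 1) * (2 * y) ^ n * x + 16 ^ n * (K * (z * T)))) +
          K * (z * (16 ^ n * T)) := by
          rw [lintegral_convPow hf]
          gcongr
          calc _ ≤ ((n : ℝ≥0∞) + 1) ^ 4 * T * y ^ n := lintegral_wt_convPow_le hf hθ1 hθ4 n
            _ ≤ 16 ^ n * T * 1 := by gcongr; exact pow_le_one₀ zero_le hf1
            _ = _ := mul_one _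
      _ ≤ (2 * (x * y ^ (n + 1)) * 2 ^ n) +
          2 * (y * ((n + 1) * (2 * y) ^ n * x) + 1 * (16 ^ n * (K * (z * T)))) +
          K * (z * (16 ^ n * T)) := by
          refine add_le_add (add_le_add ?_ ?_) le_rfl
          · exact le_mul_of_one_le_right' (one_le_pow₀ (by norm_num))
          · rw [mul_add]
            gcongr
      _ = (n + 2) * (2 * y) ^ (n + 1) * x + 3 * 16 ^ n * (K * (z * T)) := by
          rw [mul_pow, mul_pow]; ring
      _ ≤ _ := by
          rw [Nat.cast_add, Nat.cast_one, add_assoc (n : ℝ≥0∞), one_add_one_eq_two,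
            pow_succ (16 : ℝ≥0∞), mul_comm (3 : ℝ≥0∞)]
          gcongr
          norm_num

/-- The constant `∑ 16^(n+1) / (n+2)!`, a sum over the convolution powers of bounds of geometric
growth. -/
def tailConst : ℝ≥0∞ := ∑' n : ℕ, ((n + 2).factorial : ℝ≥0∞)⁻¹ * 16 ^ (n + 1)

lemma tailConst_ne_top : tailConst ≠ ⊤ := by
  have h : Summable fun n : ℕ => (16 : ℝ) ^ n / n.factorial := Real.summable_pow_div_factorial 16
  have h2 := (summable_nat_add_iff 2).2 h
  have h3 : tailConst ≤ ∑' n : ℕ, ENNReal.ofReal ((16 : ℝ) ^ (n + 2) / (n + 2).factorial) := by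
    refine ENNReal.tsum_le_tsum fun n => ?_
    rw [ENNReal.ofReal_div_of_pos (by positivity), ENNReal.ofReal_pow (by norm_num),
      ENNReal.ofReal_natCast, ENNReal.div_eq_inv_mul]
    gcongr
    · norm_num
    · simp
    · norm_num
  refine ne_top_of_le_ne_top ?_ h3
  rw [← ENNReal.ofReal_tsum_of_nonneg (fun n => by positivity) h2]
  exact ENNReal.ofReal_ne_top

lemma tsum_pow_div_factorial_le {y : ℝ≥0∞} (hy : y ≤ 1 / 16) :
    ∑' n : ℕ, ((n + 2).factorial : ℝ≥0∞)⁻¹ * ((n + 2) * (2 * y) ^ (n + 1)) ≤ 1 / 7 := by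
  have h2 : 2 * y ≤ (8 : ℝ≥0∞)⁻¹ := by
    calc 2 * y ≤ 2 * (1 / 16) := by gcongr
      _ = 8⁻¹ := by
        rw [show (16 : ℝ≥0∞) = 2 * 8 by norm_num, one_div,
          ENNReal.mul_inv (by simp) (by simp), ← mul_assoc, ENNReal.mul_inv_cancel (by simp)
          (by simp), one_mul]
  calc _ ≤ ∑' n : ℕ, (8 : ℝ≥0∞)⁻¹ ^ (n + 1) := by
        refine ENNReal.tsum_le_tsum fun n => ?_
        have h1 : ((n + 2).factorial : ℝ≥0∞)⁻¹ * (n + 2) ≤ 1 := by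
          rw [← ENNReal.div_eq_inv_mul]
          refine ENNReal.div_le_of_le_mul ?_
          rw [one_mul]
          exact_mod_cast Nat.self_le_factorial (n + 2)
        calc _ = (((n + 2).factorial : ℝ≥0∞)⁻¹ * (n + 2)) * (2 * y) ^ (n + 1) := by ring
          _ ≤ 1 * (8 : ℝ≥0∞)⁻¹ ^ (n + 1) := by gcongr
          _ = _ := one_mul _
    _ = (8 : ℝ≥0∞)⁻¹ * (1 - 8⁻¹)⁻¹ := by
        simp_rw [pow_succ']
        rw [ENNReal.tsum_mul_left, ENNReal.tsum_geometric]
    _ ≤ _ := by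
        have : (1 : ℝ≥0∞) - 8⁻¹ = 7 / 8 := by
          refine ENNReal.sub_eq_of_eq_add (by simp) ?_
          rw [← one_div, ENNReal.div_add_div_same]
          norm_num
          exact (ENNReal.div_self (by simp) (by simp)).symm
        rw [this, ENNReal.inv_div (by simp) (by simp), ENNReal.div_eq_inv_mul, mul_comm, mul_assoc,
          ENNReal.mul_inv_cancel (by simp) (by simp), mul_one, one_div]

/-- The weighted `L^p` bound for the nonlinearity, with an absorbable first term. -/
lemma exists_lpn_wt_expTail_le {p q θ : ℝ} (hp : 1 ≤ p) (hq : 0 ≤ q) (hθ1 : 1 ≤ θ)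
    (hθ4 : θ ≤ 4) : ∃ K : ℝ≥0, ∀ f : E d → ℝ≥0∞, Measurable f → ∫⁻ ξ, f ξ ≤ 1 / 16 →
      lpn p (wt q (expTail f)) ≤ 1 / 7 * lpn p (wt q f) +
        K * (lpn p (wt (q - θ) f) * ∫⁻ ξ, wt θ f ξ) := by
  have hp0 : 0 < p := by linarith
  obtain ⟨K, hK⟩ := exists_add_rpow_le q θ hq (by linarith)
  refine ⟨tailConst.toNNReal * K, fun f hf hf1 => ?_⟩
  have hf1' : ∫⁻ ξ, f ξ ≤ 1 := hf1.trans (by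
    rw [one_div]; exact ENNReal.inv_le_one.2 (by norm_num))
  set y := ∫⁻ ξ, f ξ
  have hm : ∀ n, Measurable (wt q (convPow f (n + 1))) := fun n =>
    measurable_wt q (measurable_convPow hf (n + 1))
  calc lpn p (wt q (expTail f))
      = lpn p (fun ξ => ∑' n : ℕ, ((n + 2).factorial : ℝ≥0∞)⁻¹ * wt q (convPow f (n + 1)) ξ) := by
        congr 1; ext ξ; exact wt_expTail q f ξ
    _ ≤ ∑' n : ℕ, ((n + 2).factorial : ℝ≥0∞)⁻¹ * lpn p (wt q (convPow f (n + 1))) := by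
        refine (lpn_tsum_le hp fun n => (hm n).const_mul _).trans (le_of_eq ?_)
        exact tsum_congr fun n => lpn_const_mul hp0 _ (hm n)
    _ ≤ ∑' n : ℕ, (((n + 2).factorial : ℝ≥0∞)⁻¹ * ((n + 2) * (2 * y) ^ (n + 1)) *
          lpn p (wt q f) + ((n + 2).factorial : ℝ≥0∞)⁻¹ * 16 ^ (n + 1) *
          (K * (lpn p (wt (q - θ) f) * ∫⁻ ξ, wt θ f ξ))) := by
        refine ENNReal.tsum_le_tsum fun n => ?_
        rw [mul_assoc, mul_assoc _ (16 ^ (n + 1)), ← mul_add]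
        gcongr
        refine (lpn_wt_convPow_le hp hK hq hθ1 hθ4 hf hf1' (n + 1)).trans (le_of_eq ?_)
        push_cast
        rw [add_assoc (n : ℝ≥0∞), one_add_one_eq_two]
    _ ≤ 1 / 7 * lpn p (wt q f) + tailConst *
          (K * (lpn p (wt (q - θ) f) * ∫⁻ ξ, wt θ f ξ)) := by
        rw [ENNReal.tsum_add, ENNReal.tsum_mul_right, ENNReal.tsum_mul_right]
        gcongr
        · exact tsum_pow_div_factorial_le hf1
        · exact le_rfl
    _ = _ := by
        rw [ENNReal.coe_mul, ENNReal.coe_toNNReal tailConst_ne_top, mul_assoc]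

/-- The nonlinearity is Lipschitz in `L¹` with a small constant, in the form of a bound for the
majorants. -/
lemma lintegral_expTail_le_add {A B : E d → ℝ≥0∞} (hA : Measurable A) (hB : Measurable B)
    {v : ℝ≥0∞} (hv : ∫⁻ ξ, A ξ = (∫⁻ ξ, B ξ) + v) (hA3 : ∫⁻ ξ, A ξ ≤ 1 / 3) :
    ∫⁻ ξ, expTail A ξ ≤ (∫⁻ ξ, expTail B ξ) + 1 / 2 * v := by
  have e : ∀ f : E d → ℝ≥0∞, Measurable f → ∫⁻ ξ, expTail f ξ =
      ∑' n : ℕ, ((n + 2).factorial : ℝ≥0∞)⁻¹ * (∫⁻ ξ, f ξ) ^ (n + 2) := fun f hf => by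
    unfold expTail
    rw [lintegral_tsum fun n => ((measurable_convPow hf (n + 1)).const_mul _).aemeasurable]
    refine tsum_congr fun n => ?_
    rw [lintegral_const_mul _ (measurable_convPow hf (n + 1)), lintegral_convPow hf]
  rw [e A hA, e B hB]
  set a := ∫⁻ ξ, A ξ
  set b := ∫⁻ ξ, B ξ
  -- the mean value inequality for powers, without subtraction
  have key : ∀ n : ℕ, a ^ (n + 1) ≤ b ^ (n + 1) + (n + 1) * (v * a ^ n) := fun n => by
    induction n with
    | zero => simp [hv]
    | succ n ih =>
      calc a ^ (n + 1 + 1) = (b + v) * a ^ (n + 1) := by rw [pow_succ' _ (n + 1), ← hv]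
        _ = b * a ^ (n + 1) + v * a ^ (n + 1) := add_mul _ _ _
        _ ≤ b * (b ^ (n + 1) + (n + 1) * (v * a ^ n)) + v * a ^ (n + 1) := by gcongr
        _ ≤ b * b ^ (n + 1) + a * ((n + 1) * (v * a ^ n)) + v * a ^ (n + 1) := by
          rw [mul_add]
          gcongr
          rw [hv]; exact le_self_add
        _ = _ := by push_cast; ring
  calc _ ≤ ∑' n : ℕ, (((n + 2).factorial : ℝ≥0∞)⁻¹ * b ^ (n + 2) + v * (1 / 3) ^ (n + 1)) := by
        refine ENNReal.tsum_le_tsum fun n => ?_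
        have h1 : ((n + 2).factorial : ℝ≥0∞)⁻¹ * (n + 2) ≤ 1 := by
          rw [← ENNReal.div_eq_inv_mul]
          refine ENNReal.div_le_of_le_mul ?_
          rw [one_mul]
          exact_mod_cast Nat.self_le_factorial (n + 2)
        calc ((n + 2).factorial : ℝ≥0∞)⁻¹ * a ^ (n + 2)
            ≤ ((n + 2).factorial : ℝ≥0∞)⁻¹ *
                (b ^ (n + 2) + (((n + 1 : ℕ) : ℝ≥0∞) + 1) * (v * a ^ (n + 1))) := by
              gcongr; exact key (n + 1)
          _ = ((n + 2).factorial : ℝ≥0∞)⁻¹ * b ^ (n + 2) +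
                ((n + 2).factorial : ℝ≥0∞)⁻¹ * (n + 2) * (v * a ^ (n + 1)) := by
              push_cast
              rw [add_assoc (n : ℝ≥0∞), one_add_one_eq_two]
              ring
          _ ≤ ((n + 2).factorial : ℝ≥0∞)⁻¹ * b ^ (n + 2) + 1 * (v * (1 / 3) ^ (n + 1)) := by
              gcongr
          _ = _ := by rw [one_mul]
    _ = (∑' n : ℕ, ((n + 2).factorial : ℝ≥0∞)⁻¹ * b ^ (n + 2)) +
          v * (1 / 3 * (1 - 1 / 3)⁻¹) := by
        rw [ENNReal.tsum_add, ENNReal.tsum_mul_left]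
        simp_rw [pow_succ' (1 / 3 : ℝ≥0∞)]
        rw [ENNReal.tsum_mul_left, ENNReal.tsum_geometric]
    _ = _ := by
        have : (1 : ℝ≥0∞) - 1 / 3 = 2 / 3 := by
          refine ENNReal.sub_eq_of_eq_add (by simp) ?_
          rw [ENNReal.div_add_div_same]
          norm_num
          exact (ENNReal.div_self (by simp) (by simp)).symm
        rw [this, ENNReal.inv_div (by simp) (by simp), one_div, ENNReal.div_eq_inv_mul (a := 3),
          mul_comm (2⁻¹ : ℝ≥0∞), ← mul_assoc (3⁻¹ : ℝ≥0∞), ENNReal.inv_mul_cancel (by simp)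
          (by simp), one_mul, one_div, mul_comm v]

/-- The Cauchy-Schwarz inequality for a convolution, in a crude form without square roots. -/
lemma conv_le_lintegral_sq {f g : E d → ℝ≥0∞} (hf : Measurable f) (ξ : E d) :
    conv f g ξ ≤ (∫⁻ η, f η ^ 2) + ∫⁻ η, g η ^ 2 := by
  have h : ∀ a b : ℝ≥0∞, a * b ≤ a ^ 2 + b ^ 2 := fun a b => by
    rcases le_total a b with h | h
    · calc a * b ≤ b * b := by gcongr
        _ = b ^ 2 := (sq b).symm
        _ ≤ _ := le_add_self
    · calc a * b ≤ a * a := by gcongr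
        _ = a ^ 2 := (sq a).symm
        _ ≤ _ := le_self_add
  calc conv f g ξ ≤ ∫⁻ η, (f η ^ 2 + g (ξ - η) ^ 2) := lintegral_mono fun η => h _ _
    _ = (∫⁻ η, f η ^ 2) + ∫⁻ η, g (ξ - η) ^ 2 := lintegral_add_left (by fun_prop) _
    _ = _ := by rw [lintegral_sub_left_eq_self (fun η => g η ^ 2) ξ]

/-- A pointwise bound of the weighted convolution powers by `L²` norms. -/
lemma wt_two_convPow_le {f : E d → ℝ≥0∞} (hf : Measurable f) (hf1 : ∫⁻ ξ, f ξ ≤ 1) (n : ℕ)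
    (ξ : E d) :
    wt 2 (convPow f (n + 1)) ξ ≤
      4 ^ (n + 1) * ((∫⁻ η, wt 2 f η ^ 2) + ∫⁻ η, f η ^ 2) := by
  set S := (∫⁻ η, wt 2 f η ^ 2) + ∫⁻ η, f η ^ 2
  have m1 := measurable_wt 2 hf
  have hsq : ∀ a b : ℝ≥0∞, (a + b) ^ (2 : ℝ) ≤ 2 * a ^ (2 : ℝ) + 2 * b ^ (2 : ℝ) := fun a b => by
    have := ENNReal.rpow_add_le_mul_rpow_add_rpow a b (p := 2) (by norm_num)
    rw [← mul_add]
    refine this.trans (le_of_eq ?_)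
    norm_num
  have step : ∀ g : E d → ℝ≥0∞, Measurable g → ∀ ζ,
      wt 2 (conv f g) ζ ≤ 2 * conv (wt 2 f) g ζ + 2 * conv f (wt 2 g) ζ := fun g hg ζ => by
    have m2 := measurable_wt 2 hg
    unfold conv wt
    rw [← lintegral_const_mul _ (by fun_prop), ← lintegral_const_mul _ (by fun_prop),
      ← lintegral_const_mul _ (by fun_prop), ← lintegral_add_left (by fun_prop)]
    refine lintegral_mono fun η => ?_
    dsimp only
    calc rho ζ ^ (2 : ℝ) * (f η * g (ζ - η))
        ≤ (rho η + rho (ζ - η)) ^ (2 : ℝ) * (f η * g (ζ - η)) := by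
          gcongr
          simpa using rho_add_le η (ζ - η)
      _ ≤ (2 * rho η ^ (2 : ℝ) + 2 * rho (ζ - η) ^ (2 : ℝ)) * (f η * g (ζ - η)) := by
          gcongr
          exact hsq _ _
      _ = _ := by ring
  have hL2 : ∀ k : ℕ, ∫⁻ η, convPow f k η ^ 2 ≤ ∫⁻ η, f η ^ 2 := fun k => by
    have hk : lpn 2 (convPow f k) ≤ lpn 2 f := by
      induction k with
      | zero => exact le_rfl
      | succ k ih =>
        calc lpn 2 (conv f (convPow f k)) ≤ (∫⁻ ξ, f ξ) * lpn 2 (convPow f k) :=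
              lpn_conv_le one_le_two hf (measurable_convPow hf k)
          _ ≤ 1 * lpn 2 f := by gcongr
          _ = _ := one_mul _
    unfold lpn at hk
    have := (ENNReal.rpow_le_rpow_iff (by norm_num : (0 : ℝ) < 1 / 2)).1 hk
    simpa using this
  induction n generalizing ξ with
  | zero =>
    calc wt 2 (conv f f) ξ ≤ 2 * conv (wt 2 f) f ξ + 2 * conv f (wt 2 f) ξ := step f hf ξ
      _ = 4 * conv (wt 2 f) f ξ := by
        rw [conv_comm f, ← add_mul]
        norm_num
      _ ≤ 4 * S := by gcongr; exact conv_le_lintegral_sq m1 ξ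
      _ = _ := by simp
  | succ n ih =>
    have hF := measurable_convPow hf (n + 1)
    calc wt 2 (conv f (convPow f (n + 1))) ξ
        ≤ 2 * conv (wt 2 f) (convPow f (n + 1)) ξ + 2 * conv f (wt 2 (convPow f (n + 1))) ξ :=
          step _ hF ξ
      _ ≤ 2 * S + 2 * (4 ^ (n + 1) * S) := by
          gcongr
          · refine (conv_le_lintegral_sq m1 ξ).trans ?_
            exact add_le_add le_rfl (hL2 (n + 1))
          · calc conv f (wt 2 (convPow f (n + 1))) ξ
                ≤ ∫⁻ η, f η * (4 ^ (n + 1) * S) := by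
                  unfold conv
                  exact lintegral_mono fun η => mul_le_mul' le_rfl (ih _)
              _ = (∫⁻ η, f η) * (4 ^ (n + 1) * S) := lintegral_mul_const _ hf
              _ ≤ 1 * (4 ^ (n + 1) * S) := by gcongr
              _ = _ := one_mul _
      _ ≤ 2 * (4 ^ (n + 1) * S) + 2 * (4 ^ (n + 1) * S) := by
          gcongr
          exact le_mul_of_one_le_left' (one_le_pow₀ (by norm_num))
      _ = _ := by ring

/-- A pointwise bound of the weighted nonlinearity by `L²` norms. -/
lemma wt_two_expTail_le {f : E d → ℝ≥0∞} (hf : Measurable f) (hf1 : ∫⁻ ξ, f ξ ≤ 1) (ξ : E d) :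
    wt 2 (expTail f) ξ ≤ tailConst * ((∫⁻ η, wt 2 f η ^ 2) + ∫⁻ η, f η ^ 2) := by
  rw [wt_expTail, tailConst, ← ENNReal.tsum_mul_right]
  refine ENNReal.tsum_le_tsum fun n => ?_
  rw [mul_assoc]
  gcongr
  refine (wt_two_convPow_le hf hf1 n ξ).trans ?_
  gcongr
  norm_num

end

section

variable {d : ℕ}

/-! ### Integrals in time -/

/-- An integral form of Gronwall's inequality: the weight `exp (lam * ∫_0^t Y)` reproduces itself
under integration against `lam * Y`. -/
lemma lintegral_mul_exp_le {Y : ℝ → ℝ≥0∞} (hY : Measurable Y) {t : ℝ} (ht : 0 ≤ t)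
    (hfin : ∫⁻ τ in Ioc 0 t, Y τ ≠ ⊤) {lam : ℝ} (hl : 0 < lam) :
    ENNReal.ofReal lam * ∫⁻ τ in Ioc 0 t,
        Y τ * ENNReal.ofReal (Real.exp (lam * (∫⁻ σ in Ioc 0 τ, Y σ).toReal)) ≤
      ENNReal.ofReal (Real.exp (lam * (∫⁻ σ in Ioc 0 t, Y σ).toReal)) := by
  have hYfin : ∀ᵐ τ ∂volume.restrict (Ioc 0 t), Y τ < ⊤ := ae_lt_top hY hfin
  have hint : IntervalIntegrable (fun τ => (Y τ).toReal) volume 0 t := by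
    rw [intervalIntegrable_iff_integrableOn_Ioc_of_le ht]
    exact integrable_toReal_of_lintegral_ne_top hY.aemeasurable hfin
  have heta : ∀ τ ∈ Icc 0 t, (∫⁻ σ in Ioc 0 τ, Y σ).toReal = ∫ σ in (0 : ℝ)..τ, (Y σ).toReal := by
    intro τ hτ
    rw [intervalIntegral.integral_of_le hτ.1, integral_toReal hY.aemeasurable]
    exact ae_mono (Measure.restrict_mono (Ioc_subset_Ioc_right hτ.2) le_rfl) hYfin
  set η : ℝ → ℝ := fun τ => ∫ σ in (0 : ℝ)..τ, (Y σ).toReal with hη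
  set f : ℝ → ℝ := fun τ => Real.exp (lam * η τ) with hf
  have hsub : ∀ x ∈ Icc 0 t, IntervalIntegrable (fun τ => (Y τ).toReal) volume 0 x := fun x hx =>
    hint.mono_set (by rw [uIcc_of_le hx.1, uIcc_of_le ht]; exact Icc_subset_Icc_right hx.2)
  have hmonoη : MonotoneOn η (Icc 0 t) := fun x hx y hy hxy => by
    have h0 := intervalIntegral.integral_add_adjacent_intervals (hsub x hx)
      ((hsub x hx).symm.trans (hsub y hy))
    have h1 : 0 ≤ ∫ σ in x..y, (Y σ).toReal :=
      intervalIntegral.integral_nonneg hxy fun _ _ => ENNReal.toReal_nonneg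
    simp only [hη]
    linarith
  have hmono : MonotoneOn f (uIcc 0 t) := by
    rw [uIcc_of_le ht]
    intro x hx y hy hxy
    exact Real.exp_le_exp.2 (mul_le_mul_of_nonneg_left (hmonoη hx hy hxy) hl.le)
  have hder : ∀ᵐ x, x ∈ Ioc 0 t → deriv f x = f x * (lam * (Y x).toReal) := by
    filter_upwards [hint.ae_hasDerivAt_integral] with x hx hxm
    have hx' : x ∈ uIcc 0 t := by rw [uIcc_of_le ht]; exact Ioc_subset_Icc_self hxm
    exact (((hx hx' 0 left_mem_uIcc).const_mul lam).exp).deriv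
  have hle : ∫ x in (0 : ℝ)..t, deriv f x ≤ f t := by
    have h := hmono.intervalIntegral_deriv_mem_uIcc
    have h0 : f 0 ≤ f t := hmono left_mem_uIcc right_mem_uIcc ht
    rw [uIcc_of_le (by linarith)] at h
    have : 0 ≤ f 0 := (Real.exp_pos _).le
    linarith [h.2]
  have hdi : IntegrableOn (deriv f) (Ioc 0 t) :=
    (intervalIntegrable_iff_integrableOn_Ioc_of_le ht).1 hmono.intervalIntegrable_deriv
  have hnn : ∀ᵐ x ∂volume.restrict (Ioc 0 t), 0 ≤ deriv f x := by
    rw [ae_restrict_iff' measurableSet_Ioc]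
    filter_upwards [hder] with x hx hxm
    rw [hx hxm]
    exact mul_nonneg (Real.exp_pos _).le (mul_nonneg hl.le ENNReal.toReal_nonneg)
  rw [heta t ⟨ht, le_rfl⟩]
  calc _ = ∫⁻ τ in Ioc 0 t, ENNReal.ofReal (deriv f τ) := by
        rw [← lintegral_const_mul' _ _ ENNReal.ofReal_ne_top]
        refine lintegral_congr_ae ?_
        filter_upwards [hYfin, ae_restrict_of_ae hder, ae_restrict_mem measurableSet_Ioc]
          with τ h1 h2 h3
        rw [h2 h3, heta τ (Ioc_subset_Icc_self h3), ENNReal.ofReal_mul (Real.exp_pos _).le,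
          ENNReal.ofReal_mul hl.le, ENNReal.ofReal_toReal h1.ne]
        ring
    _ = ENNReal.ofReal (∫ x in (0 : ℝ)..t, deriv f x) := by
        rw [intervalIntegral.integral_of_le ht, ofReal_integral_eq_lintegral_ofReal hdi hnn]
    _ ≤ _ := ENNReal.ofReal_le_ofReal hle

/-- The heat kernel `e^{-a t}` balances its own dissipation. -/
lemma ofReal_exp_add_lintegral {a : ℝ} (ha : 0 ≤ a) {c t : ℝ} (hct : c ≤ t) :
    ENNReal.ofReal (Real.exp (-(a * (t - c)))) + ENNReal.ofReal a *
      ∫⁻ r in Ioc c t, ENNReal.ofReal (Real.exp (-(a * (r - c)))) = 1 := by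
  have hcont : Continuous fun r : ℝ => a * Real.exp (-(a * (r - c))) := by fun_prop
  have hi : IntegrableOn (fun r : ℝ => a * Real.exp (-(a * (r - c)))) (Ioc c t) :=
    (hcont.intervalIntegrable c t).1
  have hval : ∫ r in Ioc c t, a * Real.exp (-(a * (r - c))) = 1 - Real.exp (-(a * (t - c))) := by
    rw [← intervalIntegral.integral_of_le hct]
    have := intervalIntegral.integral_eq_sub_of_hasDerivAt
      (f := fun r => -Real.exp (-(a * (r - c)))) (f' := fun r => a * Real.exp (-(a * (r - c))))
      (a := c) (b := t) (fun r _ => by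
        have h1 : HasDerivAt (fun r : ℝ => -(a * (r - c))) (-(a * 1)) r :=
          (((hasDerivAt_id' r).sub_const c).const_mul a).fun_neg
        exact h1.exp.fun_neg.congr_deriv (by ring)) (hcont.intervalIntegrable c t)
    rw [this]
    simp
    ring
  rw [← lintegral_const_mul' _ _ ENNReal.ofReal_ne_top]
  simp_rw [← ENNReal.ofReal_mul ha]
  rw [← ofReal_integral_eq_lintegral_ofReal hi
    (ae_of_all _ fun r => mul_nonneg ha (Real.exp_pos _).le), hval,
    ← ENNReal.ofReal_add (Real.exp_pos _).le]
  · simp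
  · rw [sub_nonneg, Real.exp_le_one_iff]
    have := mul_nonneg ha (sub_nonneg.2 hct)
    linarith

/-- Exchange of the order of integration over a triangle. -/
lemma lintegral_triangle_swap {F : ℝ → ℝ → ℝ≥0∞} (hF : Measurable (Function.uncurry F)) (t : ℝ) :
    ∫⁻ r in Ioc 0 t, ∫⁻ τ in Ioc 0 r, F r τ = ∫⁻ τ in Ioc 0 t, ∫⁻ r in Ioc τ t, F r τ := by
  have h1 : ∀ r ∈ Ioc 0 t, ∫⁻ τ in Ioc 0 r, F r τ =
      ∫⁻ τ in Ioc 0 t, if τ ≤ r then F r τ else 0 := fun r hr => by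
    have : Ioc 0 r = Ioc 0 t ∩ Iic r := by
      ext x; simp only [mem_Ioc, mem_inter_iff, mem_Iic]
      exact ⟨fun h => ⟨⟨h.1, h.2.trans hr.2⟩, h.2⟩, fun h => ⟨h.1.1, h.2⟩⟩
    rw [this, inter_comm, ← Measure.restrict_restrict measurableSet_Iic,
      ← lintegral_indicator measurableSet_Iic]
    rfl
  have h2 : ∀ τ ∈ Ioc 0 t, ∫⁻ r in Ioc τ t, F r τ =
      ∫⁻ r in Ioc 0 t, if τ ≤ r then F r τ else 0 := fun τ hτ => by
    have : Icc τ t = Ioc 0 t ∩ Ici τ := by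
      ext x; simp only [mem_Ioc, mem_inter_iff, mem_Ici, mem_Icc]
      exact ⟨fun h => ⟨⟨hτ.1.trans_le h.1, h.2⟩, h.1⟩, fun h => ⟨h.2, h.1.2⟩⟩
    rw [setLIntegral_congr Ioc_ae_eq_Icc, this, inter_comm,
      ← Measure.restrict_restrict measurableSet_Ici, ← lintegral_indicator measurableSet_Ici]
    rfl
  rw [setLIntegral_congr_fun measurableSet_Ioc h1, setLIntegral_congr_fun measurableSet_Ioc h2]
  refine lintegral_lintegral_swap (Measurable.aemeasurable ?_)
  exact Measurable.ite (measurableSet_le measurable_snd measurable_fst) hF measurable_const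

/-- Maximal regularity of the scalar equation `x' = -a x + n` in `L^p`. -/
lemma duhamel_rpow_le {a : ℝ} (ha : 0 < a) {n : ℝ → ℝ≥0∞} (hn : Measurable n) {p : ℝ}
    (hp : 1 ≤ p) {t : ℝ} (ht : 0 ≤ t) :
    (∫⁻ τ in Ioc 0 t, ENNReal.ofReal (Real.exp (-(a * (t - τ)))) * n τ) ^ p +
      ENNReal.ofReal a * ∫⁻ r in Ioc 0 t,
        (∫⁻ τ in Ioc 0 r, ENNReal.ofReal (Real.exp (-(a * (r - τ)))) * n τ) ^ p ≤
      ENNReal.ofReal a ^ (1 - p) * ∫⁻ τ in Ioc 0 t, n τ ^ p := by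
  set k : ℝ → ℝ≥0∞ := fun s => ENNReal.ofReal (Real.exp (-(a * s))) with hk
  have hkm : Measurable k := by fun_prop
  set A := ENNReal.ofReal a
  have hA0 : A ≠ 0 := by simpa [A] using ha
  have hAt : A ≠ ⊤ := ENNReal.ofReal_ne_top
  have hmass : ∀ r, 0 ≤ r → ∫⁻ τ in Ioc 0 r, k (r - τ) ≤ A⁻¹ := fun r hr => by
    have h1 : ∫⁻ τ in Ioc 0 r, k (r - τ) = ∫⁻ τ in Ioc 0 r, k τ := by
      rw [← lintegral_indicator measurableSet_Ioc, ← lintegral_indicator measurableSet_Ioc,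
        ← lintegral_sub_left_eq_self _ r]
      refine lintegral_congr_ae ?_
      have h0 : ∀ᵐ x : ℝ, x ≠ 0 := by simp [ae_iff, measure_singleton]
      have hr : ∀ᵐ x : ℝ, x ≠ r := by simp [ae_iff, measure_singleton]
      filter_upwards [h0, hr] with x h0 hr
      simp only [indicator, mem_Ioc, sub_sub_cancel]
      have : (0 < r - x ∧ r - x ≤ r) ↔ (0 < x ∧ x ≤ r) := by
        constructor
        · rintro ⟨h1, h2⟩
          exact ⟨lt_of_le_of_ne (by linarith) (Ne.symm h0), by linarith⟩
        · rintro ⟨h1, h2⟩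
          exact ⟨sub_pos.2 (lt_of_le_of_ne h2 hr), by linarith⟩
      simp only [this]
    have h2 := ofReal_exp_add_lintegral ha.le hr
    simp only [sub_zero] at h2
    rw [h1]
    have h3 : A * ∫⁻ τ in Ioc 0 r, k τ ≤ 1 := by rw [← h2]; exact le_add_self
    calc _ = A⁻¹ * (A * ∫⁻ τ in Ioc 0 r, k τ) := by
          rw [← mul_assoc, ENNReal.inv_mul_cancel hA0 hAt, one_mul]
      _ ≤ A⁻¹ * 1 := by gcongr
      _ = _ := mul_one _
  have hJ : ∀ r, 0 ≤ r → (∫⁻ τ in Ioc 0 r, k (r - τ) * n τ) ^ p ≤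
      A ^ (1 - p) * ∫⁻ τ in Ioc 0 r, k (r - τ) * n τ ^ p := fun r hr => by
    refine (lintegral_mul_rpow_le (by fun_prop) (by fun_prop) hp).trans ?_
    gcongr
    calc _ ≤ A⁻¹ ^ (p - 1) := ENNReal.rpow_le_rpow (hmass r hr) (by linarith)
      _ = _ := by rw [ENNReal.inv_rpow, ← ENNReal.rpow_neg, neg_sub]
  have hm2 : Measurable (Function.uncurry fun r τ => k (r - τ) * n τ ^ p) := by
    unfold Function.uncurry; fun_prop
  calc _ ≤ A ^ (1 - p) * (∫⁻ τ in Ioc 0 t, k (t - τ) * n τ ^ p) +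
        A * ∫⁻ r in Ioc 0 t, A ^ (1 - p) * ∫⁻ τ in Ioc 0 r, k (r - τ) * n τ ^ p := by
        refine add_le_add (hJ t ht) (mul_le_mul' le_rfl ?_)
        refine setLIntegral_mono' measurableSet_Ioc fun r hr => hJ r hr.1.le
    _ = A ^ (1 - p) * ((∫⁻ τ in Ioc 0 t, k (t - τ) * n τ ^ p) +
          A * ∫⁻ τ in Ioc 0 t, ∫⁻ r in Ioc τ t, k (r - τ) * n τ ^ p) := by
        rw [lintegral_const_mul' _ _ (by
          rw [Ne, ENNReal.rpow_eq_top_iff]; simp [hA0, hAt]), lintegral_triangle_swap hm2]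
        ring
    _ = A ^ (1 - p) * ∫⁻ τ in Ioc 0 t, n τ ^ p := by
        congr 1
        have hm3 : Measurable fun τ => ∫⁻ r in Ioc τ t, k (r - τ) * n τ ^ p := by
          have : ∀ τ, ∫⁻ r in Ioc τ t, k (r - τ) * n τ ^ p =
              ∫⁻ r, if τ < r ∧ r ≤ t then k (r - τ) * n τ ^ p else 0 := fun τ => by
            rw [← lintegral_indicator measurableSet_Ioc]
            simp only [indicator, mem_Ioc]
          simp_rw [this]
          refine Measurable.lintegral_prod_right' (f := fun q : ℝ × ℝ =>
            if q.1 < q.2 ∧ q.2 ≤ t then k (q.2 - q.1) * n q.1 ^ p else 0) ?_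
          refine Measurable.ite ?_ (by fun_prop) measurable_const
          exact (measurableSet_lt measurable_fst measurable_snd).inter
            (measurableSet_le measurable_snd measurable_const)
        rw [← lintegral_const_mul _ hm3, ← lintegral_add_left (by fun_prop)]
        refine setLIntegral_congr_fun measurableSet_Ioc fun τ hτ => ?_
        rw [lintegral_mul_const _ (by fun_prop), ← mul_assoc, ← add_mul,
          ofReal_exp_add_lintegral ha.le hτ.2, one_mul]

end

section

variable {d : ℕ}

/-! ### The majorant iteration -/

/-- The symbol `|2πξ|⁴` of the bilaplacian. -/
def symb (ξ : E d) : ℝ := (2 * Real.pi * ‖ξ‖) ^ 4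

/-- The multiplier `e^{-t|2πξ|⁴}` of the biharmonic heat semigroup. -/
def heat (t : ℝ) (ξ : E d) : ℝ := Real.exp (-(symb ξ * t))

/-- Duhamel's formula for nonnegative functions, with forcing `|2πξ|² N`. -/
def duhE (G : E d → ℝ≥0∞) (N : ℝ → E d → ℝ≥0∞) (t : ℝ) (ξ : E d) : ℝ≥0∞ :=
  ENNReal.ofReal (heat t ξ) * G ξ +
    ∫⁻ τ in Ioc 0 t, ENNReal.ofReal (heat (t - τ) ξ) * wt 2 (N τ) ξ

/-- Picard iteration for the equation in which all signs have been made favourable. It increases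
with `n` and dominates the Picard iteration of the equation itself. -/
def maj (G : E d → ℝ≥0∞) : ℕ → ℝ → E d → ℝ≥0∞
  | 0 => fun _ _ => 0
  | n + 1 => duhE G fun τ => expTail (wt 2 (maj G n τ))

/-- The limit of the majorant iteration. -/
def majLim (G : E d → ℝ≥0∞) (t : ℝ) (ξ : E d) : ℝ≥0∞ := ⨆ n, maj G n t ξ

/-- The quantity `∫ (|2πξ|^s m(t))^p dξ + ∫_0^t ∫ (|2πξ|^(s+4/p) m)^p dξ dr` controlled by parabolic
regularity. -/
def energy (s p : ℝ) (m : ℝ → E d → ℝ≥0∞) (t : ℝ) : ℝ≥0∞ :=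
  (∫⁻ ξ, wt s (m t) ξ ^ p) + ∫⁻ r in Ioc 0 t, ∫⁻ ξ, wt (s + 4 / p) (m r) ξ ^ p

@[fun_prop]
lemma measurable_symb : Measurable (symb : E d → ℝ) := by unfold symb; fun_prop

lemma measurable_heat : Measurable (Function.uncurry (heat : ℝ → E d → ℝ)) := by
  unfold heat Function.uncurry; fun_prop

lemma symb_nonneg (ξ : E d) : 0 ≤ symb ξ := by unfold symb; positivity

lemma ofReal_symb (ξ : E d) : ENNReal.ofReal (symb ξ) = rho ξ ^ (4 : ℝ) := by
  unfold symb rho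
  rw [ENNReal.ofReal_pow (by positivity)]
  norm_cast

lemma symb_pos {ξ : E d} (h : rho ξ ≠ 0) : 0 < symb ξ := by
  rw [Ne, rho_eq_zero_iff] at h
  have := norm_pos_iff.2 h
  unfold symb
  positivity

lemma measurable_setLIntegral_Ioc {α : Type*} [MeasurableSpace α] {F : α → ℝ → ℝ≥0∞}
    (hF : Measurable (Function.uncurry F)) {b : α → ℝ} (hb : Measurable b) :
    Measurable fun a => ∫⁻ τ in Ioc 0 (b a), F a τ := by
  have : ∀ a, ∫⁻ τ in Ioc 0 (b a), F a τ = ∫⁻ τ, if 0 < τ ∧ τ ≤ b a then F a τ else 0 := fun a => by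
    rw [← lintegral_indicator measurableSet_Ioc]
    simp only [indicator, mem_Ioc]
  simp_rw [this]
  refine Measurable.lintegral_prod_right' (f := fun q : α × ℝ =>
    if 0 < q.2 ∧ q.2 ≤ b q.1 then F q.1 q.2 else 0) ?_
  refine Measurable.ite ?_ hF measurable_const
  exact (measurableSet_lt measurable_const measurable_snd).inter
    (measurableSet_le measurable_snd (hb.comp measurable_fst))

lemma measurable_wt_param {α : Type*} [MeasurableSpace α] (s : ℝ) {f : α → E d → ℝ≥0∞}
    (hf : Measurable (Function.uncurry f)) :
    Measurable (Function.uncurry fun a => wt s (f a)) := by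
  unfold wt
  exact ((measurable_rho.comp measurable_snd).pow_const s).mul hf

lemma measurable_duhE {G : E d → ℝ≥0∞} {N : ℝ → E d → ℝ≥0∞} (hG : Measurable G)
    (hN : Measurable (Function.uncurry N)) : Measurable (Function.uncurry (duhE G N)) := by
  refine Measurable.add ?_ ?_
  · exact (ENNReal.measurable_ofReal.comp measurable_heat).mul (hG.comp measurable_snd)
  · refine measurable_setLIntegral_Ioc (α := ℝ × E d)
      (F := fun q τ => ENNReal.ofReal (heat (q.1 - τ) q.2) * wt 2 (N τ) q.2) ?_ measurable_fst
    refine Measurable.mul ?_ ?_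
    · exact ENNReal.measurable_ofReal.comp (measurable_heat.comp
        (by fun_prop : Measurable fun q : (ℝ × E d) × ℝ => (q.1.1 - q.2, q.1.2)))
    · exact (measurable_wt_param 2 hN).comp
        (by fun_prop : Measurable fun q : (ℝ × E d) × ℝ => (q.2, q.1.2))

lemma measurable_maj {G : E d → ℝ≥0∞} (hG : Measurable G) (n : ℕ) :
    Measurable (Function.uncurry (maj G n)) := by
  induction n with
  | zero => exact measurable_const
  | succ n ih =>
    exact measurable_duhE hG (measurable_expTail_param (measurable_wt_param 2 ih))

lemma measurable_majLim {G : E d → ℝ≥0∞} (hG : Measurable G) :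
    Measurable (Function.uncurry (majLim G)) :=
  Measurable.iSup fun n => measurable_maj hG n

lemma duhE_mono (G : E d → ℝ≥0∞) {N N' : ℝ → E d → ℝ≥0∞} (h : ∀ τ, N τ ≤ N' τ) (t : ℝ) :
    duhE G N t ≤ duhE G N' t := fun ξ => by
  refine add_le_add le_rfl (lintegral_mono fun τ => ?_)
  exact mul_le_mul' le_rfl (wt_mono 2 (h τ) ξ)

lemma maj_le_succ (G : E d → ℝ≥0∞) (n : ℕ) (t : ℝ) : maj G n t ≤ maj G (n + 1) t := by
  induction n generalizing t with
  | zero => exact fun ξ => zero_le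
  | succ n ih => exact duhE_mono G (fun τ => expTail_mono (wt_mono 2 (ih τ))) t

lemma maj_mono (G : E d → ℝ≥0∞) (t : ℝ) : Monotone fun n => maj G n t :=
  monotone_nat_of_le_succ fun n => maj_le_succ G n t

lemma maj_le_majLim (G : E d → ℝ≥0∞) (n : ℕ) (t : ℝ) : maj G n t ≤ majLim G t := fun ξ =>
  le_iSup (fun n => maj G n t ξ) n

lemma measurable_slice {f : ℝ → E d → ℝ≥0∞} (hf : Measurable (Function.uncurry f))
    (t : ℝ) : Measurable (f t) := hf.comp (by fun_prop : Measurable fun ξ : E d => (t, ξ))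

lemma wt_rpow (s : ℝ) {p : ℝ} (hp : 0 ≤ p) (f : E d → ℝ≥0∞) (ξ : E d) :
    wt s f ξ ^ p = rho ξ ^ (s * p) * f ξ ^ p := by
  unfold wt
  rw [ENNReal.mul_rpow_of_nonneg _ _ hp, ENNReal.rpow_mul]

lemma heat_rpow_le (c : ℝ≥0∞) {p : ℝ} (hp : 1 ≤ p) (ξ : E d) {t : ℝ} (ht : 0 ≤ t) :
    (ENNReal.ofReal (heat t ξ) * c) ^ p + ENNReal.ofReal (symb ξ) *
      ∫⁻ r in Ioc 0 t, (ENNReal.ofReal (heat r ξ) * c) ^ p ≤ c ^ p := by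
  have hp0 : 0 < p := by linarith
  have h1 : ∀ r, 0 ≤ r → (ENNReal.ofReal (heat r ξ) * c) ^ p ≤
      ENNReal.ofReal (heat r ξ) * c ^ p := fun r hr => by
    rw [ENNReal.mul_rpow_of_nonneg _ _ hp0.le]
    gcongr
    have : ENNReal.ofReal (heat r ξ) ≤ 1 := by
      rw [ENNReal.ofReal_le_one]
      unfold heat
      rw [Real.exp_le_one_iff]
      have := mul_nonneg (symb_nonneg ξ) hr
      linarith
    calc _ ≤ ENNReal.ofReal (heat r ξ) ^ (1 : ℝ) :=
          ENNReal.rpow_le_rpow_of_exponent_ge this hp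
      _ = _ := ENNReal.rpow_one _
  have h2 := ofReal_exp_add_lintegral (symb_nonneg ξ) ht
  simp only [sub_zero] at h2
  calc _ ≤ ENNReal.ofReal (heat t ξ) * c ^ p +
        ENNReal.ofReal (symb ξ) * ∫⁻ r in Ioc 0 t, ENNReal.ofReal (heat r ξ) * c ^ p :=
        add_le_add (h1 t ht) (mul_le_mul' le_rfl
          (setLIntegral_mono' measurableSet_Ioc fun r hr => h1 r hr.1.le))
    _ = (ENNReal.ofReal (heat t ξ) + ENNReal.ofReal (symb ξ) *
          ∫⁻ r in Ioc 0 t, ENNReal.ofReal (heat r ξ)) * c ^ p := by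
        rw [lintegral_mul_const _ (by unfold heat; fun_prop)]
        ring
    _ = _ := by unfold heat; rw [h2, one_mul]

/-- The pointwise form of parabolic regularity, at a fixed nonzero frequency. -/
lemma wt_duhE_rpow_le {s p : ℝ} (hp : 1 ≤ p) {G : E d → ℝ≥0∞}
    {N : ℝ → E d → ℝ≥0∞} (hN : Measurable (Function.uncurry N)) {t : ℝ}
    (ht : 0 ≤ t) {ξ : E d} (hξ : rho ξ ≠ 0) :
    wt s (duhE G N t) ξ ^ p + ∫⁻ r in Ioc 0 t, wt (s + 4 / p) (duhE G N r) ξ ^ p ≤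
      2 ^ (p - 1) * (wt s G ξ ^ p +
        ∫⁻ τ in Ioc 0 t, wt (s - 2 + 4 / p) (N τ) ξ ^ p) := by
  have hp0 : 0 < p := by linarith
  have hξt := rho_ne_top ξ
  set A := ENNReal.ofReal (symb ξ) with hA
  obtain ⟨I, hI⟩ : ∃ I : ℝ → ℝ≥0∞, I = fun r =>
      ∫⁻ τ in Ioc 0 r, ENNReal.ofReal (heat (r - τ) ξ) * wt 2 (N τ) ξ := ⟨_, rfl⟩
  have hNξ : Measurable fun τ => wt 2 (N τ) ξ :=
    Measurable.of_uncurry_right (f := fun τ => wt 2 (N τ)) (measurable_wt_param 2 hN)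
  have hbound : I t ^ p + A * ∫⁻ r in Ioc 0 t, I r ^ p ≤
      A ^ (1 - p) * ∫⁻ τ in Ioc 0 t, wt 2 (N τ) ξ ^ p := by
    have h := duhamel_rpow_le (symb_pos hξ) hNξ hp ht
    simp only [hI, heat]
    exact h
  have hhom := heat_rpow_le (G ξ) hp ξ ht
  have hsum : ∀ r, duhE G N r ξ ^ p ≤
      2 ^ (p - 1) * ((ENNReal.ofReal (heat r ξ) * G ξ) ^ p + I r ^ p) := fun r => by
    rw [hI]
    exact ENNReal.rpow_add_le_mul_rpow_add_rpow _ _ hp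
  have e1 : ∀ r, wt (s + 4 / p) (duhE G N r) ξ ^ p =
      rho ξ ^ (s * p) * (A * duhE G N r ξ ^ p) := fun r => by
    rw [wt_rpow _ hp0.le, hA, ofReal_symb, ← mul_assoc, ← ENNReal.rpow_add _ _ hξ hξt]
    congr 2
    field_simp
  have e2 : ∀ r, rho ξ ^ (s * p) * (A ^ (1 - p) * wt 2 (N r) ξ ^ p) =
      wt (s - 2 + 4 / p) (N r) ξ ^ p := fun r => by
    rw [wt_rpow _ hp0.le, wt_rpow _ hp0.le, hA, ofReal_symb, ← ENNReal.rpow_mul, ← mul_assoc,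
      ← mul_assoc, ← ENNReal.rpow_add _ _ hξ hξt, ← ENNReal.rpow_add _ _ hξ hξt]
    congr 2
    field_simp
    ring
  have hAt : A ^ (1 - p) ≠ ⊤ := by
    rw [Ne, ENNReal.rpow_eq_top_iff]
    have : A ≠ 0 := by simpa [A] using symb_pos hξ
    simp [this, A]
  have hρt : rho ξ ^ (s * p) ≠ ⊤ := by
    rw [Ne, ENNReal.rpow_eq_top_iff]
    simp [hξ, hξt]
  have hF : Measurable (Function.uncurry fun r τ : ℝ =>
      ENNReal.ofReal (heat (r - τ) ξ) * wt 2 (N τ) ξ) := by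
    have h1 : Measurable fun q : ℝ × ℝ => ENNReal.ofReal (heat (q.1 - q.2) ξ) := by
      unfold heat; fun_prop
    exact h1.mul (hNξ.comp measurable_snd)
  have hI1 : Measurable I := hI ▸ measurable_setLIntegral_Ioc hF measurable_id
  have hIm : Measurable fun r => I r ^ p := hI1.pow_const p
  calc wt s (duhE G N t) ξ ^ p + ∫⁻ r in Ioc 0 t, wt (s + 4 / p) (duhE G N r) ξ ^ p
      = rho ξ ^ (s * p) * (duhE G N t ξ ^ p + A * ∫⁻ r in Ioc 0 t, duhE G N r ξ ^ p) := by
        simp_rw [e1]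
        rw [wt_rpow _ hp0.le, lintegral_const_mul' _ _ hρt,
          lintegral_const_mul' _ _ ENNReal.ofReal_ne_top, mul_add]
    _ ≤ rho ξ ^ (s * p) * (2 ^ (p - 1) * ((ENNReal.ofReal (heat t ξ) * G ξ) ^ p + I t ^ p) +
          A * ∫⁻ r in Ioc 0 t, 2 ^ (p - 1) *
            ((ENNReal.ofReal (heat r ξ) * G ξ) ^ p + I r ^ p)) := by
        gcongr with r
        · exact hsum t
        · exact hsum r
    _ = rho ξ ^ (s * p) * (2 ^ (p - 1) * (((ENNReal.ofReal (heat t ξ) * G ξ) ^ p +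
          A * ∫⁻ r in Ioc 0 t, (ENNReal.ofReal (heat r ξ) * G ξ) ^ p) +
          (I t ^ p + A * ∫⁻ r in Ioc 0 t, I r ^ p))) := by
        rw [lintegral_const_mul' _ _ (ENNReal.rpow_ne_top_of_nonneg (by linarith) (by simp)),
          lintegral_add_right _ hIm]
        ring
    _ ≤ rho ξ ^ (s * p) * (2 ^ (p - 1) * (G ξ ^ p +
          A ^ (1 - p) * ∫⁻ τ in Ioc 0 t, wt 2 (N τ) ξ ^ p)) := by gcongr
    _ = 2 ^ (p - 1) * (wt s G ξ ^ p +
          ∫⁻ τ in Ioc 0 t, rho ξ ^ (s * p) * (A ^ (1 - p) * wt 2 (N τ) ξ ^ p)) := by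
        rw [lintegral_const_mul' _ _ hρt, lintegral_const_mul' _ _ hAt, wt_rpow _ hp0.le]
        ring
    _ = _ := by simp_rw [e2]

lemma energy_duhE_le (hd : 1 ≤ d) {s p : ℝ} (hp : 1 ≤ p) {G : E d → ℝ≥0∞}
    {N : ℝ → E d → ℝ≥0∞} (hG : Measurable G) (hN : Measurable (Function.uncurry N)) {t : ℝ}
    (ht : 0 ≤ t) :
    energy s p (duhE G N) t ≤ 2 ^ (p - 1) * ((∫⁻ ξ, wt s G ξ ^ p) +
      ∫⁻ τ in Ioc 0 t, ∫⁻ ξ, wt (s - 2 + 4 / p) (N τ) ξ ^ p) := by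
  have hp0 : 0 < p := by linarith
  have hm := measurable_duhE hG hN
  have hGs := measurable_wt s hG
  have mW : Measurable (Function.uncurry fun r ξ => wt (s + 4 / p) (duhE G N r) ξ ^ p) :=
    (measurable_wt_param _ hm).pow_const p
  have mN : Measurable (Function.uncurry fun r ξ => wt (s - 2 + 4 / p) (N r) ξ ^ p) :=
    (measurable_wt_param _ hN).pow_const p
  have m1 : Measurable fun ξ => wt s (duhE G N t) ξ ^ p :=
    (measurable_wt s (measurable_slice hm t)).pow_const p
  unfold energy
  rw [lintegral_lintegral_swap (Measurable.aemeasurable mW),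
    lintegral_lintegral_swap (Measurable.aemeasurable mN),
    ← lintegral_add_left m1, ← lintegral_add_left (hGs.pow_const p),
    ← lintegral_const_mul']
  swap
  · exact ENNReal.rpow_ne_top_of_nonneg (by linarith) (by simp)
  refine lintegral_mono_ae ?_
  filter_upwards [ae_rho_ne_zero hd] with ξ hξ
  exact wt_duhE_rpow_le hp hN ht hξ

lemma lintegral_wt_majLim_rpow {p : ℝ} (hp : 0 < p) {G : E d → ℝ≥0∞} (hG : Measurable G)
    (s r : ℝ) : ∫⁻ ξ, wt s (majLim G r) ξ ^ p = ⨆ n, ∫⁻ ξ, wt s (maj G n r) ξ ^ p := by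
  rw [← lintegral_iSup]
  · refine lintegral_congr fun ξ => ?_
    unfold wt majLim
    rw [ENNReal.mul_iSup]
    exact (ENNReal.orderIsoRpow p hp).map_iSup _
  · exact fun n => (measurable_wt s (measurable_slice (measurable_maj hG n) r)).pow_const p
  · exact fun a b hab ξ => ENNReal.rpow_le_rpow (wt_mono s (maj_mono G r hab) ξ) hp.le

lemma lintegral_lintegral_wt_majLim_rpow {p : ℝ} (hp : 0 < p) {G : E d → ℝ≥0∞}
    (hG : Measurable G) (s t : ℝ) :
    ∫⁻ r in Ioc 0 t, ∫⁻ ξ, wt s (majLim G r) ξ ^ p =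
      ⨆ n, ∫⁻ r in Ioc 0 t, ∫⁻ ξ, wt s (maj G n r) ξ ^ p := by
  simp_rw [lintegral_wt_majLim_rpow hp hG]
  refine lintegral_iSup (fun n => ?_) ?_
  · exact Measurable.lintegral_prod_right'
      ((measurable_wt_param _ (measurable_maj hG n)).pow_const p)
  · exact fun a b hab r => lintegral_mono fun ξ =>
      ENNReal.rpow_le_rpow (wt_mono _ (maj_mono G r hab) ξ) hp.le

/-- Bounds for the energies of all majorants pass to the limit. -/
lemma energy_majLim_le {s p : ℝ} (hp : 0 < p) {G : E d → ℝ≥0∞} (hG : Measurable G) {t : ℝ}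
    {C : ℝ≥0∞} (h : ∀ n, energy s p (maj G n) t ≤ C) : energy s p (majLim G) t ≤ C := by
  unfold energy
  rw [lintegral_wt_majLim_rpow hp hG, lintegral_lintegral_wt_majLim_rpow hp hG,
    ENNReal.iSup_add_iSup_of_monotone]
  · exact iSup_le h
  · exact fun a b hab => lintegral_mono fun ξ =>
      ENNReal.rpow_le_rpow (wt_mono s (maj_mono G t hab) ξ) hp.le
  · exact fun a b hab => lintegral_mono fun r => lintegral_mono fun ξ =>
      ENNReal.rpow_le_rpow (wt_mono _ (maj_mono G r hab) ξ) hp.le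

lemma f2e_mono {a b : ℝ≥0∞} (h : a ≤ b) : f2e a ≤ f2e b :=
  ENNReal.tsum_le_tsum fun n => by gcongr

/-- The critical norm of the majorants does not grow. Since the iteration is increasing, the
dissipation of the next iterate absorbs the nonlinearity evaluated at the previous one. -/
lemma lintegral_wt_two_maj_le (hd : 1 ≤ d) {G : E d → ℝ≥0∞} (hG : Measurable G)
    (hG1 : ∫⁻ ξ, wt 2 G ξ ≠ ⊤) {F : ℝ≥0∞} (hF : f2e (∫⁻ ξ, wt 2 G ξ) ≤ F) (hF1 : F < 1) (n : ℕ)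
    {t : ℝ} (ht : 0 ≤ t) :
    (∫⁻ ξ, wt 2 (maj G n t) ξ) + (1 - F) * ∫⁻ r in Ioc 0 t, ∫⁻ ξ, wt 6 (maj G n r) ξ ≤
      ∫⁻ ξ, wt 2 G ξ := by
  set y := ∫⁻ ξ, wt 2 G ξ
  have hFt : F ≠ ⊤ := (hF1.trans_le le_top).ne
  induction n generalizing t with
  | zero => simp [maj, wt]
  | succ n ih =>
    set B' := ∫⁻ r in Ioc 0 t, ∫⁻ ξ, wt 6 (maj G n r) ξ
    set B := ∫⁻ r in Ioc 0 t, ∫⁻ ξ, wt 6 (maj G (n + 1) r) ξ with hB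
    set A := ∫⁻ ξ, wt 2 (maj G (n + 1) t) ξ with hA
    have hmn := measurable_maj hG n
    have h1 := energy_duhE_le hd (s := 2) (p := 1) le_rfl hG
      (measurable_expTail_param (measurable_wt_param 2 hmn)) ht
    have h2 : A + B ≤ y + F * B' := by
      have e : energy 2 1 (maj G (n + 1)) t = A + B := by
        simp only [energy, ENNReal.rpow_one]
        norm_num [hA, hB]
      rw [← e]
      refine h1.trans ?_
      simp only [sub_self, ENNReal.rpow_zero, one_mul, ENNReal.rpow_one]
      refine add_le_add le_rfl ?_
      norm_num
      calc _ ≤ ∫⁻ τ in Ioc 0 t, F * ∫⁻ ξ, wt 6 (maj G n τ) ξ := by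
            refine setLIntegral_mono' measurableSet_Ioc fun τ hτ => ?_
            have hmτ := measurable_slice hmn τ
            refine (lintegral_wt_four_expTail_le (measurable_wt 2 hmτ)).trans ?_
            refine mul_le_mul' ?_ (le_of_eq ?_)
            · refine (f2e_mono ?_).trans hF
              exact le_self_add.trans (ih hτ.1.le)
            · refine lintegral_congr_ae ?_
              filter_upwards [ae_rho_ne_zero hd] with ξ hξ
              rw [wt_wt hξ]
              norm_num
        _ = _ := lintegral_const_mul' _ _ hFt
    -- the monotonicity of the iteration lets `F * B'` be absorbed by `B`
    have hB'B : B' ≤ B := lintegral_mono fun r => lintegral_mono fun ξ =>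
      wt_mono 6 (maj_le_succ G n r) ξ
    have hB' : B' ≠ ⊤ := by
      intro htop
      have := ih ht
      rw [show (∫⁻ r in Ioc 0 t, ∫⁻ ξ, wt 6 (maj G n r) ξ) = ⊤ from htop, ENNReal.mul_top
        (tsub_pos_of_lt hF1).ne'] at this
      simp only [add_top, top_le_iff] at this
      exact hG1 this
    have hBt : B ≠ ⊤ := by
      refine ne_top_of_le_ne_top ?_ (le_add_self.trans h2)
      finiteness
    have hsplit : (1 - F) * B + F * B = B := by
      rw [← add_mul, tsub_add_cancel_of_le hF1.le, one_mul]
    refine (ENNReal.add_le_add_iff_right (a := F * B) (by finiteness)).1 ?_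
    rw [add_assoc, hsplit]
    exact h2.trans (by gcongr)

/-- Interpolation between the weights `2` and `6`. -/
lemma lintegral_wt_interp (hd : 1 ≤ d) {p : ℝ} (hp : 1 ≤ p) {m : E d → ℝ≥0∞} (hm : Measurable m)
    (hm1 : ∫⁻ ξ, wt 2 m ξ ≤ 1) :
    (∫⁻ ξ, wt (2 + 4 / p) m ξ) ^ p ≤ ∫⁻ ξ, wt 6 m ξ := by
  have hp0 : 0 < p := by linarith
  have h := ENNReal.lintegral_mul_norm_pow_le (μ := volume)
    (measurable_wt 2 hm).aemeasurable (measurable_wt 6 hm).aemeasurable (p := 1 - 1 / p)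
    (q := 1 / p) (by rw [sub_nonneg, div_le_one hp0]; exact hp) (by positivity) (by ring)
  have e : ∫⁻ ξ, wt (2 + 4 / p) m ξ = ∫⁻ ξ, wt 2 m ξ ^ (1 - 1 / p) * wt 6 m ξ ^ (1 / p) := by
    refine lintegral_congr_ae ?_
    filter_upwards [ae_rho_ne_zero hd] with ξ hξ
    have h1 : 0 ≤ 1 - 1 / p := by rw [sub_nonneg, div_le_one hp0]; exact hp
    rw [wt_rpow _ h1, wt_rpow _ (by positivity), mul_mul_mul_comm,
      ← ENNReal.rpow_add _ _ hξ (rho_ne_top _), ← ENNReal.rpow_add_of_nonneg _ _ h1 (by positivity)]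
    unfold wt
    simp only [sub_add_cancel, ENNReal.rpow_one]
    congr 2
    ring
  rw [e]
  calc _ ≤ ((∫⁻ ξ, wt 2 m ξ) ^ (1 - 1 / p) * (∫⁻ ξ, wt 6 m ξ) ^ (1 / p)) ^ p := by gcongr
    _ ≤ (1 * (∫⁻ ξ, wt 6 m ξ) ^ (1 / p)) ^ p := by
        gcongr
        exact ENNReal.rpow_le_one hm1 (by rw [sub_nonneg, div_le_one hp0]; exact hp)
    _ = _ := by rw [one_mul, ← ENNReal.rpow_mul, one_div_mul_cancel hp0.ne', ENNReal.rpow_one]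

end

section

variable {d : ℕ}

/-- The dissipative estimate for the critical norm of the limit of the majorants. -/
lemma lintegral_wt_two_majLim_le (hd : 1 ≤ d) {G : E d → ℝ≥0∞} (hG : Measurable G)
    (hG1 : ∫⁻ ξ, wt 2 G ξ ≠ ⊤) {F : ℝ≥0∞} (hF : f2e (∫⁻ ξ, wt 2 G ξ) ≤ F) (hF1 : F < 1)
    {t : ℝ} (ht : 0 ≤ t) :
    (∫⁻ ξ, wt 2 (majLim G t) ξ) + (1 - F) * ∫⁻ r in Ioc 0 t, ∫⁻ ξ, wt 6 (majLim G r) ξ ≤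
      ∫⁻ ξ, wt 2 G ξ := by
  have h1 := lintegral_wt_majLim_rpow one_pos hG 2 t
  have h2 := lintegral_lintegral_wt_majLim_rpow one_pos hG 6 t
  simp only [ENNReal.rpow_one] at h1 h2
  rw [h1, h2, ENNReal.mul_iSup, ENNReal.iSup_add_iSup_of_monotone]
  · exact iSup_le fun n => lintegral_wt_two_maj_le hd hG hG1 hF hF1 n ht
  · exact fun a b hab => lintegral_mono fun ξ => wt_mono 2 (maj_mono G t hab) ξ
  · exact fun a b hab => mul_le_mul' le_rfl
      (lintegral_mono fun r => lintegral_mono fun ξ => wt_mono 6 (maj_mono G r hab) ξ)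

lemma lpn_rpow {p : ℝ} (hp : 0 < p) (f : E d → ℝ≥0∞) : lpn p f ^ p = ∫⁻ ξ, f ξ ^ p := by
  unfold lpn
  rw [← ENNReal.rpow_mul, one_div_mul_cancel hp.ne', ENNReal.rpow_one]

/-- The `p`-th power form of the bound for the nonlinearity. -/
lemma exists_lintegral_wt_expTail_rpow_le (hd : 1 ≤ d) {s p : ℝ} (hp : 1 ≤ p) (hp2 : p ≤ 2)
    (hq : 0 ≤ s - 2 + 4 / p) : ∃ L : ℝ≥0, ∀ m : E d → ℝ≥0∞, Measurable m →
      ∫⁻ ξ, wt 2 m ξ ≤ 1 / 16 →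
      ∫⁻ ξ, wt (s - 2 + 4 / p) (expTail (wt 2 m)) ξ ^ p ≤
        2 * (1 / 7 * (∫⁻ ξ, wt (s + 4 / p) m ξ ^ p) +
          L * ((∫⁻ ξ, wt s m ξ ^ p) * ∫⁻ ξ, wt 6 m ξ)) := by
  have hp0 : 0 < p := by linarith
  have hθ1 : 1 ≤ 4 / p := by rw [le_div_iff₀ hp0]; linarith
  have hθ4 : 4 / p ≤ 4 := by rw [div_le_iff₀ hp0]; linarith
  obtain ⟨K, hK⟩ := exists_lpn_wt_expTail_le (d := d) hp hq hθ1 hθ4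
  refine ⟨K ^ p, fun m hm hm1 => ?_⟩
  have h16 : (1 / 16 : ℝ≥0∞) ≤ 1 := by rw [one_div]; exact ENNReal.inv_le_one.2 (by norm_num)
  have h := hK (wt 2 m) (measurable_wt 2 hm) hm1
  have eq1 : ∀ r : ℝ, lpn p (wt r (wt 2 m)) ^ p = ∫⁻ ξ, wt (r + 2) m ξ ^ p := fun r => by
    rw [lpn_rpow hp0]
    refine lintegral_congr_ae ?_
    filter_upwards [ae_rho_ne_zero hd] with ξ hξ
    rw [wt_wt hξ]
  have eq2 : ∫⁻ ξ, wt (4 / p) (wt 2 m) ξ = ∫⁻ ξ, wt (2 + 4 / p) m ξ := by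
    refine lintegral_congr_ae ?_
    filter_upwards [ae_rho_ne_zero hd] with ξ hξ
    rw [wt_wt hξ, add_comm]
  rw [← lpn_rpow hp0]
  calc _ ≤ (1 / 7 * lpn p (wt (s - 2 + 4 / p) (wt 2 m)) + K *
        (lpn p (wt (s - 2 + 4 / p - 4 / p) (wt 2 m)) * ∫⁻ ξ, wt (4 / p) (wt 2 m) ξ)) ^ p := by
        gcongr
    _ ≤ 2 ^ (p - 1) * ((1 / 7 * lpn p (wt (s - 2 + 4 / p) (wt 2 m))) ^ p + (K *
        (lpn p (wt (s - 2 + 4 / p - 4 / p) (wt 2 m)) * ∫⁻ ξ, wt (4 / p) (wt 2 m) ξ)) ^ p) :=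
        ENNReal.rpow_add_le_mul_rpow_add_rpow _ _ hp
    _ = 2 ^ (p - 1) * ((1 / 7) ^ p * (∫⁻ ξ, wt (s + 4 / p) m ξ ^ p) +
          K ^ p * ((∫⁻ ξ, wt s m ξ ^ p) * (∫⁻ ξ, wt (2 + 4 / p) m ξ) ^ p)) := by
        rw [ENNReal.mul_rpow_of_nonneg _ _ hp0.le, ENNReal.mul_rpow_of_nonneg _ _ hp0.le,
          ENNReal.mul_rpow_of_nonneg _ _ hp0.le, eq1, eq1, eq2]
        ring_nf
    _ ≤ 2 ^ (1 : ℝ) * ((1 / 7) ^ (1 : ℝ) * (∫⁻ ξ, wt (s + 4 / p) m ξ ^ p) +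
          K ^ p * ((∫⁻ ξ, wt s m ξ ^ p) * ∫⁻ ξ, wt 6 m ξ)) := by
        gcongr ?_ * (?_ * _ + _ * (_ * ?_))
        · exact ENNReal.rpow_le_rpow_of_exponent_le (by norm_num) (by linarith)
        · exact ENNReal.rpow_le_rpow_of_exponent_ge
            (by rw [one_div]; exact ENNReal.inv_le_one.2 (by norm_num)) hp
        · exact lintegral_wt_interp hd hp hm (hm1.trans h16)
    _ = _ := by
        rw [ENNReal.rpow_one, ENNReal.rpow_one, ENNReal.coe_rpow_of_nonneg _ hp0.le]

/-- Uniform bounds for the weighted energies of the majorants. The first part of the nonlinearity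
is absorbed by the dissipation, the second by the Gronwall weight built from the dissipation of
the critical norm. -/
lemma exists_energy_majLim_le (hd : 1 ≤ d) {s p : ℝ} (hp : 1 ≤ p) (hp2 : p ≤ 2)
    (hq : 0 ≤ s - 2 + 4 / p) : ∃ C : ℝ≥0, ∀ G : E d → ℝ≥0∞, Measurable G →
      ∫⁻ ξ, wt 2 G ξ ≤ 1 / 16 → f2e (∫⁻ ξ, wt 2 G ξ) ≤ 1 / 2 → ∀ t : ℝ, 0 ≤ t →
      energy s p (majLim G) t ≤ C * ∫⁻ ξ, wt s G ξ ^ p := by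
  have hp0 : 0 < p := by linarith
  obtain ⟨L, hL⟩ := exists_lintegral_wt_expTail_rpow_le hd hp hp2 hq
  set lam : ℝ := 64 * L + 1 with hlam
  have hlam0 : 0 < lam := by positivity
  refine ⟨16 * Real.toNNReal (Real.exp lam), fun G hG hG1 hG2 t ht => ?_⟩
  have h16 : (1 / 16 : ℝ≥0∞) ≤ 1 := by rw [one_div]; exact ENNReal.inv_le_one.2 (by norm_num)
  have hGt : ∫⁻ ξ, wt 2 G ξ ≠ ⊤ := ne_top_of_le_ne_top ENNReal.one_ne_top (hG1.trans h16)
  have hhalf : (1 / 2 : ℝ≥0∞) < 1 := by simp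
  have hsub : (1 : ℝ≥0∞) - 1 / 2 = 1 / 2 := by simp
  set Y : ℝ → ℝ≥0∞ := fun r => ∫⁻ ξ, wt 6 (majLim G r) ξ with hY
  have hYm : Measurable Y := Measurable.lintegral_prod_right'
    (measurable_wt_param _ (measurable_majLim hG))
  have hη : ∀ r, 0 ≤ r → ∫⁻ σ in Ioc 0 r, Y σ ≤ 1 := fun r hr => by
    have h := le_add_self.trans (lintegral_wt_two_majLim_le hd hG hGt hG2 hhalf hr)
    rw [hsub] at h
    calc ∫⁻ σ in Ioc 0 r, Y σ = 2 * (1 / 2 * ∫⁻ σ in Ioc 0 r, Y σ) := by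
          rw [← mul_assoc, one_div, ENNReal.mul_inv_cancel (by simp) (by simp), one_mul]
      _ ≤ 2 * (1 / 16) := by gcongr; exact h.trans hG1
      _ ≤ 1 := by
        rw [one_div, ← div_eq_mul_inv]
        exact ENNReal.div_le_of_le_mul (by norm_num)
  -- the Gronwall weight is bounded by `exp lam`, since the dissipation `∫ Y` is at most `1`
  set w : ℝ → ℝ≥0∞ := fun r =>
    ENNReal.ofReal (Real.exp (lam * (∫⁻ σ in Ioc 0 r, Y σ).toReal)) with hw
  have hw1 : ∀ r, 1 ≤ w r := fun r => by
    simp only [hw]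
    rw [ENNReal.one_le_ofReal, Real.one_le_exp_iff]
    positivity
  set Z := ∫⁻ ξ, wt s G ξ ^ p with hZ
  -- the terms produced by the previous iterate add up to `13 * Z * w t`, so that the bound is inherited
  have hind : ∀ n, ∀ t, 0 ≤ t → energy s p (maj G n) t ≤ 16 * Z * w t := by
    intro n
    induction n with
    | zero =>
      intro t ht
      simp [energy, maj, wt, hp0]
    | succ n ih =>
      intro t ht
      have hmn := measurable_maj hG n
      have hZn : Measurable fun τ => ∫⁻ ξ, wt s (maj G n τ) ξ ^ p :=
        Measurable.lintegral_prod_right' ((measurable_wt_param _ hmn).pow_const p)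
      have hXn : Measurable fun τ => ∫⁻ ξ, wt (s + 4 / p) (maj G n τ) ξ ^ p :=
        Measurable.lintegral_prod_right' ((measurable_wt_param _ hmn).pow_const p)
      have hnl : ∫⁻ τ in Ioc 0 t, ∫⁻ ξ, wt (s - 2 + 4 / p)
          (expTail (wt 2 (maj G n τ))) ξ ^ p ≤ 2 * (1 / 7 * (16 * Z * w t) +
            L * (16 * Z * ∫⁻ τ in Ioc 0 t, Y τ * w τ)) := by
        calc _ ≤ ∫⁻ τ in Ioc 0 t, 2 * (1 / 7 * (∫⁻ ξ, wt (s + 4 / p) (maj G n τ) ξ ^ p) +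
              L * (16 * Z * (Y τ * w τ))) := by
              refine setLIntegral_mono' measurableSet_Ioc fun τ hτ => ?_
              have hτ1 : ∫⁻ ξ, wt 2 (maj G n τ) ξ ≤ 1 / 16 :=
                le_self_add.trans ((lintegral_wt_two_maj_le hd hG hGt hG2 hhalf n hτ.1.le).trans hG1)
              refine (hL _ (measurable_slice hmn τ) hτ1).trans ?_
              gcongr 2 * (_ + _ * ?_)
              calc _ ≤ 16 * Z * w τ * Y τ := by
                    refine mul_le_mul' (le_self_add.trans (ih τ hτ.1.le)) ?_
                    exact lintegral_mono fun ξ => wt_mono 6 (maj_le_majLim G n τ) ξ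
                _ = _ := by ring
          _ = 2 * (1 / 7 * (∫⁻ τ in Ioc 0 t, ∫⁻ ξ, wt (s + 4 / p) (maj G n τ) ξ ^ p) +
              ∫⁻ τ in Ioc 0 t, L * (16 * Z * (Y τ * w τ))) := by
              rw [lintegral_const_mul' _ _ (by simp), lintegral_add_left (hXn.const_mul _),
                lintegral_const_mul' _ _ (by simp)]
          _ ≤ _ := by
              have hwm : Measurable w := by
                have h1 : Measurable fun r => ∫⁻ σ in Ioc 0 r, Y σ :=
                  measurable_setLIntegral_Ioc (F := fun _ σ => Y σ)
                    (hYm.comp measurable_snd) measurable_id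
                simp only [hw]
                fun_prop
              rw [lintegral_const_mul _ (by fun_prop), lintegral_const_mul _ (by fun_prop)]
              gcongr
              exact le_add_self.trans (ih t ht)
      have hgr : 64 * L * (∫⁻ τ in Ioc 0 t, Y τ * w τ) ≤ w t := by
        have h1 := lintegral_mul_exp_le hYm ht
          (ne_top_of_le_ne_top ENNReal.one_ne_top (hη t ht)) hlam0
        refine le_trans (mul_le_mul' ?_ le_rfl) h1
        rw [hlam, ENNReal.ofReal_add (by positivity) (by norm_num),
          ENNReal.ofReal_mul (by norm_num)]
        simp
      have h2p : (2 : ℝ≥0∞) ^ (p - 1) ≤ 2 := by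
        calc (2 : ℝ≥0∞) ^ (p - 1) ≤ 2 ^ (1 : ℝ) :=
              ENNReal.rpow_le_rpow_of_exponent_le (by norm_num) (by linarith)
          _ = 2 := ENNReal.rpow_one _
      calc energy s p (maj G (n + 1)) t ≤ 2 ^ (p - 1) * (Z + ∫⁻ τ in Ioc 0 t, ∫⁻ ξ,
            wt (s - 2 + 4 / p) (expTail (wt 2 (maj G n τ))) ξ ^ p) :=
            energy_duhE_le hd hp hG (measurable_expTail_param (measurable_wt_param 2 hmn)) ht
        _ ≤ 2 * (Z * w t + 2 * (1 / 7 * (16 * Z * w t) +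
              L * (16 * Z * ∫⁻ τ in Ioc 0 t, Y τ * w τ))) := by
            gcongr
            exact le_mul_of_one_le_right' (hw1 t)
        _ = Z * (2 * w t + 64 / 7 * w t + 64 * L * (∫⁻ τ in Ioc 0 t, Y τ * w τ)) := by
            rw [show (64 / 7 : ℝ≥0∞) = 64 * (1 / 7) by rw [one_div, div_eq_mul_inv]]
            ring
        _ ≤ Z * (2 * w t + 10 * w t + w t) := by
            gcongr
            exact ENNReal.div_le_of_le_mul (by norm_num)
        _ = 13 * Z * w t := by ring
        _ ≤ 16 * Z * w t := by gcongr; norm_num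
  refine (energy_majLim_le hp0 hG fun n => hind n t ht).trans ?_
  rw [ENNReal.coe_mul, mul_right_comm]
  gcongr
  · simp
  · simp only [hw]
    refine ENNReal.ofReal_le_ofReal (Real.exp_le_exp.2 ?_)
    have : (∫⁻ σ in Ioc 0 t, Y σ).toReal ≤ 1 := by
      rw [← ENNReal.toReal_one]
      exact ENNReal.toReal_mono ENNReal.one_ne_top (hη t ht)
    nlinarith

end

section

/-! ### Convolution powers of complex functions -/

/-- `B` dominates `b` and the increment `A - B` dominates `a - b`. This relation passes through all
the operations from which the Picard iterations are built. -/
def Dom (b a : ℂ) (B A : ℝ≥0∞) : Prop := ‖b‖ₑ ≤ B ∧ ‖a - b‖ₑ + B ≤ A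

lemma Dom.self (a : ℂ) : Dom a a ‖a‖ₑ ‖a‖ₑ := ⟨le_rfl, by simp⟩

lemma Dom.right_le {b a : ℂ} {B A : ℝ≥0∞} (h : Dom b a B A) : ‖a‖ₑ ≤ A := by
  calc ‖a‖ₑ = ‖(a - b) + b‖ₑ := by rw [sub_add_cancel]
    _ ≤ ‖a - b‖ₑ + ‖b‖ₑ := enorm_add_le _ _
    _ ≤ ‖a - b‖ₑ + B := by gcongr; exact h.1
    _ ≤ A := h.2

lemma Dom.mul {b a b' a' : ℂ} {B A B' A' : ℝ≥0∞} (h : Dom b a B A) (h' : Dom b' a' B' A') :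
    Dom (b * b') (a * a') (B * B') (A * A') := by
  refine ⟨by rw [enorm_mul]; exact mul_le_mul' h.1 h'.1, ?_⟩
  have e : a * a' - b * b' = (a - b) * (a' - b') + (a - b) * b' + b * (a' - b') := by ring
  calc ‖a * a' - b * b'‖ₑ + B * B'
      ≤ ‖(a - b) * (a' - b')‖ₑ + ‖(a - b) * b'‖ₑ + ‖b * (a' - b')‖ₑ + B * B' := by
        rw [e]
        gcongr
        exact (enorm_add_le _ _).trans (by gcongr; exact enorm_add_le _ _)
    _ ≤ ‖a - b‖ₑ * ‖a' - b'‖ₑ + ‖a - b‖ₑ * B' + B * ‖a' - b'‖ₑ + B * B' := by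
        simp only [enorm_mul]
        gcongr
        · exact h'.1
        · exact h.1
    _ = (‖a - b‖ₑ + B) * (‖a' - b'‖ₑ + B') := by ring
    _ ≤ A * A' := mul_le_mul' h.2 h'.2

lemma Dom.const_mul {b a : ℂ} {B A : ℝ≥0∞} (h : Dom b a B A) (c : ℂ) :
    Dom (c * b) (c * a) (‖c‖ₑ * B) (‖c‖ₑ * A) := (Dom.self c).mul h

lemma Dom.add {b a b' a' : ℂ} {B A B' A' : ℝ≥0∞} (h : Dom b a B A) (h' : Dom b' a' B' A') :
    Dom (b + b') (a + a') (B + B') (A + A') := by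
  refine ⟨(enorm_add_le _ _).trans (add_le_add h.1 h'.1), ?_⟩
  calc ‖a + a' - (b + b')‖ₑ + (B + B') = ‖(a - b) + (a' - b')‖ₑ + (B + B') := by
        congr 2; ring
    _ ≤ ‖a - b‖ₑ + ‖a' - b'‖ₑ + (B + B') := by gcongr; exact enorm_add_le _ _
    _ = (‖a - b‖ₑ + B) + (‖a' - b'‖ₑ + B') := by ring
    _ ≤ A + A' := add_le_add h.2 h'.2

lemma Dom.neg {b a : ℂ} {B A : ℝ≥0∞} (h : Dom b a B A) : Dom (-b) (-a) B A := by
  refine ⟨by simpa using h.1, ?_⟩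
  rw [← neg_add_eq_sub, neg_neg, ← sub_eq_add_neg, enorm_sub_rev]
  exact h.2

lemma Dom.integral {α : Type*} [MeasurableSpace α] {μ : Measure α} {b a : α → ℂ}
    {B A : α → ℝ≥0∞} (hb : Measurable b) (ha : Measurable a) (hB : Measurable B)
    (h : ∀ᵐ x ∂μ, Dom (b x) (a x) (B x) (A x)) :
    Dom (∫ x, b x ∂μ) (∫ x, a x ∂μ) (∫⁻ x, B x ∂μ) (∫⁻ x, A x ∂μ) := by
  refine ⟨(enorm_integral_le_lintegral_enorm _).trans
    (lintegral_mono_ae (h.mono fun x hx => hx.1)), ?_⟩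
  by_cases hA : ∫⁻ x, A x ∂μ = ⊤
  · rw [hA]; exact le_top
  have hai : Integrable a μ := ⟨ha.aestronglyMeasurable,
    (lintegral_mono_ae (h.mono fun x hx => hx.right_le)).trans_lt (lt_top_iff_ne_top.2 hA)⟩
  have hbi : Integrable b μ := ⟨hb.aestronglyMeasurable,
    (lintegral_mono_ae (h.mono fun x hx => hx.1.trans (le_add_self.trans hx.2))).trans_lt
      (lt_top_iff_ne_top.2 hA)⟩
  rw [← integral_sub hai hbi]
  calc ‖∫ x, (a x - b x) ∂μ‖ₑ + ∫⁻ x, B x ∂μ ≤ (∫⁻ x, ‖a x - b x‖ₑ ∂μ) + ∫⁻ x, B x ∂μ := by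
        gcongr; exact enorm_integral_le_lintegral_enorm _
    _ = ∫⁻ x, (‖a x - b x‖ₑ + B x) ∂μ := (lintegral_add_right _ hB).symm
    _ ≤ ∫⁻ x, A x ∂μ := lintegral_mono_ae (h.mono fun x hx => hx.2)

/-- The convolution of two complex functions. -/
def cconv {d : ℕ} (f g : E d → ℂ) (x : E d) : ℂ := ∫ y, f y * g (x - y)

/-- The convolution power `f^{*(n+1)}` of a complex function. -/
def cconvPow {d : ℕ} (f : E d → ℂ) : ℕ → E d → ℂ
  | 0 => f
  | n + 1 => cconv f (cconvPow f n)

/-- The nonlinear part `∑_{j ≥ 2} f^{*j} / j!` of the convolution exponential of a complex function.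
Writing the series as an integral over the counting measure makes it measurable in parameters
without any hypothesis of convergence. -/
def cexpTail {d : ℕ} (f : E d → ℂ) (x : E d) : ℂ :=
  ∫ n : ℕ, ((n + 2).factorial : ℂ)⁻¹ * cconvPow f (n + 1) x ∂Measure.count

section

variable {d : ℕ} {α : Type*} [MeasurableSpace α]

lemma measurable_cconv_param {f g : α → E d → ℂ} (hf : Measurable (Function.uncurry f))
    (hg : Measurable (Function.uncurry g)) :
    Measurable (Function.uncurry fun a => cconv (f a) (g a)) := by
  unfold cconv
  have h1 : Measurable fun p : (α × E d) × E d => f p.1.1 p.2 * g p.1.1 (p.1.2 - p.2) :=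
    (hf.comp (by fun_prop : Measurable fun p : (α × E d) × E d => (p.1.1, p.2))).mul
      (hg.comp (by fun_prop : Measurable fun p : (α × E d) × E d => (p.1.1, p.1.2 - p.2)))
  exact h1.stronglyMeasurable.integral_prod_right'.measurable

lemma measurable_cconvPow_param {f : α → E d → ℂ} (hf : Measurable (Function.uncurry f))
    (n : ℕ) : Measurable (Function.uncurry fun a => cconvPow (f a) n) := by
  induction n with
  | zero => exact hf
  | succ n ih => exact measurable_cconv_param hf ih

lemma measurable_cexpTail_param {f : α → E d → ℂ} (hf : Measurable (Function.uncurry f)) :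
    Measurable (Function.uncurry fun a => cexpTail (f a)) := by
  have h1 : Measurable fun p : (α × E d) × ℕ =>
      ((p.2 + 2).factorial : ℂ)⁻¹ * cconvPow (f p.1.1) (p.2 + 1) p.1.2 :=
    measurable_from_prod_countable_left fun n =>
      (measurable_cconvPow_param hf (n + 1)).const_mul ((n + 2).factorial : ℂ)⁻¹
  exact h1.stronglyMeasurable.integral_prod_right'.measurable

end

variable {d : ℕ}

lemma measurable_cconv {f g : E d → ℂ} (hf : Measurable f) (hg : Measurable g) :
    Measurable (cconv f g) := by
  have h1 : Measurable fun p : E d × E d => f p.2 * g (p.1 - p.2) := by fun_prop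
  exact h1.stronglyMeasurable.integral_prod_right'.measurable

lemma measurable_cconvPow {f : E d → ℂ} (hf : Measurable f) (n : ℕ) :
    Measurable (cconvPow f n) := by
  induction n with
  | zero => exact hf
  | succ n ih => exact measurable_cconv hf ih

lemma measurable_cexpTail {f : E d → ℂ} (hf : Measurable f) : Measurable (cexpTail f) := by
  have h1 : Measurable fun p : E d × ℕ =>
      ((p.2 + 2).factorial : ℂ)⁻¹ * cconvPow f (p.2 + 1) p.1 :=
    measurable_from_prod_countable_left fun n =>
      (measurable_cconvPow hf (n + 1)).const_mul ((n + 2).factorial : ℂ)⁻¹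
  exact h1.stronglyMeasurable.integral_prod_right'.measurable

lemma cconv_congr {f f' g g' : E d → ℂ} (hf : f =ᵐ[volume] f') (hg : g =ᵐ[volume] g') :
    cconv f g = cconv f' g' := by
  ext x
  refine integral_congr_ae ?_
  have h := (quasiMeasurePreserving_sub_left_of_right_invariant volume x).ae_eq_comp hg
  filter_upwards [hf, h] with y h1 h2
  simp only [Function.comp] at h2
  rw [h1, h2]

lemma cconvPow_succ_congr {f f' : E d → ℂ} (hf : f =ᵐ[volume] f') (n : ℕ) :
    cconvPow f (n + 1) = cconvPow f' (n + 1) := by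
  induction n with
  | zero => exact cconv_congr hf hf
  | succ n ih => exact cconv_congr hf (by rw [ih])

lemma cexpTail_congr {f f' : E d → ℂ} (hf : f =ᵐ[volume] f') : cexpTail f = cexpTail f' := by
  ext x
  simp only [cexpTail, cconvPow_succ_congr hf]

section

variable {b a : E d → ℂ} {B A : E d → ℝ≥0∞}

lemma dom_cconvPow (hb : Measurable b) (ha : Measurable a) (hB : Measurable B)
    (h : ∀ x, Dom (b x) (a x) (B x) (A x)) (n : ℕ) (x : E d) :
    Dom (cconvPow b n x) (cconvPow a n x) (convPow B n x) (convPow A n x) := by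
  induction n generalizing x with
  | zero => exact h x
  | succ n ih =>
    have h1 := measurable_cconvPow hb n
    have h2 := measurable_cconvPow ha n
    have h3 := measurable_convPow hB n
    exact Dom.integral (by fun_prop) (by fun_prop) (by fun_prop)
      (Filter.Eventually.of_forall fun y => (h y).mul (ih (x - y)))

lemma dom_cexpTail (hb : Measurable b) (ha : Measurable a) (hB : Measurable B)
    (h : ∀ x, Dom (b x) (a x) (B x) (A x)) (x : E d) :
    Dom (cexpTail b x) (cexpTail a x) (expTail B x) (expTail A x) := by
  unfold cexpTail expTail
  rw [← lintegral_count, ← lintegral_count]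
  refine Dom.integral (measurable_of_countable _) (measurable_of_countable _)
    (measurable_of_countable _) (Filter.Eventually.of_forall fun n => ?_)
  have e : ‖((n + 2).factorial : ℂ)⁻¹‖ₑ = ((n + 2).factorial : ℝ≥0∞)⁻¹ := by
    rw [enorm_inv (by exact_mod_cast (n + 2).factorial_ne_zero)]
    congr 1
    rw [← ofReal_norm]
    simp
  have := (dom_cconvPow hb ha hB h (n + 1) x).const_mul ((n + 2).factorial : ℂ)⁻¹
  rwa [e] at this

end

lemma enorm_cconvPow_le {f : E d → ℂ} (hf : Measurable f) (n : ℕ) (x : E d) :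
    ‖cconvPow f n x‖ₑ ≤ convPow (fun y => ‖f y‖ₑ) n x :=
  (dom_cconvPow hf hf hf.enorm (fun x => Dom.self (f x)) n x).1

lemma enorm_cexpTail_le {f : E d → ℂ} (hf : Measurable f) (x : E d) :
    ‖cexpTail f x‖ₑ ≤ expTail (fun y => ‖f y‖ₑ) x :=
  (dom_cexpTail hf hf hf.enorm (fun x => Dom.self (f x)) x).1

/-- Hermitian symmetry, the Fourier side of being real valued. -/
def Herm (f : E d → ℂ) : Prop := ∀ ξ, f (-ξ) = star (f ξ)

lemma Herm.cconv {f g : E d → ℂ} (hf : Herm f) (hg : Herm g) : Herm (cconv f g) := fun x => by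
  have h := integral_neg_eq_self (fun y => f y * g (-x - y)) (volume : Measure (E d))
  unfold ExpPDE.cconv
  rw [← h]
  simp only [RCLike.star_def, ← integral_conj]
  refine integral_congr_ae (Filter.Eventually.of_forall fun y => ?_)
  have e : -x - -y = -(x - y) := by abel
  simp only [e, hf y, hg (x - y), map_mul, RCLike.star_def]

lemma Herm.cconvPow {f : E d → ℂ} (hf : Herm f) (n : ℕ) : Herm (cconvPow f n) := by
  induction n with
  | zero => exact hf
  | succ n ih => exact hf.cconv ih

lemma Herm.cexpTail {f : E d → ℂ} (hf : Herm f) : Herm (cexpTail f) := fun x => by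
  unfold ExpPDE.cexpTail
  simp only [RCLike.star_def, ← integral_conj]
  refine integral_congr_ae (Filter.Eventually.of_forall fun n => ?_)
  simp [hf.cconvPow (n + 1) x]

end

section

variable {d : ℕ}

/-! ### The Picard iteration on the Fourier side -/

/-- Multiplication by `|2πξ|²`, the Fourier side of `-Δ`. -/
def cwt (f : E d → ℂ) (ξ : E d) : ℂ := (((2 * Real.pi * ‖ξ‖) ^ 2 : ℝ) : ℂ) * f ξ

/-- Duhamel's formula for `g_t = -|2πξ|⁴ g - |2πξ|² N`. -/
def duhC (g₀ : E d → ℂ) (N : ℝ → E d → ℂ) (t : ℝ) (ξ : E d) : ℂ :=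
  (heat t ξ : ℂ) * g₀ ξ - ∫ τ in Ioc 0 t, (heat (t - τ) ξ : ℂ) * cwt (N τ) ξ

/-- The Picard iteration for the Fourier transform of the solution. -/
def picard (g₀ : E d → ℂ) : ℕ → ℝ → E d → ℂ
  | 0 => fun _ _ => 0
  | n + 1 => duhC g₀ fun τ => cexpTail (cwt (picard g₀ n τ))

lemma enorm_cwt_mult (ξ : E d) :
    ‖(((2 * Real.pi * ‖ξ‖) ^ 2 : ℝ) : ℂ)‖ₑ = rho ξ ^ (2 : ℝ) := by
  rw [← ofReal_norm, Complex.norm_real, Real.norm_of_nonneg (by positivity),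
    ENNReal.ofReal_pow (by positivity)]
  unfold rho
  norm_cast

lemma enorm_cwt (f : E d → ℂ) (ξ : E d) : ‖cwt f ξ‖ₑ = wt 2 (fun x => ‖f x‖ₑ) ξ := by
  unfold cwt wt
  rw [enorm_mul, enorm_cwt_mult]

lemma enorm_heat (t : ℝ) (ξ : E d) : ‖(heat t ξ : ℂ)‖ₑ = ENNReal.ofReal (heat t ξ) := by
  rw [← ofReal_norm, Complex.norm_real, Real.norm_of_nonneg (show 0 ≤ heat t ξ from (Real.exp_pos _).le)]

lemma Dom.cwt {b a : E d → ℂ} {B A : E d → ℝ≥0∞} {ξ : E d} (h : Dom (b ξ) (a ξ) (B ξ) (A ξ)) :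
    Dom (cwt b ξ) (cwt a ξ) (wt 2 B ξ) (wt 2 A ξ) := by
  have := h.const_mul (((2 * Real.pi * ‖ξ‖) ^ 2 : ℝ) : ℂ)
  rwa [enorm_cwt_mult] at this

lemma measurable_cwt_param {α : Type*} [MeasurableSpace α] {f : α → E d → ℂ}
    (hf : Measurable (Function.uncurry f)) :
    Measurable (Function.uncurry fun a => cwt (f a)) := by
  have h1 : Measurable fun p : α × E d => (((2 * Real.pi * ‖p.2‖) ^ 2 : ℝ) : ℂ) := by fun_prop
  exact h1.mul hf

lemma measurable_cwt {f : E d → ℂ} (hf : Measurable f) : Measurable (cwt f) := by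
  unfold cwt; fun_prop

lemma measurable_cslice {f : ℝ → E d → ℂ} (hf : Measurable (Function.uncurry f))
    (t : ℝ) : Measurable (f t) := hf.comp (by fun_prop : Measurable fun ξ : E d => (t, ξ))

lemma measurable_setIntegral_Ioc {α : Type*} [MeasurableSpace α] {F : α → ℝ → ℂ}
    (hF : Measurable (Function.uncurry F)) {b : α → ℝ} (hb : Measurable b) :
    Measurable fun a => ∫ τ in Ioc 0 (b a), F a τ := by
  have : ∀ a, ∫ τ in Ioc 0 (b a), F a τ = ∫ τ, if 0 < τ ∧ τ ≤ b a then F a τ else 0 := fun a => by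
    rw [← integral_indicator measurableSet_Ioc]
    simp only [indicator, mem_Ioc]
  simp_rw [this]
  have h1 : Measurable fun p : α × ℝ => if 0 < p.2 ∧ p.2 ≤ b p.1 then F p.1 p.2 else 0 := by
    refine Measurable.ite ?_ hF measurable_const
    exact (measurableSet_lt measurable_const measurable_snd).inter
      (measurableSet_le measurable_snd (hb.comp measurable_fst))
  exact h1.stronglyMeasurable.integral_prod_right'.measurable

lemma measurable_duhC {g₀ : E d → ℂ} {N : ℝ → E d → ℂ} (hg : Measurable g₀)
    (hN : Measurable (Function.uncurry N)) : Measurable (Function.uncurry (duhC g₀ N)) := by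
  refine Measurable.sub ?_ ?_
  · exact (Complex.measurable_ofReal.comp measurable_heat).mul (hg.comp measurable_snd)
  · refine measurable_setIntegral_Ioc (α := ℝ × E d)
      (F := fun q τ => (heat (q.1 - τ) q.2 : ℂ) * cwt (N τ) q.2) ?_ measurable_fst
    refine Measurable.mul ?_ ?_
    · exact Complex.measurable_ofReal.comp (measurable_heat.comp
        (by fun_prop : Measurable fun p : (ℝ × E d) × ℝ => (p.1.1 - p.2, p.1.2)))
    · exact (measurable_cwt_param hN).comp
        (by fun_prop : Measurable fun p : (ℝ × E d) × ℝ => (p.2, p.1.2))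

lemma measurable_picard {g₀ : E d → ℂ} (hg : Measurable g₀) (n : ℕ) :
    Measurable (Function.uncurry (picard g₀ n)) := by
  induction n with
  | zero => exact measurable_const
  | succ n ih => exact measurable_duhC hg (measurable_cexpTail_param (measurable_cwt_param ih))

lemma dom_duhC {g₀ : E d → ℂ} {b a : ℝ → E d → ℂ} {B A : ℝ → E d → ℝ≥0∞} {t : ℝ} {ξ : E d}
    (hb : Measurable (Function.uncurry b)) (ha : Measurable (Function.uncurry a))
    (hB : Measurable (Function.uncurry B))
    (h : ∀ τ ∈ Ioc 0 t, Dom (b τ ξ) (a τ ξ) (B τ ξ) (A τ ξ)) :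
    Dom (duhC g₀ b t ξ) (duhC g₀ a t ξ) (duhE (fun ξ => ‖g₀ ξ‖ₑ) B t ξ)
      (duhE (fun ξ => ‖g₀ ξ‖ₑ) A t ξ) := by
  unfold duhC duhE
  simp only [sub_eq_add_neg]
  have hh : Measurable fun τ : ℝ => heat (t + -τ) ξ := by unfold heat; fun_prop
  refine Dom.add ?_ (Dom.neg (Dom.integral ?_ ?_ ?_ ?_))
  · have := (Dom.self (g₀ ξ)).const_mul (heat t ξ)
    rwa [enorm_heat] at this
  · exact (Complex.measurable_ofReal.comp hh).mul (measurable_cwt_param hb).of_uncurry_right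
  · exact (Complex.measurable_ofReal.comp hh).mul (measurable_cwt_param ha).of_uncurry_right
  · exact hh.ennreal_ofReal.mul (measurable_wt_param 2 hB).of_uncurry_right
  · filter_upwards [ae_restrict_mem measurableSet_Ioc] with τ hτ
    have := (h τ hτ).cwt.const_mul (heat (t + -τ) ξ)
    rwa [enorm_heat] at this

/-- One step of the Picard iteration respects domination. -/
lemma dom_duhC_cexpTail {g₀ : E d → ℂ} {b a : ℝ → E d → ℂ} {B A : ℝ → E d → ℝ≥0∞}
    (hb : Measurable (Function.uncurry b)) (ha : Measurable (Function.uncurry a))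
    (hB : Measurable (Function.uncurry B))
    (h : ∀ τ ξ, Dom (b τ ξ) (a τ ξ) (B τ ξ) (A τ ξ)) (t : ℝ) (ξ : E d) :
    Dom (duhC g₀ (fun τ => cexpTail (cwt (b τ))) t ξ) (duhC g₀ (fun τ => cexpTail (cwt (a τ))) t ξ)
      (duhE (fun ξ => ‖g₀ ξ‖ₑ) (fun τ => expTail (wt 2 (B τ))) t ξ)
      (duhE (fun ξ => ‖g₀ ξ‖ₑ) (fun τ => expTail (wt 2 (A τ))) t ξ) :=
  dom_duhC (measurable_cexpTail_param (measurable_cwt_param hb))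
    (measurable_cexpTail_param (measurable_cwt_param ha))
    (measurable_expTail_param (measurable_wt_param 2 hB)) fun τ _ =>
      dom_cexpTail (measurable_cwt (measurable_cslice hb τ)) (measurable_cwt (measurable_cslice ha τ))
        (measurable_wt 2 (measurable_slice hB τ)) (fun η => (h τ η).cwt) ξ

lemma dom_picard {g₀ : E d → ℂ} (hg : Measurable g₀) (n : ℕ) (t : ℝ) (ξ : E d) :
    Dom (picard g₀ n t ξ) (picard g₀ (n + 1) t ξ) (maj (fun ξ => ‖g₀ ξ‖ₑ) n t ξ)
      (maj (fun ξ => ‖g₀ ξ‖ₑ) (n + 1) t ξ) := by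
  induction n generalizing t ξ with
  | zero =>
    have h := (dom_duhC_cexpTail (g₀ := g₀) (b := fun _ _ => 0) (a := fun _ _ => 0)
      (B := fun _ _ => 0) (A := fun _ _ => 0) measurable_const measurable_const measurable_const
      (fun τ ξ => by simp [Dom]) t ξ).1
    refine ⟨by simp [picard], ?_⟩
    simpa [picard, maj] using h
  | succ n ih =>
    exact dom_duhC_cexpTail (measurable_picard hg n) (measurable_picard hg (n + 1))
      (measurable_maj hg.enorm n) ih t ξ

lemma dom_picard_of_le {g₀ : E d → ℂ} (hg : Measurable g₀) {n m : ℕ} (hnm : n ≤ m) (t : ℝ)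
    (ξ : E d) :
    Dom (picard g₀ n t ξ) (picard g₀ m t ξ) (maj (fun ξ => ‖g₀ ξ‖ₑ) n t ξ)
      (maj (fun ξ => ‖g₀ ξ‖ₑ) m t ξ) := by
  induction m, hnm using Nat.le_induction with
  | base => exact ⟨(dom_picard hg n t ξ).1, by simp⟩
  | succ m _ ih =>
    refine ⟨ih.1, ?_⟩
    have h2 := (dom_picard hg m t ξ).2
    calc ‖picard g₀ (m + 1) t ξ - picard g₀ n t ξ‖ₑ + maj (fun ξ => ‖g₀ ξ‖ₑ) n t ξ
        = ‖(picard g₀ (m + 1) t ξ - picard g₀ m t ξ) + (picard g₀ m t ξ - picard g₀ n t ξ)‖ₑ +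
            maj (fun ξ => ‖g₀ ξ‖ₑ) n t ξ := by rw [sub_add_sub_cancel]
      _ ≤ ‖picard g₀ (m + 1) t ξ - picard g₀ m t ξ‖ₑ + ‖picard g₀ m t ξ - picard g₀ n t ξ‖ₑ +
            maj (fun ξ => ‖g₀ ξ‖ₑ) n t ξ := by gcongr; exact enorm_add_le _ _
      _ ≤ ‖picard g₀ (m + 1) t ξ - picard g₀ m t ξ‖ₑ + maj (fun ξ => ‖g₀ ξ‖ₑ) m t ξ := by
          rw [add_assoc]; gcongr; exact ih.2
      _ ≤ _ := h2

/-- The pointwise limit of the Picard iteration. -/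
def picardLim (g₀ : E d → ℂ) (t : ℝ) (ξ : E d) : ℂ :=
  Filter.atTop.limUnder fun n => picard g₀ n t ξ

lemma measurable_picardLim {g₀ : E d → ℂ} (hg : Measurable g₀) :
    Measurable (Function.uncurry (picardLim g₀)) :=
  (StronglyMeasurable.limUnder (l := Filter.atTop) (f := fun n => Function.uncurry (picard g₀ n))
    fun n => (measurable_picard hg n).stronglyMeasurable).measurable

lemma tendsto_maj (G : E d → ℝ≥0∞) (t : ℝ) (ξ : E d) :
    Filter.Tendsto (fun n => maj G n t ξ) Filter.atTop (nhds (majLim G t ξ)) :=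
  tendsto_atTop_iSup fun _ _ h => maj_mono G t h ξ

lemma tendsto_picard {g₀ : E d → ℂ} (hg : Measurable g₀) {t : ℝ} {ξ : E d}
    (h : majLim (fun ξ => ‖g₀ ξ‖ₑ) t ξ ≠ ⊤) :
    Filter.Tendsto (fun n => picard g₀ n t ξ) Filter.atTop (nhds (picardLim g₀ t ξ)) := by
  refine tendsto_nhds_limUnder (cauchySeq_tendsto_of_complete ?_)
  obtain ⟨M, hM⟩ : ∃ M : ℕ → ℝ, M = fun n => (maj (fun ξ => ‖g₀ ξ‖ₑ) n t ξ).toReal := ⟨_, rfl⟩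
  have hfin : ∀ n, maj (fun ξ => ‖g₀ ξ‖ₑ) n t ξ ≠ ⊤ := fun n =>
    ne_top_of_le_ne_top h (maj_le_majLim _ n t ξ)
  have hMt : CauchySeq M := by
    rw [hM]
    exact ((ENNReal.tendsto_toReal h).comp (tendsto_maj _ t ξ)).cauchySeq
  have hle : ∀ n m, n ≤ m → ‖picard g₀ m t ξ - picard g₀ n t ξ‖ ≤ M m - M n := by
    intro n m hnm
    have h1 := (dom_picard_of_le hg hnm t ξ).2
    have h2 := ENNReal.toReal_mono (hfin m) h1
    rw [ENNReal.toReal_add enorm_ne_top (hfin n), toReal_enorm] at h2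
    rw [hM]; simp only; linarith
  rw [Metric.cauchySeq_iff'] at hMt ⊢
  intro ε hε
  obtain ⟨N, hN⟩ := hMt ε hε
  refine ⟨N, fun n hn => ?_⟩
  rw [dist_eq_norm]
  refine (hle N n hn).trans_lt ((le_abs_self _).trans_lt ?_)
  simpa [Real.dist_eq] using hN n hn

lemma dom_picardLim {g₀ : E d → ℂ} (hg : Measurable g₀) (n : ℕ) (t : ℝ) (ξ : E d) :
    Dom (picard g₀ n t ξ) (picardLim g₀ t ξ) (maj (fun ξ => ‖g₀ ξ‖ₑ) n t ξ)
      (majLim (fun ξ => ‖g₀ ξ‖ₑ) t ξ) := by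
  refine ⟨(dom_picard hg n t ξ).1, ?_⟩
  by_cases h : majLim (fun ξ => ‖g₀ ξ‖ₑ) t ξ = ⊤
  · rw [h]; exact le_top
  · have h1 := tendsto_picard hg h
    have h2 : Filter.Tendsto
        (fun m => ‖picard g₀ m t ξ - picard g₀ n t ξ‖ₑ + maj (fun ξ => ‖g₀ ξ‖ₑ) n t ξ)
        Filter.atTop (nhds (‖picardLim g₀ t ξ - picard g₀ n t ξ‖ₑ +
          maj (fun ξ => ‖g₀ ξ‖ₑ) n t ξ)) :=
      ((continuous_enorm.tendsto _).comp (h1.sub_const _)).add_const _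
    refine le_of_tendsto h2 ?_
    filter_upwards [Filter.eventually_ge_atTop n] with m hm
    exact (dom_picard_of_le hg hm t ξ).2.trans (maj_le_majLim _ m t ξ)

/-- The limit of the majorants solves the majorant equation. -/
lemma majLim_eq {G : E d → ℝ≥0∞} (hG : Measurable G) (t : ℝ) (ξ : E d) :
    majLim G t ξ = duhE G (fun τ => expTail (wt 2 (majLim G τ))) t ξ := by
  have h0 : majLim G t ξ = ⨆ n, maj G (n + 1) t ξ :=
    (Monotone.iSup_nat_add (fun _ _ h => maj_mono G t h ξ) 1).symm
  rw [h0]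
  simp only [maj]
  unfold duhE
  rw [← ENNReal.add_iSup, ← lintegral_iSup]
  · congr 1
    refine lintegral_congr fun τ => ?_
    rw [← ENNReal.mul_iSup]
    congr 1
    beta_reduce
    have e : wt 2 (majLim G τ) = fun ξ => ⨆ n, wt 2 (maj G n τ) ξ := by
      ext ξ; unfold wt majLim; rw [ENNReal.mul_iSup]
    rw [e, expTail_iSup (fun n => measurable_wt 2 (measurable_slice (measurable_maj hG n) τ))
      (fun a b hab => wt_mono 2 (maj_mono G τ hab))]
    unfold wt; rw [ENNReal.mul_iSup]
  · intro n
    have hh : Measurable fun τ : ℝ => heat (t - τ) ξ := by unfold heat; fun_prop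
    exact hh.ennreal_ofReal.mul (measurable_wt_param 2
      (measurable_expTail_param (measurable_wt_param 2 (measurable_maj hG n)))).of_uncurry_right
  · intro a b hab τ
    exact mul_le_mul' le_rfl (wt_mono 2 (expTail_mono (wt_mono 2 (maj_mono G τ hab))) ξ)

lemma Herm.duhC {g₀ : E d → ℂ} (hg : Herm g₀) {N : ℝ → E d → ℂ} (hN : ∀ τ, Herm (N τ)) (t : ℝ) :
    Herm (duhC g₀ N t) := fun ξ => by
  unfold ExpPDE.duhC ExpPDE.cwt heat symb
  simp only [norm_neg, hg ξ, (hN _) ξ, star_sub, star_mul', RCLike.star_def, Complex.conj_ofReal,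
    ← integral_conj, map_mul]

lemma Herm.cwt {f : E d → ℂ} (hf : Herm f) : Herm (cwt f) := fun ξ => by
  simp [ExpPDE.cwt, hf ξ]

lemma herm_picard {g₀ : E d → ℂ} (hg : Herm g₀) (n : ℕ) (t : ℝ) : Herm (picard g₀ n t) := by
  induction n generalizing t with
  | zero => exact fun ξ => by simp [picard]
  | succ n ih => exact hg.duhC (fun τ => (ih τ).cwt.cexpTail) t

/-- Existence for the Fourier side of the equation, with Duhamel's formula valid everywhere. -/
lemma exists_mild (hd : 1 ≤ d) {g₀ : E d → ℂ} (hg : Measurable g₀)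
    (h1 : ∫⁻ ξ, wt 2 (fun ξ => ‖g₀ ξ‖ₑ) ξ ≠ ⊤) (h2 : f2e (∫⁻ ξ, wt 2 (fun ξ => ‖g₀ ξ‖ₑ) ξ) < 1)
    (hH : Herm g₀) :
    ∃ g : ℝ → E d → ℂ, Measurable (Function.uncurry g) ∧
      (∀ t ξ, ‖g t ξ‖ₑ ≤ majLim (fun ξ => ‖g₀ ξ‖ₑ) t ξ) ∧
      (∀ t ξ, g t ξ = duhC g₀ (fun τ => cexpTail (cwt (g τ))) t ξ) ∧
      ∀ t, 0 ≤ t → ∃ g' : E d → ℂ, Herm g' ∧ g t =ᵐ[volume] g' := by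
  obtain ⟨m, hm⟩ : ∃ m, m = majLim (fun ξ => ‖g₀ ξ‖ₑ) := ⟨_, rfl⟩
  have hp := measurable_picardLim hg
  have hmm : Measurable (Function.uncurry m) := hm ▸ measurable_majLim hg.enorm
  -- redefining the limit through Duhamel's formula changes it on a null set of frequencies only
  have heq : ∀ t ξ, m t ξ ≠ ⊤ →
      duhC g₀ (fun τ => cexpTail (cwt (picardLim g₀ τ))) t ξ = picardLim g₀ t ξ := by
    intro t ξ hfin
    rw [hm] at hfin
    have hD := fun n => (dom_duhC_cexpTail (g₀ := g₀) (measurable_picard hg n) hp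
      (measurable_maj hg.enorm n) (dom_picardLim hg n) t ξ).2
    simp only [← majLim_eq hg.enorm] at hD
    have ht1 := (tendsto_picard hg hfin).comp (Filter.tendsto_add_atTop_nat 1)
    have ht2 := (tendsto_maj (fun ξ => ‖g₀ ξ‖ₑ) t ξ).comp (Filter.tendsto_add_atTop_nat 1)
    have ht3 := ((continuous_enorm.tendsto _).comp (ht1.const_sub
      (duhC g₀ (fun τ => cexpTail (cwt (picardLim g₀ τ))) t ξ))).add ht2
    have := le_of_tendsto ht3 (Filter.Eventually.of_forall hD)
    have h0 : ‖duhC g₀ (fun τ => cexpTail (cwt (picardLim g₀ τ))) t ξ - picardLim g₀ t ξ‖ₑ = 0 := by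
      have h5 : ‖duhC g₀ (fun τ => cexpTail (cwt (picardLim g₀ τ))) t ξ - picardLim g₀ t ξ‖ₑ +
        majLim (fun ξ => ‖g₀ ξ‖ₑ) t ξ ≤ 0 + majLim (fun ξ => ‖g₀ ξ‖ₑ) t ξ := by rwa [zero_add]
      exact le_antisymm ((ENNReal.add_le_add_iff_right hfin).1 h5) zero_le
    exact sub_eq_zero.1 (enorm_eq_zero.1 h0)
  have hae : ∀ t, 0 ≤ t → ∀ᵐ ξ, m t ξ ≠ ⊤ := fun t ht => by
    have h3 := (le_self_add.trans (lintegral_wt_two_majLim_le hd hg.enorm h1 le_rfl h2 ht))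
    rw [← hm] at h3
    filter_upwards [ae_lt_top (measurable_wt 2 (measurable_slice hmm t))
      (ne_top_of_le_ne_top h1 h3), ae_rho_ne_zero hd] with ξ h4 h5 h6
    rw [wt, h6, ENNReal.mul_top] at h4
    · exact lt_irrefl _ h4
    · simp [h5]
  have hae2 : ∀ t, 0 ≤ t →
      duhC g₀ (fun τ => cexpTail (cwt (picardLim g₀ τ))) t =ᵐ[volume] picardLim g₀ t := fun t ht => by
    filter_upwards [hae t ht] with ξ hξ using heq t ξ hξ
  refine ⟨duhC g₀ fun τ => cexpTail (cwt (picardLim g₀ τ)),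
    measurable_duhC hg (measurable_cexpTail_param (measurable_cwt_param hp)), fun t ξ => ?_,
    fun t ξ => ?_, fun t ht => ?_⟩
  · rw [majLim_eq hg.enorm]
    exact (dom_duhC_cexpTail (measurable_picard hg 0) hp (measurable_maj hg.enorm 0)
      (dom_picardLim hg 0) t ξ).right_le
  · refine congrArg (fun z => (heat t ξ : ℂ) * g₀ ξ - z) (setIntegral_congr_fun measurableSet_Ioc
      fun τ hτ => ?_)
    simp only
    rw [cexpTail_congr (f := cwt (picardLim g₀ τ))]
    filter_upwards [hae2 τ hτ.1.le] with η hη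
    simp only [cwt, hη]
  · -- the symmetry is exact at the frequencies where the iteration converges at `ξ` and at `-ξ`
    classical
    refine ⟨fun ξ => if m t ξ ≠ ⊤ ∧ m t (-ξ) ≠ ⊤ then picardLim g₀ t ξ else 0, fun ξ => ?_, ?_⟩
    · simp only [neg_neg, and_comm (a := m t (-ξ) ≠ ⊤)]
      split_ifs with h
      · rw [hm] at h
        refine tendsto_nhds_unique (tendsto_picard hg h.2) ?_
        simp only [herm_picard hH _ t ξ]
        exact (tendsto_picard hg h.1).star
      · simp
    · have hneg : ∀ᵐ ξ, m t (-ξ) ≠ ⊤ :=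
        (Measure.measurePreserving_neg (volume : Measure (E d))).quasiMeasurePreserving.ae (hae t ht)
      filter_upwards [hae2 t ht, hae t ht, hneg] with ξ e1 e2 e3
      rw [e1, if_pos ⟨e2, e3⟩]

end

section

/-! ### Variation of constants with integrable forcing -/

/-- Integration by parts against the primitive of an integrable function, by exchanging the order of
integration over a triangle. -/
lemma integral_mul_primitive {k K : ℝ → ℂ} (hk : Continuous k) (hK : ∀ x, HasDerivAt K (k x) x)
    {M : ℝ → ℂ} {t : ℝ} (hM : IntegrableOn M (Ioc 0 t)) :
    ∫ r in Ioc 0 t, k r * ∫ τ in Ioc 0 r, M τ = ∫ τ in Ioc 0 t, (K t - K τ) * M τ := by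
  have hki : IntegrableOn k (Ioc 0 t) := (hk.integrableOn_Icc).mono_set Ioc_subset_Icc_self
  obtain ⟨F, hF⟩ : ∃ F : ℝ → ℝ → ℂ, F = fun r τ => if τ ≤ r then k r * M τ else 0 := ⟨_, rfl⟩
  have h1 : ∀ r ∈ Ioc 0 t, k r * ∫ τ in Ioc 0 r, M τ = ∫ τ in Ioc 0 t, F r τ := fun r hr => by
    have e : Ioc 0 r = Ioc 0 t ∩ Iic r := by
      ext x; simp only [mem_Ioc, mem_inter_iff, mem_Iic]
      exact ⟨fun h => ⟨⟨h.1, h.2.trans hr.2⟩, h.2⟩, fun h => ⟨h.1.1, h.2⟩⟩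
    rw [← integral_const_mul, e, ← setIntegral_indicator measurableSet_Iic, hF]
    simp only [indicator, mem_Iic]
  have h2 : ∀ τ ∈ Ioc 0 t, (K t - K τ) * M τ = ∫ r in Ioc 0 t, F r τ := fun τ hτ => by
    have e : Ioc τ t = Ioc 0 t ∩ Ioi τ := by
      ext x; simp only [mem_Ioc, mem_inter_iff, mem_Ioi]
      exact ⟨fun h => ⟨⟨hτ.1.trans h.1, h.2⟩, h.1⟩, fun h => ⟨h.2, h.1.2⟩⟩
    have e2 : ∫ r in Ioc τ t, k r = K t - K τ := by
      rw [← intervalIntegral.integral_of_le hτ.2]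
      exact intervalIntegral.integral_eq_sub_of_hasDerivAt (fun x _ => hK x)
        (hk.intervalIntegrable _ _)
    rw [← e2, ← integral_mul_const, e, ← setIntegral_indicator measurableSet_Ioi]
    refine integral_congr_ae ?_
    have hne : ∀ᵐ r ∂volume.restrict (Ioc 0 t), r ≠ τ :=
      ae_restrict_of_ae (Measure.ae_ne volume τ)
    filter_upwards [hne] with r hr
    have : τ < r ↔ τ ≤ r := ⟨le_of_lt, fun h => lt_of_le_of_ne h hr.symm⟩
    simp only [hF, indicator, mem_Ioi, this]
  rw [setIntegral_congr_fun measurableSet_Ioc h1, setIntegral_congr_fun measurableSet_Ioc h2]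
  refine integral_integral_swap ?_
  have hp : Integrable (fun p : ℝ × ℝ => k p.1 * M p.2)
    ((volume.restrict (Ioc 0 t)).prod (volume.restrict (Ioc 0 t))) := hki.mul_prod hM
  have hs : MeasurableSet {p : ℝ × ℝ | p.2 ≤ p.1} :=
    measurableSet_le measurable_snd measurable_fst
  refine (hp.indicator hs).congr (Filter.Eventually.of_forall fun p => ?_)
  simp only [hF, indicator, mem_ofPred_eq, Function.uncurry]

lemma hasDerivAt_cexp_mul (a x : ℝ) :
    HasDerivAt (fun r : ℝ => Complex.exp (a * r)) (a * Complex.exp (a * x)) x := by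
  have h : HasDerivAt (fun r : ℝ => (a : ℂ) * r) a x := by
    simpa using (Complex.ofRealCLM.hasDerivAt (x := x)).const_mul (a : ℂ)
  simpa [mul_comm] using h.cexp

lemma integrableOn_cexp_mul {a t : ℝ} {N : ℝ → ℂ} (hN : IntegrableOn N (Ioc 0 t)) :
    IntegrableOn (fun τ : ℝ => Complex.exp (a * τ) * N τ) (Ioc 0 t) := by
  have hc : Continuous fun τ : ℝ => Complex.exp (a * τ) := by fun_prop
  rw [← integrableOn_Icc_iff_integrableOn_Ioc] at hN ⊢
  exact hN.continuousOn_mul hc.continuousOn isCompact_Icc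

lemma integral_cexp_mul_sub (a t : ℝ) (N : ℝ → ℂ) :
    ∫ τ in Ioc 0 t, Complex.exp (-(a * (t - τ))) * N τ =
      Complex.exp (-(a * t)) * ∫ τ in Ioc 0 t, Complex.exp (a * τ) * N τ := by
  rw [← integral_const_mul]
  refine integral_congr_ae (Filter.Eventually.of_forall fun τ => ?_)
  simp only
  rw [← mul_assoc, ← Complex.exp_add]
  congr 2; ring

/-- Duhamel's formula gives a continuous solution of the integrated equation. -/
lemma continuousOn_and_integral_eq_of_duhamel {a T : ℝ} {y₀ : ℂ} {y N : ℝ → ℂ}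
    (hN : IntegrableOn N (Ioc 0 T))
    (hy : ∀ t ∈ Icc 0 T, y t = Complex.exp (-(a * t)) * y₀ -
      ∫ τ in Ioc 0 t, Complex.exp (-(a * (t - τ))) * N τ) :
    ContinuousOn y (Icc 0 T) ∧ ∀ t ∈ Icc 0 T, y t = y₀ - ∫ r in Ioc 0 t, (a * y r + N r) := by
  have hM := integrableOn_cexp_mul (a := a) hN
  have hyc : ContinuousOn y (Icc 0 T) := by
    have h1 := intervalIntegral.continuousOn_primitive
      ((integrableOn_Icc_iff_integrableOn_Ioc (μ := volume)).2 hM)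
    have h2 : ContinuousOn (fun t : ℝ => Complex.exp (-(a * t)) * (y₀ -
        ∫ τ in Ioc 0 t, Complex.exp (a * τ) * N τ)) (Icc 0 T) :=
      (by fun_prop : Continuous fun t : ℝ => Complex.exp (-(a * t))).continuousOn.mul
        (continuousOn_const.sub h1)
    refine h2.congr fun t ht => ?_
    rw [hy t ht, integral_cexp_mul_sub]; ring
  refine ⟨hyc, fun t ht => ?_⟩
  have hsub : Icc 0 t ⊆ Icc 0 T := Icc_subset_Icc_right ht.2
  have hsub' : Ioc 0 t ⊆ Ioc 0 T := Ioc_subset_Ioc_right ht.2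
  have hyi : IntegrableOn y (Ioc 0 t) :=
    ((hyc.mono hsub).integrableOn_Icc).mono_set Ioc_subset_Icc_self
  have hMt := hM.mono_set hsub'
  have hNt := hN.mono_set hsub'
  have hk : Continuous fun r : ℝ => (a : ℂ) * Complex.exp (-(a * r)) := by fun_prop
  have hK : ∀ x : ℝ, HasDerivAt (fun r : ℝ => -Complex.exp (-(a * r)))
      ((a : ℂ) * Complex.exp (-(a * x))) x := fun x => by
    have := (hasDerivAt_cexp_mul (-a) x).fun_neg
    simpa using this
  have h3 := integral_mul_primitive hk hK hMt
  have h4 : ∫ r in Ioc 0 t, a * Complex.exp (-(a * r)) = 1 - Complex.exp (-(a * t)) := by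
    rw [← intervalIntegral.integral_of_le ht.1, intervalIntegral.integral_eq_sub_of_hasDerivAt
      (fun x _ => hK x) (hk.intervalIntegrable _ _)]
    simp; ring
  have h5 : ∫ τ in Ioc 0 t, (-Complex.exp (-(a * t)) - -Complex.exp (-(a * τ))) *
      (Complex.exp (a * τ) * N τ) = (∫ τ in Ioc 0 t, N τ) - Complex.exp (-(a * t)) *
        ∫ τ in Ioc 0 t, Complex.exp (a * τ) * N τ := by
    rw [← integral_const_mul, ← integral_sub hNt (hMt.const_mul _)]
    refine integral_congr_ae (Filter.Eventually.of_forall fun τ => ?_)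
    have : Complex.exp (-(a * τ)) * Complex.exp (a * τ) = 1 := by
      rw [← Complex.exp_add]; simp
    simp only
    linear_combination N τ * this
  have h6 : ∫ r in Ioc 0 t, a * y r = (1 - Complex.exp (-(a * t))) * y₀ - ((∫ τ in Ioc 0 t, N τ) -
      Complex.exp (-(a * t)) * ∫ τ in Ioc 0 t, Complex.exp (a * τ) * N τ) := by
    have e : ∀ r ∈ Ioc 0 t, a * y r = a * Complex.exp (-(a * r)) * y₀ -
        a * Complex.exp (-(a * r)) * ∫ τ in Ioc 0 r, Complex.exp (a * τ) * N τ := fun r hr => by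
      rw [hy r (hsub (Ioc_subset_Icc_self hr)), integral_cexp_mul_sub]; ring
    have hi1 : IntegrableOn (fun r : ℝ => a * Complex.exp (-(a * r)) * y₀) (Ioc 0 t) :=
      ((hk.mul continuous_const).integrableOn_Icc).mono_set Ioc_subset_Icc_self
    have hi2 : IntegrableOn (fun r : ℝ => a * Complex.exp (-(a * r)) *
        ∫ τ in Ioc 0 r, Complex.exp (a * τ) * N τ) (Ioc 0 t) :=
      ((hk.continuousOn.mul (intervalIntegral.continuousOn_primitive
        ((integrableOn_Icc_iff_integrableOn_Ioc (μ := volume)).2 hMt))).integrableOn_Icc).mono_set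
          Ioc_subset_Icc_self
    rw [setIntegral_congr_fun measurableSet_Ioc e, integral_sub hi1 hi2, h3, h5, ← h4,
      integral_mul_const]
  rw [integral_add (hyi.const_mul _) hNt, h6, hy t ht, integral_cexp_mul_sub]
  ring

/-- Conversely, an integrable solution of the integrated equation is given by Duhamel's formula. -/
lemma eq_duhamel_of_integral_eq {a T : ℝ} {w N : ℝ → ℂ} (hN : IntegrableOn N (Ioc 0 T))
    (hw : IntegrableOn w (Ioc 0 T)) (h : ∀ t ∈ Icc 0 T, w t = -∫ r in Ioc 0 t, (a * w r + N r))
    {t : ℝ} (ht : t ∈ Icc 0 T) :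
    w t = -∫ τ in Ioc 0 t, Complex.exp (-(a * (t - τ))) * N τ := by
  have hsub' : Ioc 0 t ⊆ Ioc 0 T := Ioc_subset_Ioc_right ht.2
  have hP : IntegrableOn (fun r => a * w r + N r) (Ioc 0 t) :=
    ((hw.mono_set hsub').const_mul (a : ℂ)).add (hN.mono_set hsub')
  have hk : Continuous fun r : ℝ => (a : ℂ) * Complex.exp (a * r) := by fun_prop
  have h1 := integral_mul_primitive hk (hasDerivAt_cexp_mul a) hP
  have e1 : ∀ r ∈ Ioc 0 t, a * Complex.exp (a * r) * ∫ τ in Ioc 0 r, (a * w τ + N τ) =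
      -(a * (Complex.exp (a * r) * w r)) := fun r hr => by
    rw [h r ⟨hr.1.le, hr.2.trans ht.2⟩]; ring
  have hwt := integrableOn_cexp_mul (a := a) (hw.mono_set hsub')
  have hNt := integrableOn_cexp_mul (a := a) (hN.mono_set hsub')
  have hR : IntegrableOn (fun τ : ℝ => a * (Complex.exp (a * τ) * w τ) +
      Complex.exp (a * τ) * N τ) (Ioc 0 t) := (hwt.const_mul _).add hNt
  have e2 : ∫ τ in Ioc 0 t, (Complex.exp (a * t) - Complex.exp (a * τ)) * (a * w τ + N τ) =
      Complex.exp (a * t) * (∫ τ in Ioc 0 t, (a * w τ + N τ)) -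
      (a * (∫ τ in Ioc 0 t, Complex.exp (a * τ) * w τ) +
        ∫ τ in Ioc 0 t, Complex.exp (a * τ) * N τ) := by
    rw [← integral_const_mul, ← integral_const_mul, ← integral_add (hwt.const_mul _) hNt,
      ← integral_sub (hP.const_mul _) hR]
    refine integral_congr_ae (Filter.Eventually.of_forall fun τ => ?_)
    simp only
    ring
  rw [setIntegral_congr_fun measurableSet_Ioc e1, e2, integral_neg, integral_const_mul] at h1
  rw [integral_cexp_mul_sub]
  have hexp : Complex.exp (-(a * t)) * Complex.exp (a * t) = 1 := by
    rw [← Complex.exp_add]; simp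
  rw [h t ht]
  linear_combination (-(∫ r in Ioc 0 t, (a * w r + N r))) * (-hexp) +
    Complex.exp (-(a * t)) * h1

end

section

variable {d : ℕ}

/-! ### Solutions on the Fourier side -/

lemma tsum_inv_factorial_mul_pow_ne_top {y : ℝ≥0∞} (hy : y ≠ ⊤) :
    ∑' n : ℕ, (n.factorial : ℝ≥0∞)⁻¹ * y ^ n ≠ ⊤ := by
  have h : Summable fun n : ℕ => y.toReal ^ n / n.factorial := Real.summable_pow_div_factorial _
  have e : ∑' n : ℕ, (n.factorial : ℝ≥0∞)⁻¹ * y ^ n =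
      ∑' n : ℕ, ENNReal.ofReal (y.toReal ^ n / n.factorial) := by
    refine tsum_congr fun n => ?_
    rw [ENNReal.ofReal_div_of_pos (by positivity), ENNReal.ofReal_pow (by positivity),
      ENNReal.ofReal_toReal hy, ENNReal.ofReal_natCast, ENNReal.div_eq_inv_mul]
  rw [e, ← ENNReal.ofReal_tsum_of_nonneg (fun n => by positivity) h]
  exact ENNReal.ofReal_ne_top

lemma f2e_ne_top {y : ℝ≥0∞} (hy : y ≠ ⊤) : f2e y ≠ ⊤ := by
  have h := tsum_inv_factorial_mul_pow_ne_top (y := 8 * y) (ENNReal.mul_ne_top (by simp) hy)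
  refine ne_top_of_le_ne_top h (le_trans ?_ (ENNReal.tsum_comp_le_tsum_of_injective
    (f := fun n : ℕ => n + 1) (add_left_injective 1) _))
  refine ENNReal.tsum_le_tsum fun n => ?_
  have h1 : ((n : ℝ≥0∞) + 2) ^ 3 ≤ 8 ^ (n + 1) := by
    have h2 : n + 1 < 2 ^ (n + 1) := Nat.lt_two_pow_self
    have h3 : (n + 2) ^ 3 ≤ (2 ^ (n + 1)) ^ 3 := Nat.pow_le_pow_left h2 3
    rw [← pow_mul, mul_comm, pow_mul] at h3
    exact_mod_cast h3
  calc ((n : ℝ≥0∞) + 2) ^ 3 * ((n + 1).factorial : ℝ≥0∞)⁻¹ * y ^ (n + 1)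
      ≤ 8 ^ (n + 1) * ((n + 1).factorial : ℝ≥0∞)⁻¹ * y ^ (n + 1) := by gcongr
    _ = _ := by rw [mul_pow]; ring

lemma exists_lintegral_expTail_le (M : ℝ≥0) : ∃ C : ℝ≥0, ∀ f : E d → ℝ≥0∞, Measurable f →
    ∫⁻ ξ, f ξ ≤ M → ∫⁻ ξ, expTail f ξ ≤ C := by
  have h := tsum_inv_factorial_mul_pow_ne_top (y := M) (by simp)
  refine ⟨(∑' n : ℕ, (n.factorial : ℝ≥0∞)⁻¹ * (M : ℝ≥0∞) ^ n).toNNReal, fun f hf hM => ?_⟩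
  rw [ENNReal.coe_toNNReal h]
  unfold expTail
  rw [lintegral_tsum fun n => ((measurable_convPow hf (n + 1)).const_mul _).aemeasurable]
  refine le_trans ?_ (ENNReal.tsum_comp_le_tsum_of_injective
    (f := fun n : ℕ => n + 2) (add_left_injective 2) _)
  refine ENNReal.tsum_le_tsum fun n => ?_
  rw [lintegral_const_mul _ (measurable_convPow hf _), lintegral_convPow hf]
  gcongr

/-- The integrated equation for the Fourier transform of a solution of `h_t = Δ e^{-Δh}`, together
with the boundedness and integrability required of solutions. -/
structure FourierSol (g₀ : E d → ℂ) (g : ℝ → E d → ℂ) : Prop where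
  meas : Measurable (Function.uncurry g)
  bounded : ∀ T, 0 ≤ T → ∃ M : ℝ≥0, ∀ t ∈ Icc 0 T, ∫⁻ ξ, wt 2 (fun ξ => ‖g t ξ‖ₑ) ξ ≤ M
  integrable : ∀ T, 0 ≤ T → ∫⁻ τ in Ioc 0 T, ∫⁻ ξ, wt 6 (fun ξ => ‖g τ ξ‖ₑ) ξ < ⊤
  eq : ∀ᵐ ξ, ∀ t, 0 ≤ t → g t ξ =
    g₀ ξ - ∫ r in Ioc 0 t, ((symb ξ : ℂ) * g r ξ + cwt (cexpTail (cwt (g r))) ξ)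

lemma enorm_cexpTail_cwt_le {f : E d → ℂ} (hf : Measurable f) (ξ : E d) :
    ‖cexpTail (cwt f) ξ‖ₑ ≤ expTail (wt 2 fun ξ => ‖f ξ‖ₑ) ξ := by
  have := enorm_cexpTail_le (measurable_cwt hf) ξ
  simp only [enorm_cwt] at this
  exact this

lemma measurable_cexpTail_cwt {g : ℝ → E d → ℂ} (hg : Measurable (Function.uncurry g)) :
    Measurable (Function.uncurry fun τ => cexpTail (cwt (g τ))) :=
  measurable_cexpTail_param (measurable_cwt_param hg)

lemma measurable_enorm_param {g : ℝ → E d → ℂ} (hg : Measurable (Function.uncurry g)) :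
    Measurable (Function.uncurry fun τ ξ => ‖g τ ξ‖ₑ) := hg.enorm

/-- A bound in space and time gives integrability in time at almost every frequency. -/
lemma ae_integrableOn_of_lintegral {F : ℝ → E d → ℂ} (hF : Measurable (Function.uncurry F))
    (h : ∀ n : ℕ, ∃ s : ℝ, ∫⁻ τ in Ioc 0 (n : ℝ), ∫⁻ ξ, wt s (fun ξ => ‖F τ ξ‖ₑ) ξ < ⊤)
    (hd : 1 ≤ d) :
    ∀ᵐ ξ, ∀ T, IntegrableOn (fun τ => F τ ξ) (Ioc 0 T) := by
  have h1 : ∀ n : ℕ, ∀ᵐ ξ, IntegrableOn (fun τ => F τ ξ) (Ioc 0 (n : ℝ)) := fun n => by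
    obtain ⟨s, hs⟩ := h n
    have hm : Measurable (Function.uncurry fun (τ : ℝ) (ξ : E d) => wt s (fun ξ => ‖F τ ξ‖ₑ) ξ) :=
      measurable_wt_param s (measurable_enorm_param hF)
    have h3 := lintegral_lintegral_swap (μ := volume.restrict (Ioc 0 (n : ℝ)))
      (ν := (volume : Measure (E d))) hm.aemeasurable
    rw [h3] at hs
    filter_upwards [ae_lt_top (hm.comp measurable_swap).lintegral_prod_right' hs.ne,
      ae_rho_ne_zero hd] with ξ h4 h5
    refine ⟨hF.of_uncurry_right.aestronglyMeasurable, ?_⟩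
    have h6 : rho ξ ^ s ≠ 0 := by simp [h5, rho_ne_top]
    have h7 : rho ξ ^ s ≠ ⊤ := by simp [h5, rho_ne_top]
    simp only [Function.comp, Function.uncurry, Prod.swap, wt] at h4
    rw [lintegral_const_mul' _ _ h7] at h4
    rw [HasFiniteIntegral]
    by_contra h8
    rw [not_lt_top_iff.1 h8, ENNReal.mul_top h6] at h4
    exact lt_irrefl _ h4
  filter_upwards [ae_all_iff.2 h1] with ξ hξ T
  obtain ⟨n, hn⟩ := exists_nat_ge T
  exact (hξ n).mono_set (Ioc_subset_Ioc_right hn)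

lemma wt_zero (f : E d → ℝ≥0∞) : wt 0 f = f := by ext ξ; simp [wt]

/-- The finiteness conditions of a Fourier-side solution, without the equation. -/
lemma ae_integrableOn_of_bounds (hd : 1 ≤ d) {g : ℝ → E d → ℂ}
    (hg : Measurable (Function.uncurry g))
    (hb : ∀ T, 0 ≤ T → ∃ M : ℝ≥0, ∀ t ∈ Icc 0 T, ∫⁻ ξ, wt 2 (fun ξ => ‖g t ξ‖ₑ) ξ ≤ M) :
    (∀ᵐ ξ, ∀ T, IntegrableOn (fun τ => g τ ξ) (Ioc 0 T)) ∧
      ∀ᵐ ξ, ∀ T, IntegrableOn (fun τ => cwt (cexpTail (cwt (g τ))) ξ) (Ioc 0 T) := by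
  constructor
  · refine ae_integrableOn_of_lintegral hg (fun n => ⟨2, ?_⟩) hd
    obtain ⟨M, hM⟩ := hb n n.cast_nonneg
    calc ∫⁻ τ in Ioc 0 (n : ℝ), ∫⁻ ξ, wt 2 (fun ξ => ‖g τ ξ‖ₑ) ξ
        ≤ ∫⁻ τ in Ioc 0 (n : ℝ), (M : ℝ≥0∞) :=
          setLIntegral_mono measurable_const fun τ hτ => hM τ (Ioc_subset_Icc_self hτ)
      _ < ⊤ := by simp [ENNReal.mul_lt_top]
  · refine (ae_integrableOn_of_lintegral (measurable_cexpTail_cwt hg)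
      (fun n => ⟨0, ?_⟩) hd).mono fun ξ hξ T => ?_
    · obtain ⟨M, hM⟩ := hb n n.cast_nonneg
      obtain ⟨C, hC⟩ := exists_lintegral_expTail_le (d := d) M
      calc ∫⁻ τ in Ioc 0 (n : ℝ), ∫⁻ ξ, wt 0 (fun ξ => ‖cexpTail (cwt (g τ)) ξ‖ₑ) ξ
          ≤ ∫⁻ τ in Ioc 0 (n : ℝ), (C : ℝ≥0∞) := by
            refine setLIntegral_mono measurable_const fun τ hτ => ?_
            rw [wt_zero]
            refine (lintegral_mono fun ξ => enorm_cexpTail_cwt_le (measurable_cslice hg τ) ξ).trans ?_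
            exact hC _ (measurable_wt 2 (measurable_cslice hg τ).enorm)
              (hM τ (Ioc_subset_Icc_self hτ))
        _ < ⊤ := by simp [ENNReal.mul_lt_top]
    · exact (hξ T).const_mul (((2 * Real.pi * ‖ξ‖) ^ 2 : ℝ) : ℂ)

lemma duhC_eq (g₀ : E d → ℂ) (N : ℝ → E d → ℂ) (t : ℝ) (ξ : E d) :
    duhC g₀ N t ξ = Complex.exp (-((symb ξ : ℂ) * t)) * g₀ ξ -
      ∫ τ in Ioc 0 t, Complex.exp (-((symb ξ : ℂ) * (t - τ))) * cwt (N τ) ξ := by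
  unfold duhC heat
  push_cast
  rfl

/-- The solution obtained from the Picard iteration solves the integrated equation and is continuous
in time at almost every frequency. -/
lemma fourierSol_of_mild (hd : 1 ≤ d) {g₀ : E d → ℂ} (hg : Measurable g₀)
    (h1 : ∫⁻ ξ, wt 2 (fun ξ => ‖g₀ ξ‖ₑ) ξ ≠ ⊤) (h2 : f2e (∫⁻ ξ, wt 2 (fun ξ => ‖g₀ ξ‖ₑ) ξ) < 1)
    {g : ℝ → E d → ℂ} (hm : Measurable (Function.uncurry g))
    (hle : ∀ t ξ, ‖g t ξ‖ₑ ≤ majLim (fun ξ => ‖g₀ ξ‖ₑ) t ξ)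
    (heq : ∀ t ξ, g t ξ = duhC g₀ (fun τ => cexpTail (cwt (g τ))) t ξ) :
    FourierSol g₀ g ∧ ∀ᵐ ξ, ContinuousOn (fun t => g t ξ) (Ici 0) := by
  have hc := fun (t : ℝ) (ht : 0 ≤ t) => lintegral_wt_two_majLim_le hd hg.enorm h1 le_rfl h2 ht
  have hb : ∀ T, 0 ≤ T → ∃ M : ℝ≥0, ∀ t ∈ Icc 0 T, ∫⁻ ξ, wt 2 (fun ξ => ‖g t ξ‖ₑ) ξ ≤ M :=
    fun T hT => ⟨(∫⁻ ξ, wt 2 (fun ξ => ‖g₀ ξ‖ₑ) ξ).toNNReal, fun t ht => by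
      rw [ENNReal.coe_toNNReal h1]
      exact (lintegral_mono (wt_mono 2 (hle t))).trans (le_self_add.trans (hc t ht.1))⟩
  obtain ⟨-, hi⟩ := ae_integrableOn_of_bounds hd hm hb
  have key : ∀ᵐ ξ, ∀ T, ContinuousOn (fun t => g t ξ) (Icc 0 T) ∧ ∀ t ∈ Icc 0 T, g t ξ =
      g₀ ξ - ∫ r in Ioc 0 t, ((symb ξ : ℂ) * g r ξ + cwt (cexpTail (cwt (g r))) ξ) := by
    filter_upwards [hi] with ξ hξ T
    exact continuousOn_and_integral_eq_of_duhamel (hξ T) fun t _ => by rw [heq t ξ, duhC_eq]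
  refine ⟨⟨hm, hb, fun T hT => ?_, ?_⟩, ?_⟩
  · have h3 : (1 - f2e (∫⁻ ξ, wt 2 (fun ξ => ‖g₀ ξ‖ₑ) ξ)) ≠ 0 := (tsub_pos_of_lt h2).ne'
    have h4 := (le_add_self.trans (hc T hT)).trans_lt (lt_top_iff_ne_top.2 h1)
    refine (lintegral_mono fun τ => lintegral_mono (wt_mono 6 (hle τ))).trans_lt ?_
    by_contra h5
    rw [not_lt_top_iff.1 h5, ENNReal.mul_top h3] at h4
    exact lt_irrefl _ h4
  · filter_upwards [key] with ξ hξ t ht using (hξ t).2 t ⟨ht, le_rfl⟩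
  · filter_upwards [key] with ξ hξ t ht
    have h3 := (hξ (t + 1)).1 t ⟨ht, by linarith⟩
    refine h3.mono_of_mem_nhdsWithin ?_
    rw [mem_nhdsWithin]
    exact ⟨Iio (t + 1), isOpen_Iio, by simp, fun x hx => ⟨hx.2, hx.1.le⟩⟩

/-- A square integrable bound of the majorant, uniform on bounded time intervals. -/
lemma exists_sq_majLim_le (hd : 1 ≤ d) {G : E d → ℝ≥0∞} (hG : Measurable G)
    (h1 : ∫⁻ ξ, wt 2 G ξ ≤ 1 / 16) (h2 : f2e (∫⁻ ξ, wt 2 G ξ) ≤ 1 / 2)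
    (hG2 : ∫⁻ ξ, G ξ ^ (2 : ℝ) ≠ ⊤) {T : ℝ} (hT : 0 ≤ T) :
    ∃ D : E d → ℝ≥0∞, Measurable D ∧ ∫⁻ ξ, D ξ ≠ ⊤ ∧
      ∀ᵐ ξ, ∀ t ∈ Icc 0 T, majLim G t ξ ^ (2 : ℝ) ≤ D ξ := by
  obtain ⟨C, hC⟩ := exists_energy_majLim_le hd (s := 0) (p := 2) (by norm_num) le_rfl (by norm_num)
  obtain ⟨L, hL⟩ := exists_lintegral_wt_expTail_rpow_le hd (s := 0) (p := 2) (by norm_num) le_rfl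
    (by norm_num)
  have hm := measurable_majLim hG
  have hN := measurable_expTail_param (measurable_wt_param 2 hm)
  have h1t : ∫⁻ ξ, wt 2 G ξ ≠ ⊤ := ne_top_of_le_ne_top (by simp) h1
  have hhalf : (1 / 2 : ℝ≥0∞) < 1 := by simp
  have hc := fun (t : ℝ) (ht : 0 ≤ t) => lintegral_wt_two_majLim_le hd hG h1t h2 hhalf ht
  have e0 : ∀ f : E d → ℝ≥0∞, wt (0 - 2 + 4 / 2) f = f := fun f => by
    rw [show (0 - 2 + 4 / 2 : ℝ) = 0 by norm_num, wt_zero]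
  have hNi : ∫⁻ τ in Ioc 0 T, ∫⁻ ξ, expTail (wt 2 (majLim G τ)) ξ ^ (2 : ℝ) ≠ ⊤ := by
    obtain ⟨K, hK⟩ : ∃ K : ℝ≥0∞, K = C * ∫⁻ ξ, G ξ ^ (2 : ℝ) := ⟨_, rfl⟩
    have hKt : K ≠ ⊤ := hK ▸ ENNReal.mul_ne_top (by simp) hG2
    have hE : ∀ t, 0 ≤ t → energy 0 2 (majLim G) t ≤ K := fun t ht => by
      have := hC G hG h1 h2 t ht
      rwa [wt_zero, ← hK] at this
    have h3 : ∀ τ ∈ Ioc 0 T, ∫⁻ ξ, expTail (wt 2 (majLim G τ)) ξ ^ (2 : ℝ) ≤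
        2 * ((∫⁻ ξ, wt (0 + 4 / 2) (majLim G τ) ξ ^ (2 : ℝ)) +
          L * (K * ∫⁻ ξ, wt 6 (majLim G τ) ξ)) := fun τ hτ => by
      have h4 := hL (majLim G τ) (measurable_slice hm τ)
        ((le_self_add.trans (hc τ hτ.1.le)).trans h1)
      rw [e0] at h4
      refine h4.trans ?_
      gcongr
      · exact mul_le_of_le_one_left' (by rw [one_div]; exact ENNReal.inv_le_one.2 (by norm_num))
      · exact le_self_add.trans (hE τ hτ.1.le)
    refine ne_top_of_le_ne_top ?_ (setLIntegral_mono' measurableSet_Ioc h3)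
    have hm6 : Measurable fun τ => ∫⁻ ξ, wt 6 (majLim G τ) ξ :=
      (measurable_wt_param 6 hm).lintegral_prod_right'
    rw [lintegral_const_mul' _ _ (by simp), lintegral_add_right _ ((hm6.const_mul _).const_mul _),
      lintegral_const_mul' _ _ (by simp), lintegral_const_mul' _ _ hKt]
    have h5 : ∫⁻ τ in Ioc 0 T, ∫⁻ ξ, wt 6 (majLim G τ) ξ ≠ ⊤ := by
      have h6 := (le_add_self.trans (hc T hT)).trans_lt (lt_top_iff_ne_top.2 h1t)
      intro h7
      rw [h7, ENNReal.mul_top (tsub_pos_of_lt hhalf).ne'] at h6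
      exact lt_irrefl _ h6
    refine ENNReal.mul_ne_top (by simp) (ENNReal.add_ne_top.2 ⟨?_, ?_⟩)
    · exact ne_top_of_le_ne_top hKt (le_add_self.trans (hE T hT))
    · exact ENNReal.mul_ne_top (by simp) (ENNReal.mul_ne_top hKt h5)
  have hN2 : Measurable (Function.uncurry fun (τ : ℝ) (ξ : E d) =>
      expTail (wt 2 (majLim G τ)) ξ ^ (2 : ℝ)) := hN.pow_const _
  have hmeas : Measurable fun ξ => ∫⁻ τ in Ioc 0 T, expTail (wt 2 (majLim G τ)) ξ ^ (2 : ℝ) :=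
    (hN2.comp measurable_swap).lintegral_prod_right'
  refine ⟨fun ξ => 2 * (G ξ ^ (2 : ℝ) +
    ∫⁻ τ in Ioc 0 T, expTail (wt 2 (majLim G τ)) ξ ^ (2 : ℝ)),
    ((hG.pow_const _).add hmeas).const_mul _, ?_, ?_⟩
  · rw [lintegral_const_mul' _ _ (by simp), lintegral_add_right _ hmeas,
      ← lintegral_lintegral_swap (μ := volume.restrict (Ioc 0 T))
        (ν := (volume : Measure (E d))) hN2.aemeasurable]
    exact ENNReal.mul_ne_top (by simp) (ENNReal.add_ne_top.2 ⟨hG2, hNi⟩)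
  · filter_upwards [ae_rho_ne_zero hd] with ξ hξ t ht
    have h3 := wt_duhE_rpow_le (s := 0) (p := 2) (by norm_num) (G := G) hN ht.1 hξ
    simp only [e0, wt_zero, ← majLim_eq hG t ξ] at h3
    refine (le_self_add.trans h3).trans ?_
    rw [show (2 : ℝ) - 1 = 1 by norm_num, ENNReal.rpow_one]
    gcongr
    exact ht.2

/-- Continuity in `L²` of the solution obtained from the Picard iteration. -/
lemma tendsto_lintegral_sub_sq (hd : 1 ≤ d) {G : E d → ℝ≥0∞} (hG : Measurable G)
    (h1 : ∫⁻ ξ, wt 2 G ξ ≤ 1 / 16) (h2 : f2e (∫⁻ ξ, wt 2 G ξ) ≤ 1 / 2)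
    (hG2 : ∫⁻ ξ, G ξ ^ (2 : ℝ) ≠ ⊤) {g : ℝ → E d → ℂ} (hm : Measurable (Function.uncurry g))
    (hle : ∀ t ξ, ‖g t ξ‖ₑ ≤ majLim G t ξ)
    (hc : ∀ᵐ ξ, ContinuousOn (fun t => g t ξ) (Ici 0)) {t₀ : ℝ} (ht₀ : 0 ≤ t₀) :
    Filter.Tendsto (fun t => ∫⁻ ξ, ‖g t ξ - g t₀ ξ‖ₑ ^ (2 : ℝ)) (nhdsWithin t₀ (Ici 0)) (nhds 0) := by
  obtain ⟨D, hD, hDi, hDle⟩ := exists_sq_majLim_le hd hG h1 h2 hG2 (T := t₀ + 1) (by linarith)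
  have h := tendsto_lintegral_filter_of_dominated_convergence (μ := (volume : Measure (E d)))
    (l := nhdsWithin t₀ (Ici 0)) (F := fun t ξ => ‖g t ξ - g t₀ ξ‖ₑ ^ (2 : ℝ)) (f := fun _ => 0)
    (fun ξ => 4 * D ξ)
    (Filter.Eventually.of_forall fun t =>
      ((measurable_cslice hm t).sub (measurable_cslice hm t₀)).enorm.pow_const _) ?_
    (by rw [lintegral_const_mul' _ _ (by simp)]; exact ENNReal.mul_ne_top (by simp) hDi) ?_
  · simpa using h
  · have : ∀ᶠ t in nhdsWithin t₀ (Ici 0), t ∈ Icc 0 (t₀ + 1) := by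
      filter_upwards [self_mem_nhdsWithin,
        mem_nhdsWithin_of_mem_nhds (Iio_mem_nhds (lt_add_one t₀))] with t h3 h4 using ⟨h3, h4.le⟩
    filter_upwards [this] with t ht
    filter_upwards [hDle] with ξ hξ
    have h3 : ∀ r ∈ Icc 0 (t₀ + 1), ‖g r ξ‖ₑ ^ (2 : ℝ) ≤ D ξ := fun r hr =>
      (ENNReal.rpow_le_rpow (hle r ξ) (by norm_num)).trans (hξ r hr)
    have h4 : ‖g t ξ - g t₀ ξ‖ₑ ≤ ‖g t ξ‖ₑ + ‖g t₀ ξ‖ₑ := enorm_sub_le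
    have h5 := ENNReal.rpow_add_le_mul_rpow_add_rpow ‖g t ξ‖ₑ ‖g t₀ ξ‖ₑ (p := 2) (by norm_num)
    rw [show (2 : ℝ) - 1 = 1 by norm_num, ENNReal.rpow_one] at h5
    calc ‖g t ξ - g t₀ ξ‖ₑ ^ (2 : ℝ) ≤ (‖g t ξ‖ₑ + ‖g t₀ ξ‖ₑ) ^ (2 : ℝ) :=
          ENNReal.rpow_le_rpow h4 (by norm_num)
      _ ≤ 2 * (‖g t ξ‖ₑ ^ (2 : ℝ) + ‖g t₀ ξ‖ₑ ^ (2 : ℝ)) := h5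
      _ ≤ 2 * (D ξ + D ξ) := by
          gcongr
          · exact h3 t ht
          · exact h3 t₀ ⟨ht₀, by linarith⟩
      _ = 4 * D ξ := by ring
  · filter_upwards [hc] with ξ hξ
    have h3 : Filter.Tendsto (fun t => ‖g t ξ - g t₀ ξ‖ₑ ^ (2 : ℝ)) (nhdsWithin t₀ (Ici 0))
        (nhds (‖g t₀ ξ - g t₀ ξ‖ₑ ^ (2 : ℝ))) :=
      (ENNReal.continuous_rpow_const.tendsto _).comp ((continuous_enorm.tendsto _).comp
        ((hξ t₀ ht₀).tendsto.sub_const _))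
    simpa using h3

end

section

variable {d : ℕ}

/-! ### Uniqueness on the Fourier side -/

lemma cwt_sub (f g : E d → ℂ) (ξ : E d) : cwt f ξ - cwt g ξ = cwt (fun x => f x - g x) ξ := by
  unfold cwt; ring

/-- The nonlinearity is a contraction of factor `1/2` in the critical norm, near small functions. -/
lemma lintegral_cexpTail_sub_le {f f' : E d → ℂ} (hf : Measurable f) (hf' : Measurable f')
    (h : ∫⁻ ξ, wt 2 (fun ξ => ‖f ξ‖ₑ) ξ ≤ 1 / 16)
    (hv : ∫⁻ ξ, wt 2 (fun ξ => ‖f' ξ - f ξ‖ₑ) ξ ≤ 1 / 4) :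
    ∫⁻ ξ, ‖cexpTail (cwt f') ξ - cexpTail (cwt f) ξ‖ₑ ≤
      1 / 2 * ∫⁻ ξ, wt 2 (fun ξ => ‖f' ξ - f ξ‖ₑ) ξ := by
  obtain ⟨B, hB⟩ : ∃ B : E d → ℝ≥0∞, B = wt 2 fun ξ => ‖f ξ‖ₑ := ⟨_, rfl⟩
  obtain ⟨W, hW⟩ : ∃ W : E d → ℝ≥0∞, W = wt 2 fun ξ => ‖f' ξ - f ξ‖ₑ := ⟨_, rfl⟩
  have hBm : Measurable B := hB ▸ measurable_wt 2 hf.enorm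
  have hWm : Measurable W := hW ▸ measurable_wt 2 (hf'.sub hf).enorm
  rw [← hB] at h
  rw [← hW] at hv ⊢
  have hD : ∀ ξ, Dom (cwt f ξ) (cwt f' ξ) (B ξ) (B ξ + W ξ) := fun ξ => by
    refine ⟨by rw [enorm_cwt, hB], ?_⟩
    rw [cwt_sub, enorm_cwt, ← hW, add_comm]
  have h1 : ∀ ξ, ‖cexpTail (cwt f') ξ - cexpTail (cwt f) ξ‖ₑ + expTail B ξ ≤
      expTail (fun ξ => B ξ + W ξ) ξ := fun ξ =>
    (dom_cexpTail (measurable_cwt hf) (measurable_cwt hf') hBm hD ξ).2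
  have h2 := lintegral_mono (μ := (volume : Measure (E d))) h1
  rw [lintegral_add_right _ (measurable_expTail hBm)] at h2
  have hsum : ∫⁻ ξ, (B ξ + W ξ) = (∫⁻ ξ, B ξ) + ∫⁻ ξ, W ξ := lintegral_add_right _ hWm
  have h3 : ∫⁻ ξ, (B ξ + W ξ) ≤ 1 / 3 := by
    rw [hsum]
    refine (add_le_add h hv).trans ?_
    rw [← ENNReal.toReal_le_toReal (by simp) (by simp), ENNReal.toReal_add (by simp) (by simp)]
    norm_num
  have h4 := lintegral_expTail_le_add (hBm.add hWm) hBm hsum h3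
  obtain ⟨C, hC⟩ := exists_lintegral_expTail_le (d := d) 1
  have h5 : ∫⁻ ξ, expTail B ξ ≠ ⊤ := ne_top_of_le_ne_top (by simp)
    (hC B hBm (h.trans (by rw [one_div]; exact ENNReal.inv_le_one.2 (by norm_num))))
  have h6 := h2.trans h4
  rw [add_comm] at h6
  exact (ENNReal.add_le_add_iff_left h5).1 h6

/-- While two solutions stay close they coincide: their difference, integrated in time, is at most
half of itself. -/
lemma FourierSol.ae_eq_of_close (hd : 1 ≤ d) {g₀ : E d → ℂ} {g g' : ℝ → E d → ℂ}
    (hg : FourierSol g₀ g) (hg' : FourierSol g₀ g')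
    (hs : ∀ t, 0 ≤ t → ∫⁻ ξ, wt 2 (fun ξ => ‖g t ξ‖ₑ) ξ ≤ 1 / 16) {T : ℝ} (hT : 0 ≤ T)
    (hv : ∀ t ∈ Ioc 0 T, ∫⁻ ξ, wt 2 (fun ξ => ‖g' t ξ - g t ξ‖ₑ) ξ ≤ 1 / 4) :
    ∀ t ∈ Icc 0 T, g' t =ᵐ[volume] g t := by
  obtain ⟨i1, i2⟩ := ae_integrableOn_of_bounds hd hg.meas hg.bounded
  obtain ⟨j1, j2⟩ := ae_integrableOn_of_bounds hd hg'.meas hg'.bounded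
  obtain ⟨N, hN⟩ : ∃ N : ℝ → E d → ℂ, N = fun τ ξ =>
    cwt (cexpTail (cwt (g' τ))) ξ - cwt (cexpTail (cwt (g τ))) ξ := ⟨_, rfl⟩
  have hDm : Measurable (Function.uncurry fun (τ : ℝ) (ξ : E d) =>
      ‖cexpTail (cwt (g' τ)) ξ - cexpTail (cwt (g τ)) ξ‖ₑ) :=
    ((measurable_cexpTail_cwt hg'.meas).sub (measurable_cexpTail_cwt hg.meas)).enorm
  have hwm : Measurable (Function.uncurry fun (τ : ℝ) (ξ : E d) => ‖g' τ ξ - g τ ξ‖ₑ) :=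
    (hg'.meas.sub hg.meas).enorm
  have hNm : Measurable (Function.uncurry N) := by
    rw [hN]
    exact (measurable_cwt_param (measurable_cexpTail_cwt hg'.meas)).sub
      (measurable_cwt_param (measurable_cexpTail_cwt hg.meas))
  have hNe : ∀ τ ξ, ‖N τ ξ‖ₑ = rho ξ ^ (2 : ℝ) *
      ‖cexpTail (cwt (g' τ)) ξ - cexpTail (cwt (g τ)) ξ‖ₑ := fun τ ξ => by
    rw [hN]; simp only; rw [cwt_sub, enorm_cwt]; rfl
  have heq : ∀ᵐ ξ, ∀ t, 0 ≤ t → g' t ξ - g t ξ =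
      -∫ r in Ioc 0 t, ((symb ξ : ℂ) * (g' r ξ - g r ξ) + N r ξ) := by
    filter_upwards [hg.eq, hg'.eq, i1, i2, j1, j2] with ξ e e' a1 a2 b1 b2 t ht
    have s1 : IntegrableOn (fun r => (symb ξ : ℂ) * g r ξ + cwt (cexpTail (cwt (g r))) ξ)
      (Ioc 0 t) := ((a1 t).const_mul _).add (a2 t)
    have s2 : IntegrableOn (fun r => (symb ξ : ℂ) * g' r ξ + cwt (cexpTail (cwt (g' r))) ξ)
      (Ioc 0 t) := ((b1 t).const_mul _).add (b2 t)
    rw [e t ht, e' t ht, sub_sub_sub_cancel_left, ← integral_sub s1 s2, ← integral_neg]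
    refine integral_congr_ae (Filter.Eventually.of_forall fun r => ?_)
    simp only [hN]; ring
  -- the difference is bounded by the difference of the nonlinearities, integrated in time
  have hle : ∀ᵐ ξ, ∫⁻ τ in Ioc 0 T, wt 2 (fun ξ => ‖g' τ ξ - g τ ξ‖ₑ) ξ ≤
      ∫⁻ τ in Ioc 0 T, ‖cexpTail (cwt (g' τ)) ξ - cexpTail (cwt (g τ)) ξ‖ₑ := by
    filter_upwards [heq, i1, i2, j1, j2, ae_rho_ne_zero hd] with ξ e a1 a2 b1 b2 hξ
    have hNi : IntegrableOn (fun τ => N τ ξ) (Ioc 0 T) := by rw [hN]; exact (b2 T).sub (a2 T)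
    have h1 : ∀ t ∈ Ioc 0 T, ‖g' t ξ - g t ξ‖ₑ ≤ ∫⁻ τ in Ioc 0 t,
        ENNReal.ofReal (Real.exp (-(symb ξ * (t - τ)))) * ‖N τ ξ‖ₑ := fun t ht => by
      rw [eq_duhamel_of_integral_eq (w := fun t => g' t ξ - g t ξ) hNi ((b1 T).sub (a1 T))
        (fun t ht => e t ht.1) ⟨ht.1.le, ht.2⟩, enorm_neg]
      refine (enorm_integral_le_lintegral_enorm _).trans_eq (lintegral_congr fun τ => ?_)
      rw [enorm_mul]
      congr 1
      rw [show Real.exp (-(symb ξ * (t - τ))) = heat (t - τ) ξ from rfl, ← enorm_heat, heat]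
      push_cast; rfl
    have h2 := duhamel_rpow_le (symb_pos hξ) (n := fun τ => ‖N τ ξ‖ₑ)
      hNm.of_uncurry_right.enorm (p := 1) le_rfl hT
    simp only [sub_self, ENNReal.rpow_zero, one_mul, ENNReal.rpow_one] at h2
    have h3 := (mul_le_mul' (le_refl (ENNReal.ofReal (symb ξ)))
      (setLIntegral_mono' measurableSet_Ioc h1)).trans (le_add_self.trans h2)
    simp only [hNe] at h3
    have r2 : rho ξ ^ (2 : ℝ) ≠ 0 := by simp [hξ]
    have r2' : rho ξ ^ (2 : ℝ) ≠ ⊤ := by simp [rho_ne_top]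
    have r4 : rho ξ ^ (4 : ℝ) = rho ξ ^ (2 : ℝ) * rho ξ ^ (2 : ℝ) := by
      rw [← ENNReal.rpow_add _ _ hξ (rho_ne_top ξ)]; norm_num
    rw [lintegral_const_mul' _ _ r2', ofReal_symb, r4, mul_assoc,
      ENNReal.mul_le_mul_iff_right r2 r2'] at h3
    unfold wt
    rwa [lintegral_const_mul' _ _ r2']
  obtain ⟨v, hvd⟩ : ∃ v : ℝ → ℝ≥0∞, v = fun τ => ∫⁻ ξ, wt 2 (fun ξ => ‖g' τ ξ - g τ ξ‖ₑ) ξ :=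
    ⟨_, rfl⟩
  have hvm : Measurable v := by
    rw [hvd]; exact (measurable_wt_param 2 hwm).lintegral_prod_right'
  -- the contraction property of the nonlinearity, integrated in time
  have hV : ∫⁻ τ in Ioc 0 T, v τ ≤ 1 / 2 * ∫⁻ τ in Ioc 0 T, v τ := by
    have h1 := lintegral_mono_ae hle
    rw [← lintegral_lintegral_swap (μ := volume.restrict (Ioc 0 T)) (ν := (volume : Measure (E d)))
      (measurable_wt_param 2 hwm).aemeasurable,
      ← lintegral_lintegral_swap (μ := volume.restrict (Ioc 0 T)) (ν := (volume : Measure (E d)))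
      hDm.aemeasurable] at h1
    rw [← lintegral_const_mul' _ _ (by simp)]
    simp only [hvd]
    refine h1.trans (setLIntegral_mono' measurableSet_Ioc fun τ hτ => ?_)
    exact lintegral_cexpTail_sub_le (measurable_cslice hg.meas τ) (measurable_cslice hg'.meas τ)
      (hs τ hτ.1.le) (hv τ hτ)
  have hVfin : ∫⁻ τ in Ioc 0 T, v τ ≠ ⊤ := by
    have h1 : ∫⁻ τ in Ioc 0 T, v τ ≤ ∫⁻ τ in Ioc 0 T, (1 / 4 : ℝ≥0∞) :=
      setLIntegral_mono' measurableSet_Ioc fun τ hτ => by rw [hvd]; exact hv τ hτ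
    refine ne_top_of_le_ne_top ?_ h1
    simp [ENNReal.mul_eq_top]
  have hV0 : ∫⁻ τ in Ioc 0 T, v τ = 0 := by
    have h1 := ENNReal.toReal_mono (ENNReal.mul_ne_top (by simp) hVfin) hV
    rw [ENNReal.toReal_mul] at h1
    norm_num at h1
    have h2 : (∫⁻ τ in Ioc 0 T, v τ).toReal = 0 :=
      le_antisymm (by linarith) ENNReal.toReal_nonneg
    exact ((ENNReal.toReal_eq_zero_iff _).1 h2).resolve_right hVfin
  have hz : ∀ᵐ τ ∂volume.restrict (Ioc 0 T), g' τ =ᵐ[volume] g τ := by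
    filter_upwards [(lintegral_eq_zero_iff hvm).1 hV0] with τ hτ
    simp only [hvd, Pi.zero_apply] at hτ
    have h1 := (lintegral_eq_zero_iff (measurable_wt 2 (measurable_slice hwm τ))).1 hτ
    filter_upwards [h1, ae_rho_ne_zero hd] with ξ h2 h3
    simp only [wt, Pi.zero_apply, mul_eq_zero, ENNReal.rpow_eq_zero_iff, h3, rho_ne_top,
      false_and, or_self, false_or, enorm_eq_zero] at h2
    exact sub_eq_zero.1 h2
  -- equality at almost every time makes the integrands of the two integrated equations agree, which
  -- gives equality at every time
  have hz2 : ∀ᵐ ξ, ∀ᵐ τ ∂volume.restrict (Ioc 0 T), (symb ξ : ℂ) * (g' τ ξ - g τ ξ) + N τ ξ = 0 := by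
    have hms : MeasurableSet {p : ℝ × E d |
        (symb p.2 : ℂ) * (g' p.1 p.2 - g p.1 p.2) + N p.1 p.2 = 0} := by
      refine measurableSet_eq_fun ?_ measurable_const
      exact ((Complex.measurable_ofReal.comp (measurable_symb.comp measurable_snd)).mul
        (hg'.meas.sub hg.meas)).add hNm
    refine (Measure.ae_ae_comm hms).1 ?_
    filter_upwards [hz] with τ hτ
    have h1 : cexpTail (cwt (g' τ)) = cexpTail (cwt (g τ)) := cexpTail_congr (by
      filter_upwards [hτ] with ξ h2
      simp only [cwt, h2])
    filter_upwards [hτ] with ξ h2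
    simp [hN, h1, h2]
  intro t ht
  filter_upwards [heq, hz2] with ξ e h1
  have h2 := e t ht.1
  rw [integral_eq_zero_of_ae (ae_restrict_of_ae_restrict_of_subset
    (Ioc_subset_Ioc_right ht.2) h1), neg_zero] at h2
  exact sub_eq_zero.1 h2

/-- The critical norm of the difference of two solutions is continuous in time, with a modulus given
by an integrable function. -/
lemma FourierSol.exists_modulus (hd : 1 ≤ d) {g₀ : E d → ℂ} {g g' : ℝ → E d → ℂ}
    (hg : FourierSol g₀ g) (hg' : FourierSol g₀ g') {T : ℝ} (hT : 0 ≤ T) :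
    ∃ κ : ℝ → ℝ≥0∞, ∫⁻ τ in Ioc 0 T, κ τ ≠ ⊤ ∧ ∀ s ∈ Icc 0 T, ∀ t ∈ Icc s T,
      ∫⁻ ξ, wt 2 (fun ξ => ‖g' t ξ - g t ξ‖ₑ) ξ ≤
        (∫⁻ ξ, wt 2 (fun ξ => ‖g' s ξ - g s ξ‖ₑ) ξ) + ∫⁻ τ in Ioc s t, κ τ := by
  -- the time derivative of a solution is integrable in the critical norm
  have hone : ∀ {g : ℝ → E d → ℂ}, FourierSol g₀ g → ∃ κ : ℝ → ℝ≥0∞, Measurable κ ∧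
      ∫⁻ τ in Ioc 0 T, κ τ ≠ ⊤ ∧ ∀ s ∈ Icc 0 T, ∀ t ∈ Icc s T,
        ∫⁻ ξ, wt 2 (fun ξ => ‖g t ξ - g s ξ‖ₑ) ξ ≤ ∫⁻ τ in Ioc s t, κ τ := by
    intro g hg
    obtain ⟨i1, i2⟩ := ae_integrableOn_of_bounds hd hg.meas hg.bounded
    obtain ⟨M, hM⟩ := hg.bounded T hT
    obtain ⟨F, hF⟩ : ∃ F : ℝ → E d → ℝ≥0∞, F = fun τ ξ =>
      ‖(symb ξ : ℂ) * g τ ξ + cwt (cexpTail (cwt (g τ))) ξ‖ₑ := ⟨_, rfl⟩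
    have hFm : Measurable (Function.uncurry F) := by
      rw [hF]
      exact (((Complex.measurable_ofReal.comp (measurable_symb.comp measurable_snd)).mul
        hg.meas).add (measurable_cwt_param (measurable_cexpTail_cwt hg.meas))).enorm
    have hFw := measurable_wt_param 2 hFm
    have hes : ∀ ξ : E d, ‖(symb ξ : ℂ)‖ₑ = rho ξ ^ (4 : ℝ) := fun ξ => by
      rw [← ofReal_symb, ← ofReal_norm, Complex.norm_real, Real.norm_of_nonneg (symb_nonneg ξ)]
    refine ⟨fun τ => ∫⁻ ξ, wt 2 (F τ) ξ, hFw.lintegral_prod_right', ?_, ?_⟩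
    · have h1 : ∀ τ ∈ Ioc 0 T, ∫⁻ ξ, wt 2 (F τ) ξ ≤
          (1 + f2e M) * ∫⁻ ξ, wt 6 (fun ξ => ‖g τ ξ‖ₑ) ξ := fun τ hτ => by
        have hgτ := (measurable_cslice hg.meas τ)
        have h2 : ∀ᵐ ξ, wt 2 (F τ) ξ ≤ wt 6 (fun ξ => ‖g τ ξ‖ₑ) ξ +
            wt 4 (expTail (wt 2 fun ξ => ‖g τ ξ‖ₑ)) ξ := by
          filter_upwards [ae_rho_ne_zero hd] with ξ hξ
          have r4 : rho ξ ^ (4 : ℝ) = rho ξ ^ (2 : ℝ) * rho ξ ^ (2 : ℝ) := by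
            rw [← ENNReal.rpow_add _ _ hξ (rho_ne_top ξ)]; norm_num
          have r6 : rho ξ ^ (6 : ℝ) = rho ξ ^ (2 : ℝ) * rho ξ ^ (4 : ℝ) := by
            rw [← ENNReal.rpow_add _ _ hξ (rho_ne_top ξ)]; norm_num
          have h3 : F τ ξ ≤ rho ξ ^ (4 : ℝ) * ‖g τ ξ‖ₑ +
              rho ξ ^ (2 : ℝ) * expTail (wt 2 fun ξ => ‖g τ ξ‖ₑ) ξ := by
            rw [hF]
            refine (enorm_add_le _ _).trans ?_
            rw [enorm_mul, hes, enorm_cwt, wt]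
            gcongr
            exact enorm_cexpTail_cwt_le hgτ ξ
          calc wt 2 (F τ) ξ ≤ rho ξ ^ (2 : ℝ) * (rho ξ ^ (4 : ℝ) * ‖g τ ξ‖ₑ +
              rho ξ ^ (2 : ℝ) * expTail (wt 2 fun ξ => ‖g τ ξ‖ₑ) ξ) := mul_le_mul' le_rfl h3
            _ = _ := by unfold wt; rw [r6, r4]; ring
        refine (lintegral_mono_ae h2).trans ?_
        rw [lintegral_add_left (measurable_wt 6 hgτ.enorm), add_mul, one_mul]
        gcongr
        have h4 := lintegral_wt_four_expTail_le (measurable_wt 2 hgτ.enorm)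
        refine h4.trans ?_
        have h5 : ∫⁻ ξ, wt 4 (wt 2 fun ξ => ‖g τ ξ‖ₑ) ξ = ∫⁻ ξ, wt 6 (fun ξ => ‖g τ ξ‖ₑ) ξ := by
          refine lintegral_congr_ae ?_
          filter_upwards [ae_rho_ne_zero hd] with ξ hξ
          rw [wt_wt hξ]; norm_num
        rw [h5]
        gcongr
        exact f2e_mono (hM τ (Ioc_subset_Icc_self hτ))
      refine ne_top_of_le_ne_top ?_ (setLIntegral_mono' measurableSet_Ioc h1)
      have h6 : 1 + f2e M ≠ ⊤ := ENNReal.add_ne_top.2 ⟨by simp, f2e_ne_top (by simp)⟩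
      rw [lintegral_const_mul' _ _ h6]
      exact ENNReal.mul_ne_top h6 (hg.integrable T hT).ne
    · intro s hs t ht
      rw [lintegral_lintegral_swap (μ := volume.restrict (Ioc s t)) (ν := (volume : Measure (E d)))
        hFw.aemeasurable]
      refine lintegral_mono_ae ?_
      filter_upwards [hg.eq, i1, i2] with ξ e a1 a2
      have r2' : rho ξ ^ (2 : ℝ) ≠ ⊤ := ENNReal.rpow_ne_top_of_nonneg (by norm_num) (rho_ne_top ξ)
      simp only [wt]
      rw [lintegral_const_mul' _ _ r2']
      gcongr
      have hi : ∀ T, IntegrableOn (fun r => (symb ξ : ℂ) * g r ξ + cwt (cexpTail (cwt (g r))) ξ)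
        (Ioc 0 T) := fun T => ((a1 T).const_mul _).add (a2 T)
      have hu : Ioc 0 t = Ioc 0 s ∪ Ioc s t := (Ioc_union_Ioc_eq_Ioc hs.1 ht.1).symm
      have hdis : Disjoint (Ioc 0 s) (Ioc s t) := by
        rw [Set.disjoint_left]; intro x h1 h2; exact absurd h1.2 (not_le.2 h2.1)
      rw [e t (hs.1.trans ht.1), e s hs.1, sub_sub_sub_cancel_left, hu,
        setIntegral_union hdis measurableSet_Ioc (hi s)
          ((hi t).mono_set (hu ▸ subset_union_right)), sub_add_cancel_left, enorm_neg]
      refine (enorm_integral_le_lintegral_enorm _).trans_eq ?_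
      rw [hF]
  obtain ⟨κ, hκm, hκ, h1⟩ := hone hg
  obtain ⟨κ', hκm', hκ', h1'⟩ := hone hg'
  refine ⟨fun τ => κ τ + κ' τ, ?_, fun s hs t ht => ?_⟩
  · rw [lintegral_add_left hκm]; exact ENNReal.add_ne_top.2 ⟨hκ, hκ'⟩
  · rw [lintegral_add_left hκm]
    have m1 := measurable_cslice hg.meas
    have m2 := measurable_cslice hg'.meas
    have h2 : ∀ ξ, wt 2 (fun ξ => ‖g' t ξ - g t ξ‖ₑ) ξ ≤ wt 2 (fun ξ => ‖g' s ξ - g s ξ‖ₑ) ξ +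
        (wt 2 (fun ξ => ‖g t ξ - g s ξ‖ₑ) ξ + wt 2 (fun ξ => ‖g' t ξ - g' s ξ‖ₑ) ξ) := fun ξ => by
      unfold wt
      rw [← mul_add, ← mul_add]
      gcongr
      have e : g' t ξ - g t ξ = (g' s ξ - g s ξ) + ((g' t ξ - g' s ξ) - (g t ξ - g s ξ)) := by ring
      beta_reduce
      rw [e]
      refine (enorm_add_le _ _).trans ?_
      gcongr
      rw [add_comm]
      exact enorm_sub_le
    refine (lintegral_mono h2).trans ?_
    have n1 : Measurable (wt 2 fun ξ => ‖g' s ξ - g s ξ‖ₑ) := measurable_wt 2 ((m2 s).sub (m1 s)).enorm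
    have n2 : Measurable (wt 2 fun ξ => ‖g t ξ - g s ξ‖ₑ) := measurable_wt 2 ((m1 t).sub (m1 s)).enorm
    rw [lintegral_add_left n1, lintegral_add_left n2]
    gcongr
    · exact h1 s hs t ht
    · exact h1' s hs t ht

/-- Uniqueness on the Fourier side: a solution that stays small in the critical norm is the only
solution. -/
theorem FourierSol.unique (hd : 1 ≤ d) {g₀ : E d → ℂ} {g g' : ℝ → E d → ℂ}
    (hg : FourierSol g₀ g) (hg' : FourierSol g₀ g')
    (hs : ∀ t, 0 ≤ t → ∫⁻ ξ, wt 2 (fun ξ => ‖g t ξ‖ₑ) ξ ≤ 1 / 16) {T : ℝ} (hT : 0 ≤ T) :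
    g' T =ᵐ[volume] g T := by
  obtain ⟨κ, hκ, hmod⟩ := hg.exists_modulus hd hg' hT
  obtain ⟨δ, hδ, hδκ⟩ := exists_pos_setLIntegral_lt_of_measure_lt hκ (ε := 1 / 4) (by simp)
  obtain ⟨η, hη0, hηδ⟩ : ∃ η : ℝ, 0 < η ∧ ENNReal.ofReal η < δ := by
    obtain ⟨q, hq0, hq⟩ := ENNReal.lt_iff_exists_nnreal_btwn.1 hδ
    exact ⟨q, by exact_mod_cast hq0, by simpa using hq⟩
  -- closeness is propagated over steps of a fixed length `η`, over which the modulus of continuity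
  -- increases by less than `1 / 4`
  have step : ∀ k : ℕ, ∀ t ∈ Icc 0 (min T (k * η)), g' t =ᵐ[volume] g t := by
    intro k
    induction k with
    | zero =>
      intro t ht
      have h0 : t = 0 := le_antisymm (by simpa [hT] using ht.2) ht.1
      subst h0
      filter_upwards [hg.eq, hg'.eq] with ξ e e'
      rw [e 0 le_rfl, e' 0 le_rfl]; simp
    | succ k ih =>
      have hs0 : 0 ≤ min T (k * η) := le_min hT (by positivity)
      refine hg.ae_eq_of_close hd hg' hs (le_min hT (by positivity)) fun t ht => ?_
      have hz : ∀ r ∈ Icc 0 (min T (k * η)), ∫⁻ ξ, wt 2 (fun ξ => ‖g' r ξ - g r ξ‖ₑ) ξ = 0 :=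
        fun r hr => by
        rw [← lintegral_zero (μ := (volume : Measure (E d)))]
        refine lintegral_congr_ae ?_
        filter_upwards [ih r hr] with ξ h
        simp [wt, h]
      rcases le_total t (min T (k * η)) with h | h
      · rw [hz t ⟨ht.1.le, h⟩]; exact zero_le
      · refine (hmod _ ⟨hs0, min_le_left _ _⟩ t ⟨h, ht.2.trans (min_le_left _ _)⟩).trans ?_
        rw [hz _ ⟨hs0, le_rfl⟩, zero_add]
        have hsub : Ioc (min T (k * η)) t ⊆ Ioc 0 T := fun x hx =>
          ⟨hs0.trans_lt hx.1, hx.2.trans (ht.2.trans (min_le_left _ _))⟩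
        have h3 := hδκ (Ioc (min T (k * η)) t) ?_
        · rw [Measure.restrict_restrict measurableSet_Ioc, inter_eq_left.2 hsub] at h3
          exact h3.le
        · refine ((Measure.restrict_apply_le _ _).trans ?_).trans_lt hηδ
          rw [Real.volume_Ioc]
          refine ENNReal.ofReal_le_ofReal ?_
          have h4 := ht.2
          push_cast at h4
          rcases le_total T (k * η) with h5 | h5
          · rw [min_eq_left h5]; linarith [h4.trans (min_le_left _ _)]
          · rw [min_eq_right h5]; linarith [h4.trans (min_le_right _ _)]
  obtain ⟨k, hk⟩ := exists_nat_ge (T / η)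
  refine step k T ⟨hT, le_min le_rfl ?_⟩
  rwa [div_le_iff₀ hη0] at hk

end

section

/-! ### Schwartz functions and Fourier inversion -/

open scoped FourierTransform

variable {d : ℕ}

/-- A real Schwartz function, regarded as a complex one. -/
def toC (φ : 𝓢(E d, ℝ)) : 𝓢(E d, ℂ) := SchwartzMap.postcompCLM (𝕜 := ℝ) Complex.ofRealCLM φ

/-- The inverse Fourier transform of a real Schwartz function. -/
def psi (φ : 𝓢(E d, ℝ)) : 𝓢(E d, ℂ) := 𝓕⁻ (toC φ)

lemma toC_apply (φ : 𝓢(E d, ℝ)) (x : E d) : toC φ x = (φ x : ℂ) := by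
  simp [toC]

lemma toC_laplacian (φ : 𝓢(E d, ℝ)) :
    toC (Laplacian.laplacian φ) = Laplacian.laplacian (toC φ) := by
  ext x
  have h : (toC φ : E d → ℂ) = Complex.ofRealCLM ∘ φ := by ext x; simp [toC_apply]
  rw [toC_apply, SchwartzMap.laplacian_apply, SchwartzMap.laplacian_apply, h]
  exact ((φ.contDiffAt 2).laplacian_CLM_comp_left (l := Complex.ofRealCLM)).symm

lemma psi_laplacian (φ : 𝓢(E d, ℝ)) (ξ : E d) :
    psi (Laplacian.laplacian φ) ξ = -((((2 * Real.pi * ‖ξ‖) ^ 2 : ℝ) : ℂ) * psi φ ξ) := by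
  have h1 : 𝓕 (Laplacian.laplacian (toC φ)) (-ξ) =
      -((((2 * Real.pi * ‖ξ‖) ^ 2 : ℝ) : ℂ) * 𝓕 (toC φ) (-ξ)) := by
    rw [SchwartzMap.laplacian_eq_fourierMultiplierCLM, FourierTransform.fourier_smul,
      SchwartzMap.fourierMultiplierCLM_apply, FourierTransform.fourier_fourierInv_eq]
    rw [smul_apply, SchwartzMap.smulLeftCLM_apply_apply (by fun_prop)]
    simp only [norm_neg, Complex.real_smul]
    push_cast
    simp
    ring
  have h2 : ∀ f : 𝓢(E d, ℂ), 𝓕⁻ f ξ = 𝓕 f (-ξ) := fun f => by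
    rw [SchwartzMap.fourierInv_coe, SchwartzMap.fourier_coe, Real.fourierInv_eq_fourier_neg]
  unfold psi
  rw [toC_laplacian, h2, h2, h1]

lemma psi_neg (φ : 𝓢(E d, ℝ)) (ξ : E d) : psi φ (-ξ) = star (psi φ ξ) := by
  unfold psi
  rw [SchwartzMap.fourierInv_coe, Real.fourierInv_eq', Real.fourierInv_eq', RCLike.star_def,
    ← integral_conj]
  refine integral_congr_ae (Filter.Eventually.of_forall fun x => ?_)
  simp [toC_apply, ← Complex.exp_conj, Complex.conj_ofNat]

/-- Parseval's identity for a square integrable and a Schwartz function. -/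
lemma integral_mul_schwartz (F : Lp ℂ 2 (volume : Measure (E d))) (φ : 𝓢(E d, ℂ)) :
    ∫ x, F x * φ x = ∫ ξ, (𝓕 F : Lp ℂ 2 (volume : Measure (E d))) ξ * 𝓕⁻ φ ξ := by
  have h := congrArg (fun T : 𝓢'(E d, ℂ) => T (𝓕⁻ φ)) (Lp.fourier_toTemperedDistribution_eq F)
  simp only [TemperedDistribution.fourier_apply, FourierTransform.fourier_fourierInv_eq,
    Lp.toTemperedDistribution_apply, smul_eq_mul] at h
  simpa only [mul_comm] using h

lemma coeFn_toComplex (f : L2 d) : toComplex f =ᵐ[volume] fun x => (f x : ℂ) :=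
  Complex.ofRealCLM.coeFn_compLp f

/-- The pairing of a real `L²` function with a real Schwartz function, on the Fourier side. -/
lemma integral_L2_mul (h : L2 d) (φ : 𝓢(E d, ℝ)) :
    ((∫ x, h x * φ x : ℝ) : ℂ) =
      ∫ ξ, (𝓕 (toComplex h) : Lp ℂ 2 (volume : Measure (E d))) ξ * psi φ ξ := by
  rw [psi, ← integral_mul_schwartz, ← integral_complex_ofReal]
  refine integral_congr_ae ?_
  filter_upwards [coeFn_toComplex h] with x hx
  rw [hx, toC_apply]; push_cast; rfl

/-- The Fourier inversion pairing for integrable functions. -/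
lemma integral_fourierInv_mul {f g : E d → ℂ} (hf : Integrable f) (hg : Integrable g) :
    ∫ x, 𝓕⁻ f x * g x = ∫ ξ, f ξ * 𝓕⁻ g ξ := by
  have h := VectorFourier.integral_fourierIntegral_smul_eq_flip (μ := (volume : Measure (E d)))
    (ν := (volume : Measure (E d))) (L := -innerₗ (E d)) (e := Real.fourierChar)
    Real.continuous_fourierChar (by
      have : Continuous fun p : E d × E d => -(inner ℝ p.1 p.2) := by fun_prop
      exact this) hf hg
  have e : (-innerₗ (E d)).flip = -innerₗ (E d) := by
    ext x y; simp [real_inner_comm]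
  rw [e] at h
  exact h

lemma integral_fourierInv_mul_schwartz {f : E d → ℂ} (hf : Integrable f) (φ : 𝓢(E d, ℝ)) :
    ∫ x, 𝓕⁻ f x * (φ x : ℂ) = ∫ ξ, f ξ * psi φ ξ := by
  have := integral_fourierInv_mul hf (toC φ).integrable
  simp only [toC_apply] at this
  rw [this, psi, SchwartzMap.fourierInv_coe]

/-- The constant term of the exponential does not contribute to the equation. -/
lemma integral_laplacian_eq_zero (φ : 𝓢(E d, ℝ)) : ∫ x, Laplacian.laplacian φ x = 0 := by
  have h1 := psi_laplacian φ 0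
  simp only [norm_zero, mul_zero] at h1
  rw [psi, SchwartzMap.fourierInv_coe, Real.fourierInv_eq'] at h1
  simp only [inner_zero_right, mul_zero, Complex.ofReal_zero, zero_mul, Complex.exp_zero, one_smul,
    toC_apply] at h1
  rw [integral_complex_ofReal] at h1
  have h2 : (((∫ x, Laplacian.laplacian φ x : ℝ)) : ℂ) = 0 := by simpa using h1
  exact_mod_cast h2

/-- A function annihilated by the inverse Fourier transforms of real Schwartz functions vanishes. -/
lemma ae_eq_zero_of_integral_psi {q : E d → ℂ}
    (hi : ∀ φ : 𝓢(E d, ℂ), Integrable fun ξ => q ξ * φ ξ)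
    (h : ∀ φ : 𝓢(E d, ℝ), ∫ ξ, q ξ * psi φ ξ = 0) : ∀ᵐ ξ, q ξ = 0 := by
  -- integrability against Schwartz functions implies local integrability, by a bump function
  have hq : LocallyIntegrable q := by
    rw [locallyIntegrable_iff]
    intro K hK
    obtain ⟨R, hR⟩ := hK.isBounded.subset_closedBall (0 : E d)
    obtain ⟨b, hb⟩ : ∃ b : ContDiffBump (0 : E d), b.rIn = max R 1 :=
      ⟨⟨max R 1, max R 1 + 1, by positivity, by linarith⟩, rfl⟩
    have hi' := (hi (toC (b.hasCompactSupport.toSchwartzMap b.contDiff))).integrableOn (s := K)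
    refine hi'.congr_fun_ae ?_
    filter_upwards [ae_restrict_mem hK.measurableSet] with x hx
    have h1 : b x = 1 := b.one_of_mem_closedBall
      (Metric.closedBall_subset_closedBall (by rw [hb]; exact le_max_left _ _) (hR hx))
    have h2 : b.hasCompactSupport.toSchwartzMap b.contDiff x = b x := rfl
    rw [toC_apply, h2, h1]; simp
  refine ae_eq_zero_of_integral_contDiff_smul_eq_zero hq fun g hg hc => ?_
  obtain ⟨γ, hγ⟩ : ∃ γ : 𝓢(E d, ℝ), γ = hc.toSchwartzMap hg := ⟨_, rfl⟩
  have hγx : ∀ x, γ x = g x := fun x => by rw [hγ]; rfl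
  -- a test function is a complex combination of inverse Fourier transforms of real Schwartz functions
  obtain ⟨φ₁, h1⟩ : ∃ φ₁ : 𝓢(E d, ℝ),
    φ₁ = SchwartzMap.postcompCLM (𝕜 := ℝ) Complex.reCLM (𝓕 (toC γ)) := ⟨_, rfl⟩
  obtain ⟨φ₂, h2⟩ : ∃ φ₂ : 𝓢(E d, ℝ),
    φ₂ = SchwartzMap.postcompCLM (𝕜 := ℝ) Complex.imCLM (𝓕 (toC γ)) := ⟨_, rfl⟩
  have h3 : 𝓕 (toC γ) = toC φ₁ + Complex.I • toC φ₂ := by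
    ext x
    simp only [add_apply, smul_apply, toC_apply, h1, h2,
      SchwartzMap.postcompCLM_apply, Complex.reCLM_apply, Complex.imCLM_apply, smul_eq_mul]
    rw [mul_comm]
    exact (Complex.re_add_im _).symm
  have h4 : toC γ = psi φ₁ + Complex.I • psi φ₂ := by
    have := congrArg (fun f : 𝓢(E d, ℂ) => 𝓕⁻ f) h3
    simp only [FourierTransform.fourierInv_fourier_eq, FourierTransform.fourierInv_add,
      FourierTransform.fourierInv_smul] at this
    exact this
  have h5 : ∀ x, g x • q x = q x * psi φ₁ x + Complex.I * (q x * psi φ₂ x) := fun x => by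
    have h6 := congrArg (fun f : 𝓢(E d, ℂ) => f x) h4
    simp only [toC_apply, hγx, add_apply, smul_apply, smul_eq_mul] at h6
    rw [Complex.real_smul, h6]; ring
  simp_rw [h5]
  rw [integral_add (hi _) ((hi _).const_mul _), integral_const_mul, h, h]
  simp

end

section

/-! ### The convolution exponential and the equation -/

open scoped FourierTransform

variable {d : ℕ}

lemma integrable_cconvPow {f : E d → ℂ} (hf : Measurable f) (hi : Integrable f) (n : ℕ) :
    Integrable (cconvPow f n) := by
  refine ⟨(measurable_cconvPow hf n).aestronglyMeasurable,
    (lintegral_mono (enorm_cconvPow_le hf n)).trans_lt ?_⟩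
  rw [lintegral_convPow hf.enorm]
  exact ENNReal.pow_lt_top hi.2

lemma fourierInv_cconv {f g : E d → ℂ} (hf : Integrable f) (hg : Integrable g) (x : E d) :
    𝓕⁻ (cconv f g) x = 𝓕⁻ f x * 𝓕⁻ g x := by
  simp only [Real.fourierInv_eq_fourier_neg]
  exact Real.fourier_mul_convolution_eq hf hg (-x)

lemma fourierInv_cconvPow {f : E d → ℂ} (hf : Measurable f) (hi : Integrable f) (n : ℕ) (x : E d) :
    𝓕⁻ (cconvPow f n) x = 𝓕⁻ f x ^ (n + 1) := by
  induction n with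
  | zero => simp [cconvPow]
  | succ n ih =>
    rw [cconvPow, fourierInv_cconv hi (integrable_cconvPow hf hi n), ih, ← pow_succ']

lemma lintegral_expTail_lt_top {f : E d → ℂ} (hf : Measurable f) (hi : Integrable f) :
    ∫⁻ ξ, expTail (fun ξ => ‖f ξ‖ₑ) ξ < ⊤ := by
  obtain ⟨C, hC⟩ := exists_lintegral_expTail_le (d := d) (∫⁻ ξ, ‖f ξ‖ₑ).toNNReal
  refine (hC _ hf.enorm ?_).trans_lt (by simp)
  rw [ENNReal.coe_toNNReal hi.2.ne]

lemma integrable_cexpTail {f : E d → ℂ} (hf : Measurable f) (hi : Integrable f) :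
    Integrable (cexpTail f) :=
  ⟨(measurable_cexpTail hf).aestronglyMeasurable,
    (lintegral_mono (enorm_cexpTail_le hf)).trans_lt (lintegral_expTail_lt_top hf hi)⟩

/-- The Fourier side of the nonlinearity `e^U - 1 - U`. -/
lemma fourierInv_cexpTail {f : E d → ℂ} (hf : Measurable f) (hi : Integrable f) (x : E d) :
    𝓕⁻ (cexpTail f) x = Complex.exp (𝓕⁻ f x) - 1 - 𝓕⁻ f x := by
  obtain ⟨e, he⟩ : ∃ e : E d → ℂ, e = fun v =>
    Complex.exp (((2 * Real.pi * inner ℝ v x : ℝ) : ℂ) * Complex.I) := ⟨_, rfl⟩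
  have hinv : ∀ F : E d → ℂ, 𝓕⁻ F x = ∫ v, e v * F v := fun F => by
    rw [Real.fourierInv_eq', he]; simp only [smul_eq_mul]
  have hem : Measurable e := by
    rw [he]
    have : Continuous fun v : E d =>
      Complex.exp (((2 * Real.pi * inner ℝ v x : ℝ) : ℂ) * Complex.I) := by fun_prop
    exact this.measurable
  have hen : ∀ v, ‖e v‖ₑ = 1 := fun v => by
    rw [he, ← ofReal_norm]; simp only; rw [Complex.norm_exp_ofReal_mul_I]; simp
  obtain ⟨F, hF⟩ : ∃ F : E d → ℕ → ℂ, F = fun v n =>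
    e v * (((n + 2).factorial : ℂ)⁻¹ * cconvPow f (n + 1) v) := ⟨_, rfl⟩
  have hFm : Measurable (Function.uncurry F) := by
    rw [hF]
    exact measurable_from_prod_countable_left fun n =>
      hem.mul ((measurable_cconvPow hf (n + 1)).const_mul ((n + 2).factorial : ℂ)⁻¹)
  -- the exponential series is written as an integral for the counting measure, and Fubini applies
  have hFi : Integrable (Function.uncurry F) (volume.prod Measure.count) := by
    refine ⟨hFm.aestronglyMeasurable, ?_⟩
    rw [HasFiniteIntegral, lintegral_prod _ hFm.enorm.aemeasurable]
    refine (lintegral_mono fun v => ?_).trans_lt (lintegral_expTail_lt_top hf hi)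
    rw [lintegral_count, expTail]
    refine ENNReal.tsum_le_tsum fun n => ?_
    simp only [Function.uncurry, hF]
    rw [enorm_mul, hen, one_mul, enorm_mul]
    gcongr
    · rw [enorm_inv (by exact_mod_cast (n + 2).factorial_ne_zero), ← ofReal_norm]
      simp
    · exact enorm_cconvPow_le hf _ v
  have h1 : 𝓕⁻ (cexpTail f) x =
      ∫ n : ℕ, ((n + 2).factorial : ℂ)⁻¹ * 𝓕⁻ f x ^ (n + 2) ∂Measure.count := by
    rw [hinv]
    have e1 : ∀ v, e v * cexpTail f v = ∫ n, F v n ∂Measure.count := fun v => by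
      rw [hF, cexpTail, ← integral_const_mul]
    simp_rw [e1]
    rw [integral_integral_swap hFi]
    refine integral_congr_ae (Filter.Eventually.of_forall fun n => ?_)
    simp only [hF]
    rw [← fourierInv_cconvPow hf hi (n + 1) x, hinv, ← integral_const_mul]
    refine integral_congr_ae (Filter.Eventually.of_forall fun v => ?_)
    simp only; ring
  have hs : HasSum (fun n : ℕ => 𝓕⁻ f x ^ n / (n.factorial : ℂ)) (Complex.exp (𝓕⁻ f x)) := by
    rw [Complex.exp_eq_exp_ℂ]; exact NormedSpace.expSeries_div_hasSum_exp _
  have hs2 := (hasSum_nat_add_iff' 2).2 hs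
  have hsn : Summable fun n : ℕ => ‖((n + 2).factorial : ℂ)⁻¹ * 𝓕⁻ f x ^ (n + 2)‖ := by
    have := (summable_nat_add_iff 2).2 (NormedSpace.norm_expSeries_div_summable (𝔸 := ℂ) (𝓕⁻ f x))
    refine this.congr fun n => ?_
    rw [div_eq_inv_mul]
  rw [h1, integral_countable (integrable_count_iff.2 hsn)]
  simp only [Measure.real, Measure.count_singleton, ENNReal.toReal_one, one_smul]
  have h2 : ∀ n : ℕ, ((n + 2).factorial : ℂ)⁻¹ * 𝓕⁻ f x ^ (n + 2) =
      𝓕⁻ f x ^ (n + 2) / ((n + 2).factorial : ℂ) := fun n => by rw [div_eq_inv_mul]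
  simp_rw [h2]
  rw [hs2.tsum_eq]
  simp [Finset.sum_range_succ]; ring

lemma fourierInv_continuous {f : E d → ℂ} (hf : Integrable f) : Continuous (𝓕⁻ f) := by
  have h : Continuous fun p : E d × E d => -(inner ℝ p.1 p.2) := by fun_prop
  exact VectorFourier.fourierIntegral_continuous (L := -innerₗ (E d)) Real.continuous_fourierChar
    h hf

lemma integrable_mul_schwartz {f : E d → ℂ} (hf : Integrable f) (φ : 𝓢(E d, ℂ)) :
    Integrable fun ξ => f ξ * φ ξ := by
  obtain ⟨C, hC⟩ := φ.toBoundedContinuousFunction.bddAbove_range_norm_comp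
  refine hf.mul_bdd (c := C) φ.continuous.aestronglyMeasurable
    (Filter.Eventually.of_forall fun x => ?_)
  exact hC ⟨x, rfl⟩

lemma cwt_mul_psi (f : E d → ℂ) (φ : 𝓢(E d, ℝ)) (ξ : E d) :
    cwt f ξ * psi φ ξ = -(f ξ * psi (Laplacian.laplacian φ) ξ) := by
  rw [psi_laplacian, cwt]; ring

lemma cwt_cwt (g : E d → ℂ) (ξ : E d) : cwt (cwt g) ξ = (symb ξ : ℂ) * g ξ := by
  unfold cwt symb; push_cast; ring

/-- The right-hand side of the equation, tested against a Schwartz function, on the Fourier side. -/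
lemma integral_exp_mul_laplacian {g : E d → ℂ} (hg : Measurable g) (hi : Integrable (cwt g))
    (u : E d →ᵇ ℝ) (hu : ∀ x, (u x : ℂ) = -𝓕⁻ (cwt g) x) (φ : 𝓢(E d, ℝ)) :
    ((∫ x, Real.exp (-(u x)) * Laplacian.laplacian φ x : ℝ) : ℂ) =
      -∫ ξ, ((symb ξ : ℂ) * g ξ + cwt (cexpTail (cwt g)) ξ) * psi φ ξ := by
  have hT := integrable_cexpTail (measurable_cwt hg) hi
  have h1 := integral_fourierInv_mul_schwartz hi (Laplacian.laplacian φ)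
  have h2 := integral_fourierInv_mul_schwartz hT (Laplacian.laplacian φ)
  have hΔ : Integrable fun x => Laplacian.laplacian φ x := (Laplacian.laplacian φ).integrable
  have hexp : Integrable fun x => Real.exp (-(u x)) * Laplacian.laplacian φ x := by
    refine hΔ.bdd_mul (c := Real.exp ‖u‖) (by fun_prop) (Filter.Eventually.of_forall fun x => ?_)
    rw [Real.norm_of_nonneg (Real.exp_pos _).le, Real.exp_le_exp]
    exact (neg_le_abs _).trans (u.norm_coe_le_norm x)
  have e1 : ∫ x, Real.exp (-(u x)) * Laplacian.laplacian φ x =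
      ∫ x, (Real.exp (-(u x)) - 1) * Laplacian.laplacian φ x := by
    simp_rw [sub_mul, one_mul]
    rw [integral_sub hexp hΔ, integral_laplacian_eq_zero, sub_zero]
  have i1 : Integrable fun x => 𝓕⁻ (cwt g) x * ((Laplacian.laplacian φ x : ℝ) : ℂ) := by
    refine (hΔ.ofReal (𝕜 := ℂ)).bdd_mul (c := ‖u‖)
      (fourierInv_continuous hi).aestronglyMeasurable (Filter.Eventually.of_forall fun x => ?_)
    have := u.norm_coe_le_norm x
    rw [← norm_neg, ← hu x, Complex.norm_real]; exact this
  have i2 : Integrable fun x =>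
      𝓕⁻ (cexpTail (cwt g)) x * ((Laplacian.laplacian φ x : ℝ) : ℂ) := by
    refine (hΔ.ofReal (𝕜 := ℂ)).bdd_mul (c := ∫ ξ, ‖cexpTail (cwt g) ξ‖)
      (fourierInv_continuous hT).aestronglyMeasurable (Filter.Eventually.of_forall fun x => ?_)
    exact VectorFourier.norm_fourierIntegral_le_integral_norm _ _ _ _ _
  rw [e1, ← integral_complex_ofReal]
  have e2 : ∀ x, (((Real.exp (-(u x)) - 1) * Laplacian.laplacian φ x : ℝ) : ℂ) =
      𝓕⁻ (cwt g) x * ((Laplacian.laplacian φ x : ℝ) : ℂ) +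
        𝓕⁻ (cexpTail (cwt g)) x * ((Laplacian.laplacian φ x : ℝ) : ℂ) := fun x => by
    rw [fourierInv_cexpTail (measurable_cwt hg) hi]
    push_cast
    rw [hu x, neg_neg]; ring
  simp_rw [e2]
  rw [integral_add i1 i2, h1, h2, ← integral_add
    (integrable_mul_schwartz hi _) (integrable_mul_schwartz hT _), ← integral_neg]
  refine integral_congr_ae (Filter.Eventually.of_forall fun ξ => ?_)
  simp only
  rw [← cwt_cwt, add_mul, cwt_mul_psi (cwt g), cwt_mul_psi (cexpTail (cwt g))]; ring

/-- The distributional Laplacian of `h`, read off from its Fourier transform. -/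
lemma isLaplacian_iff {h : L2 d} {g : E d → ℂ}
    (hgh : g =ᵐ[volume] (𝓕 (toComplex h) : Lp ℂ 2 (volume : Measure (E d))))
    (hi : Integrable (cwt g)) (u : E d →ᵇ ℝ) :
    IsLaplacian h u ↔ ∀ x, (u x : ℂ) = -𝓕⁻ (cwt g) x := by
  have key : ∀ φ : 𝓢(E d, ℝ), ((∫ x, h x * Laplacian.laplacian φ x : ℝ) : ℂ) =
      -∫ x, 𝓕⁻ (cwt g) x * (φ x : ℂ) := fun φ => by
    rw [integral_L2_mul, integral_fourierInv_mul_schwartz hi, ← integral_neg]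
    refine integral_congr_ae ?_
    filter_upwards [hgh] with ξ hξ
    rw [cwt_mul_psi, neg_neg, hξ]
  have hcont := fourierInv_continuous hi
  have hucont : Continuous fun x => (u x : ℂ) := by fun_prop
  constructor
  · intro hL
    have h0 : ∀ᵐ x, (u x : ℂ) + 𝓕⁻ (cwt g) x = 0 := by
      refine ae_eq_zero_of_integral_contDiff_smul_eq_zero
        (hucont.add hcont).locallyIntegrable fun χ hχ hc => ?_
      have h1 := hL (hc.toSchwartzMap hχ)
      have h2 := key (hc.toSchwartzMap hχ)
      have hx : ∀ x, hc.toSchwartzMap hχ x = χ x := fun x => rfl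
      rw [← h1] at h2
      simp only [hx] at h2
      rw [← integral_complex_ofReal] at h2
      have hχc : Continuous fun x => (χ x : ℂ) := Complex.continuous_ofReal.comp hχ.continuous
      have hcc : HasCompactSupport fun x => (χ x : ℂ) := hc.comp_left Complex.ofReal_zero
      have j1 : Integrable fun x => (u x : ℂ) * (χ x : ℂ) :=
        (hucont.mul hχc).integrable_of_hasCompactSupport hcc.mul_left
      have j2 : Integrable fun x => 𝓕⁻ (cwt g) x * (χ x : ℂ) :=
        (hcont.mul hχc).integrable_of_hasCompactSupport hcc.mul_left
      have e : ∀ x, χ x • ((u x : ℂ) + 𝓕⁻ (cwt g) x) =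
          (u x : ℂ) * (χ x : ℂ) + 𝓕⁻ (cwt g) x * (χ x : ℂ) := fun x => by
        rw [Complex.real_smul]; ring
      simp_rw [e]
      rw [integral_add j1 j2]
      push_cast at h2
      rw [h2]; ring
    have h3 := (Continuous.ae_eq_iff_eq (volume : Measure (E d)) (hucont.add hcont)
      (continuous_const (y := (0 : ℂ)))).1 h0
    intro x
    exact eq_neg_of_add_eq_zero_left (congrFun h3 x)
  · intro hu φ
    have h2 := key φ
    have : ((∫ x, u x * φ x : ℝ) : ℂ) = ((∫ x, h x * Laplacian.laplacian φ x : ℝ) : ℂ) := by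
      rw [h2, ← integral_complex_ofReal, ← integral_neg]
      refine integral_congr_ae (Filter.Eventually.of_forall fun x => ?_)
      simp only
      push_cast
      rw [hu x]; ring
    exact_mod_cast this

end

section

/-! ### Norms in Mathlib's normalisation of the Fourier transform -/

open scoped FourierTransform

variable {d : ℕ}

/-- Mathlib's Fourier transform of a real `L²` function, with kernel `e^{-2πi x·w}`. -/
def ghat (h : L2 d) : E d → ℂ := (𝓕 (toComplex h) : Lp ℂ 2 (volume : Measure (E d)))

lemma measurable_ghat (h : L2 d) : Measurable (ghat h) := (Lp.stronglyMeasurable _).measurable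

lemma lintegral_enorm_sq (F : Lp ℂ 2 (volume : Measure (E d))) :
    ∫⁻ ξ, ‖F ξ‖ₑ ^ (2 : ℝ) = ‖F‖ₑ ^ (2 : ℝ) := by
  rw [Lp.enorm_def, eLpNorm_eq_lintegral_rpow_enorm_toReal (by simp) (by simp),
    ← ENNReal.rpow_mul]
  simp

lemma lintegral_comp_inv_two_pi_smul (F : E d → ℝ≥0∞) (hF : Measurable F) :
    ∫⁻ ξ : E d, F ((2 * Real.pi)⁻¹ • ξ) = ENNReal.ofReal ((2 * Real.pi) ^ d) * ∫⁻ w, F w := by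
  have h := Measure.map_addHaar_smul (volume : Measure (E d)) (r := (2 * Real.pi)⁻¹) (by positivity)
  rw [← lintegral_map hF (by fun_prop), h, lintegral_smul_measure, finrank_euclideanSpace_fin,
    inv_pow, inv_inv, abs_of_pos (by positivity), smul_eq_mul]

lemma enorm_eq_rho (ξ : E d) : ‖ξ‖ₑ = rho ((2 * Real.pi)⁻¹ • ξ) := by
  rw [rho, norm_smul, Real.norm_of_nonneg (by positivity), ← mul_assoc,
    mul_inv_cancel₀ (by positivity), one_mul, ofReal_norm]

lemma enorm_fhat (h : L2 d) (ξ : E d) :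
    ‖fhat h ξ‖ₑ = ENNReal.ofReal ((2 * Real.pi) ^ (-(d : ℝ) / 2)) *
      ‖ghat h ((2 * Real.pi)⁻¹ • ξ)‖ₑ := by
  unfold fhat ghat
  rw [enorm_mul]
  congr 1
  rw [← ofReal_norm, Complex.norm_real, Real.norm_of_nonneg (by positivity)]

lemma fNorm_eq (s : ℝ) {p : ℝ} (hp : 0 < p) (h : L2 d) :
    fNorm s p h = (ENNReal.ofReal ((2 * Real.pi) ^ d) *
      ENNReal.ofReal ((2 * Real.pi) ^ (-(d : ℝ) / 2)) ^ p) ^ (1 / p) *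
        (∫⁻ ξ, wt s (fun ξ => ‖ghat h ξ‖ₑ) ξ ^ p) ^ (1 / p) := by
  unfold fNorm
  rw [← ENNReal.mul_rpow_of_nonneg _ _ (by positivity)]
  congr 1
  have hm : Measurable fun w => wt s (fun ξ => ‖ghat h ξ‖ₑ) w ^ p :=
    (measurable_wt s (measurable_ghat h).enorm).pow_const p
  rw [mul_assoc, ← lintegral_const_mul _ hm,
    ← lintegral_comp_inv_two_pi_smul _ (hm.const_mul _)]
  refine lintegral_congr fun ξ => ?_
  rw [enorm_fhat, enorm_eq_rho, wt_rpow s hp.le, ENNReal.mul_rpow_of_nonneg _ _ hp.le]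
  ring

/-- The factor `(2π)^(d/2)` between the two normalisations. -/
def normConst (d : ℕ) : ℝ≥0∞ := ENNReal.ofReal ((2 * Real.pi) ^ ((d : ℝ) / 2))

lemma normConst_ne_top (d : ℕ) : normConst d ≠ ⊤ := ENNReal.ofReal_ne_top

lemma two_le_normConst (hd : 1 ≤ d) : 2 ≤ normConst d := by
  have h1 : (2 : ℝ) ≤ (2 * Real.pi) ^ ((d : ℝ) / 2) := by
    have hpi := Real.pi_gt_three
    calc (2 : ℝ) = (4 : ℝ) ^ ((1 : ℝ) / 2) := by
          rw [show (4 : ℝ) = 2 ^ (2 : ℝ) by norm_num, ← Real.rpow_mul (by norm_num)]; norm_num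
      _ ≤ (2 * Real.pi) ^ ((1 : ℝ) / 2) := by
          apply Real.rpow_le_rpow <;> linarith
      _ ≤ _ := by
          apply Real.rpow_le_rpow_of_exponent_le (by linarith)
          have : (1 : ℝ) ≤ d := by exact_mod_cast hd
          linarith
  calc (2 : ℝ≥0∞) = ENNReal.ofReal 2 := by simp
    _ ≤ _ := ENNReal.ofReal_le_ofReal h1

lemma sNorm_eq (s : ℝ) (h : L2 d) :
    sNorm s h = normConst d * ∫⁻ ξ, wt s (fun ξ => ‖ghat h ξ‖ₑ) ξ := by
  have h1 : sNorm s h = fNorm s 1 h := by simp [sNorm, fNorm]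
  rw [h1, fNorm_eq s one_pos]
  simp only [ENNReal.rpow_one, one_div, inv_one]
  congr 1
  rw [normConst, ← ENNReal.ofReal_mul (by positivity), ← Real.rpow_natCast,
    ← Real.rpow_add (by positivity)]
  congr 2; ring

lemma lintegral_wt_ghat_le (hd : 1 ≤ d) (s : ℝ) (h : L2 d) :
    2 * ∫⁻ ξ, wt s (fun ξ => ‖ghat h ξ‖ₑ) ξ ≤ sNorm s h := by
  rw [sNorm_eq]
  gcongr
  exact two_le_normConst hd

/-! ### Solutions seen on the Fourier side -/

/-- A continuous curve in `L²` has a jointly measurable representative: it is the almost everywhere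
limit of rapidly converging curves with values in a countable dense set. -/
lemma exists_measurable_rep {F : ℝ → Lp ℂ 2 (volume : Measure (E d))} (hF : Continuous F) :
    ∃ γ : ℝ → E d → ℂ, Measurable (Function.uncurry γ) ∧ ∀ t, γ t =ᵐ[volume] F t := by
  classical
  have : Fact ((2 : ℝ≥0∞) ≠ ⊤) := ⟨by simp⟩
  obtain ⟨D, hD⟩ := TopologicalSpace.exists_dense_seq (Lp ℂ 2 (volume : Measure (E d)))
  have hex : ∀ (j : ℕ) (t : ℝ), ∃ k, ‖F t - D k‖ < (1 / 2) ^ j := fun j t => by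
    obtain ⟨k, hk⟩ := hD.exists_dist_lt (F t) (show (0 : ℝ) < (1 / 2) ^ j by positivity)
    exact ⟨k, by rwa [← dist_eq_norm]⟩
  obtain ⟨γ, hγ⟩ : ∃ γ : ℕ → ℝ → E d → ℂ, γ = fun j t ξ => D (Nat.find (hex j t)) ξ := ⟨_, rfl⟩
  have hγm : ∀ j, Measurable (Function.uncurry (γ j)) := fun j => by
    have h1 : Measurable fun t => Nat.find (hex j t) := measurable_find (hex j) fun k =>
      (isOpen_lt (hF.sub continuous_const).norm continuous_const).measurableSet
    have h2 : Measurable fun p : ℕ × E d => D p.1 p.2 :=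
      measurable_from_prod_countable_right fun n => (Lp.stronglyMeasurable (D n)).measurable
    rw [hγ]
    exact h2.comp ((h1.comp measurable_fst).prodMk measurable_snd)
  refine ⟨fun t ξ => Filter.atTop.limUnder fun j => γ j t ξ,
    (StronglyMeasurable.limUnder (l := Filter.atTop) (f := fun j => Function.uncurry (γ j))
      fun j => (hγm j).stronglyMeasurable).measurable, fun t => ?_⟩
  have hm : ∀ j, Measurable fun ξ => ‖F t ξ - γ j t ξ‖ₑ ^ (2 : ℝ) := fun j =>
    ((Lp.stronglyMeasurable (F t)).measurable.sub (measurable_cslice (hγm j) t)).enorm.pow_const _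
  have h1 : ∀ j, ∫⁻ ξ, ‖F t ξ - γ j t ξ‖ₑ ^ (2 : ℝ) ≤ (1 / 2) ^ j := fun j => by
    have e : ∫⁻ ξ, ‖F t ξ - γ j t ξ‖ₑ ^ (2 : ℝ) = ‖F t - D (Nat.find (hex j t))‖ₑ ^ (2 : ℝ) := by
      rw [← lintegral_enorm_sq]
      refine lintegral_congr_ae ?_
      filter_upwards [Lp.coeFn_sub (F t) (D (Nat.find (hex j t)))] with ξ hξ
      rw [hξ, hγ]; rfl
    have h2 := Nat.find_spec (hex j t)
    have h3 : ‖F t - D (Nat.find (hex j t))‖ₑ ≤ (1 / 2) ^ j := by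
      rw [← ofReal_norm]
      refine (ENNReal.ofReal_le_ofReal h2.le).trans_eq ?_
      rw [ENNReal.ofReal_pow (by norm_num), ENNReal.ofReal_div_of_pos (by norm_num)]
      simp
    have h4 : ((1 / 2 : ℝ≥0∞)) ^ j ≤ 1 := pow_le_one₀ zero_le (by simp)
    rw [e]
    calc ‖F t - D (Nat.find (hex j t))‖ₑ ^ (2 : ℝ) ≤ ((1 / 2) ^ j) ^ (2 : ℝ) :=
          ENNReal.rpow_le_rpow h3 (by norm_num)
      _ = (1 / 2) ^ j * (1 / 2) ^ j := by
          rw [show (2 : ℝ) = ((2 : ℕ) : ℝ) by norm_num, ENNReal.rpow_natCast, pow_two]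
      _ ≤ (1 / 2) ^ j := mul_le_of_le_one_left' h4
  have h2 : ∫⁻ ξ, ∑' j, ‖F t ξ - γ j t ξ‖ₑ ^ (2 : ℝ) ≠ ⊤ := by
    rw [lintegral_tsum fun j => (hm j).aemeasurable]
    refine ne_top_of_le_ne_top ?_ (ENNReal.tsum_le_tsum h1)
    rw [ENNReal.tsum_geometric]
    simp
  filter_upwards [ae_lt_top (Measurable.tsum hm) h2] with ξ h3
  have h4 := ENNReal.tendsto_atTop_zero_of_tsum_ne_top h3.ne
  refine Filter.Tendsto.limUnder_eq ?_
  rw [tendsto_iff_edist_tendsto_0]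
  have h5 := (ENNReal.continuous_rpow_const (y := 1 / 2)).tendsto 0 |>.comp h4
  simp only [Function.comp_def, ← ENNReal.rpow_mul] at h5
  norm_num at h5
  refine h5.congr fun j => ?_
  rw [edist_comm, edist_eq_enorm_sub]

lemma continuous_toComplex : Continuous (toComplex : L2 d → Lp ℂ 2 (volume : Measure (E d))) :=
  (ContinuousLinearMap.compLpL 2 volume Complex.ofRealCLM).continuous

/-- A curve in `L²`, continuous for nonnegative times, has a jointly measurable Fourier transform. -/
lemma exists_measurable_ghat {h : ℝ → L2 d} (hc : ContinuousOn h (Ici 0)) :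
    ∃ γ : ℝ → E d → ℂ, Measurable (Function.uncurry γ) ∧ ∀ t, 0 ≤ t → γ t =ᵐ[volume] ghat (h t) := by
  have hF : Continuous fun t : ℝ =>
      (𝓕 (toComplex (h (max t 0))) : Lp ℂ 2 (volume : Measure (E d))) := by
    have h1 : Continuous fun t : ℝ => h (max t 0) :=
      hc.comp_continuous (by fun_prop) fun t => le_max_right t 0
    exact (FourierTransform.continuous_fourier).comp (continuous_toComplex.comp h1)
  obtain ⟨γ, hγ, he⟩ := exists_measurable_rep hF
  refine ⟨γ, hγ, fun t ht => ?_⟩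
  have := he t
  rwa [max_eq_left ht] at this

end

section

open scoped FourierTransform

variable {d : ℕ}

lemma integrable_ghat_mul {g : E d → ℂ} {h : L2 d} (hg : g =ᵐ[volume] ghat h) (φ : 𝓢(E d, ℂ)) :
    Integrable fun ξ => g ξ * φ ξ := by
  have h1 : MemLp g 2 (volume : Measure (E d)) := (memLp_congr_ae hg).2 (Lp.memLp _)
  exact h1.integrable_mul (φ.memLp 2 volume)

lemma integral_L2_mul_of_ae {g : E d → ℂ} {h : L2 d} (hg : g =ᵐ[volume] ghat h)
    (φ : 𝓢(E d, ℝ)) : ((∫ x, h x * φ x : ℝ) : ℂ) = ∫ ξ, g ξ * psi φ ξ := by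
  rw [integral_L2_mul]
  refine integral_congr_ae ?_
  filter_upwards [hg] with ξ hξ
  rw [hξ]; rfl

/-- The right-hand side of the equation on the Fourier side. -/
def rhs (g : E d → ℂ) (ξ : E d) : ℂ := (symb ξ : ℂ) * g ξ + cwt (cexpTail (cwt g)) ξ

lemma measurable_rhs {g : ℝ → E d → ℂ} (hg : Measurable (Function.uncurry g)) :
    Measurable (Function.uncurry fun τ => rhs (g τ)) :=
  ((Complex.measurable_ofReal.comp (measurable_symb.comp measurable_snd)).mul hg).add
    (measurable_cwt_param (measurable_cexpTail_cwt hg))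

lemma rhs_congr {g g' : E d → ℂ} (h : g =ᵐ[volume] g') : rhs g =ᵐ[volume] rhs g' := by
  have h1 : cexpTail (cwt g) = cexpTail (cwt g') := cexpTail_congr (by
    filter_upwards [h] with ξ h2; simp only [cwt, h2])
  filter_upwards [h] with ξ h2
  simp only [rhs, h1, h2]

lemma exists_rho_sq_mul_schwartz_le (φ : 𝓢(E d, ℂ)) :
    ∃ C : ℝ≥0, ∀ ξ, rho ξ ^ (2 : ℝ) * ‖φ ξ‖ₑ ≤ C := by
  obtain ⟨C, hC⟩ := φ.decay 2 0
  refine ⟨(Real.toNNReal ((2 * Real.pi) ^ 2 * C)), fun ξ => ?_⟩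
  have h1 := hC.2 ξ
  rw [norm_iteratedFDeriv_zero] at h1
  have h2 : rho ξ ^ (2 : ℝ) * ‖φ ξ‖ₑ = ENNReal.ofReal ((2 * Real.pi * ‖ξ‖) ^ 2 * ‖φ ξ‖) := by
    rw [ENNReal.ofReal_mul (by positivity), ofReal_norm, ENNReal.ofReal_pow (by positivity), rho]
    norm_cast
  rw [h2]
  refine ENNReal.ofReal_le_ofReal ?_
  calc (2 * Real.pi * ‖ξ‖) ^ 2 * ‖φ ξ‖ = (2 * Real.pi) ^ 2 * (‖ξ‖ ^ 2 * ‖φ ξ‖) := by ring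
    _ ≤ (2 * Real.pi) ^ 2 * C := by gcongr

/-- The right-hand side, integrated in time against a Schwartz function, converges absolutely. -/
lemma integrable_rhs_mul {g : ℝ → E d → ℂ} (hg : Measurable (Function.uncurry g)) {T : ℝ}
    {M : ℝ≥0} (hM : ∀ t ∈ Ioc 0 T, ∫⁻ ξ, wt 2 (fun ξ => ‖g t ξ‖ₑ) ξ ≤ M) (φ : 𝓢(E d, ℂ)) :
    Integrable (Function.uncurry fun τ ξ => rhs (g τ) ξ * φ ξ)
      ((volume.restrict (Ioc 0 T)).prod volume) := by
  obtain ⟨C, hC⟩ := exists_rho_sq_mul_schwartz_le φ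
  obtain ⟨K, hK⟩ := exists_lintegral_expTail_le (d := d) M
  have hφ : Measurable φ := φ.continuous.measurable
  have hm : Measurable (Function.uncurry fun τ ξ => rhs (g τ) ξ * φ ξ) :=
    (measurable_rhs hg).mul (hφ.comp measurable_snd)
  refine ⟨hm.aestronglyMeasurable, ?_⟩
  rw [HasFiniteIntegral, lintegral_prod _ hm.enorm.aemeasurable]
  have h1 : ∀ τ ∈ Ioc 0 T, ∫⁻ ξ, ‖rhs (g τ) ξ * φ ξ‖ₑ ≤ C * (M + K) := fun τ hτ => by
    have hgτ := measurable_cslice hg τ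
    have hw := measurable_wt 2 hgτ.enorm
    have h2 : ∀ ξ, ‖rhs (g τ) ξ * φ ξ‖ₑ ≤ C * (wt 2 (fun ξ => ‖g τ ξ‖ₑ) ξ +
        expTail (wt 2 fun ξ => ‖g τ ξ‖ₑ) ξ) := fun ξ => by
      have h3 : ‖rhs (g τ) ξ‖ₑ ≤ rho ξ ^ (2 : ℝ) * (wt 2 (fun ξ => ‖g τ ξ‖ₑ) ξ +
          expTail (wt 2 fun ξ => ‖g τ ξ‖ₑ) ξ) := by
        rw [rhs, ← cwt_cwt, mul_add]
        refine (enorm_add_le _ _).trans (add_le_add ?_ ?_)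
        · rw [enorm_cwt, wt, enorm_cwt]
        · rw [enorm_cwt, wt]; gcongr; exact enorm_cexpTail_cwt_le hgτ ξ
      rw [enorm_mul]
      calc ‖rhs (g τ) ξ‖ₑ * ‖φ ξ‖ₑ ≤ rho ξ ^ (2 : ℝ) * (wt 2 (fun ξ => ‖g τ ξ‖ₑ) ξ +
          expTail (wt 2 fun ξ => ‖g τ ξ‖ₑ) ξ) * ‖φ ξ‖ₑ := by gcongr
        _ = (rho ξ ^ (2 : ℝ) * ‖φ ξ‖ₑ) * (wt 2 (fun ξ => ‖g τ ξ‖ₑ) ξ +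
          expTail (wt 2 fun ξ => ‖g τ ξ‖ₑ) ξ) := by ring
        _ ≤ _ := by gcongr; exact hC ξ
    refine (lintegral_mono h2).trans ?_
    rw [lintegral_const_mul' _ _ (by simp), lintegral_add_left hw]
    gcongr
    · exact hM τ hτ
    · exact hK _ hw (hM τ hτ)
  simp only [Function.uncurry]
  refine (setLIntegral_mono' measurableSet_Ioc h1).trans_lt ?_
  simp [ENNReal.mul_lt_top_iff, ENNReal.add_lt_top]

lemma integrable_cwt {g : E d → ℂ} (hg : Measurable g) {M : ℝ≥0}
    (h : ∫⁻ ξ, wt 2 (fun ξ => ‖g ξ‖ₑ) ξ ≤ M) : Integrable (cwt g) := by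
  refine ⟨(measurable_cwt hg).aestronglyMeasurable, ?_⟩
  rw [HasFiniteIntegral]
  simp_rw [enorm_cwt]
  exact h.trans_lt (by simp)

lemma lintegral_wt_congr {g g' : E d → ℂ} (h : g =ᵐ[volume] g') (s : ℝ) :
    ∫⁻ ξ, wt s (fun ξ => ‖g ξ‖ₑ) ξ = ∫⁻ ξ, wt s (fun ξ => ‖g' ξ‖ₑ) ξ := by
  refine lintegral_congr_ae ?_
  filter_upwards [h] with ξ hξ
  simp only [wt, hξ]

/-- The Fourier transform of a solution solves the integrated equation frequency by frequency. -/
theorem IsSolution.exists_fourierSol (hd : 1 ≤ d) {h₀ : L2 d} {h : ℝ → L2 d}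
    (hs : IsSolution h₀ h) :
    ∃ g, FourierSol (ghat h₀) g ∧ ∀ t, 0 ≤ t → g t =ᵐ[volume] ghat (h t) := by
  obtain ⟨γ, hγm, hγ⟩ := exists_measurable_ghat hs.continuousOn
  obtain ⟨u, hu, heq⟩ := hs.equation
  have hle : ∀ (s t : ℝ), 0 ≤ t → ∫⁻ ξ, wt s (fun ξ => ‖γ t ξ‖ₑ) ξ ≤ sNorm s (h t) :=
    fun s t ht => by
      rw [lintegral_wt_congr (hγ t ht)]
      refine le_trans ?_ (lintegral_wt_ghat_le hd s (h t))
      exact le_mul_of_one_le_left' (by norm_num)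
  have hb : ∀ T, 0 ≤ T → ∃ M : ℝ≥0, ∀ t ∈ Icc 0 T, ∫⁻ ξ, wt 2 (fun ξ => ‖γ t ξ‖ₑ) ξ ≤ M :=
    fun T hT => by
      obtain ⟨M, hM⟩ := hs.locally_bounded T hT
      exact ⟨M, fun t ht => (hle 2 t ht.1).trans (hM t ht)⟩
  -- the solution is redefined through the integrated equation
  obtain ⟨g, hg⟩ : ∃ g : ℝ → E d → ℂ, g = fun t ξ => ghat h₀ ξ - ∫ r in Ioc 0 t, rhs (γ r) ξ :=
    ⟨_, rfl⟩
  have hgm : Measurable (Function.uncurry g) := by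
    rw [hg]
    refine ((measurable_ghat h₀).comp measurable_snd).sub ?_
    refine measurable_setIntegral_Ioc (α := ℝ × E d) (F := fun q τ => rhs (γ τ) q.2) ?_
      measurable_fst
    exact (measurable_rhs hγm).comp
      (by fun_prop : Measurable fun p : (ℝ × E d) × ℝ => (p.2, p.1.2))
  have hgγ : ∀ t, 0 ≤ t → g t =ᵐ[volume] γ t := fun t ht => by
    obtain ⟨M, hM⟩ := hb t ht
    have hF := fun φ : 𝓢(E d, ℂ) =>
      integrable_rhs_mul hγm (fun τ hτ => hM τ (Ioc_subset_Icc_self hτ)) φ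
    have hi : ∀ φ : 𝓢(E d, ℂ), Integrable fun ξ => (∫ r in Ioc 0 t, rhs (γ r) ξ) * φ ξ :=
      fun φ => by
        refine (hF φ).integral_prod_right.congr (Filter.Eventually.of_forall fun ξ => ?_)
        simp only [Function.uncurry]
        rw [integral_mul_const]
    have hq := ae_eq_zero_of_integral_psi (q := fun ξ => γ t ξ - g t ξ) (fun φ => ?_) (fun φ => ?_)
    · filter_upwards [hq] with ξ hξ using (sub_eq_zero.1 hξ).symm
    · refine (((integrable_ghat_mul (hγ t ht) φ).sub
        (integrable_ghat_mul (Filter.EventuallyEq.refl _ (ghat h₀)) φ)).add (hi φ)).congr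
        (Filter.Eventually.of_forall fun ξ => ?_)
      simp only [Pi.add_apply, Pi.sub_apply, hg]; ring
    · have e : ∀ ξ, (γ t ξ - g t ξ) * psi φ ξ = γ t ξ * psi φ ξ - ghat h₀ ξ * psi φ ξ +
          (∫ r in Ioc 0 t, rhs (γ r) ξ) * psi φ ξ := fun ξ => by rw [hg]; ring
      have i1 := integrable_ghat_mul (hγ t ht) (psi φ)
      have i2 := integrable_ghat_mul (Filter.EventuallyEq.refl _ (ghat h₀)) (psi φ)
      have i12 : Integrable fun ξ => γ t ξ * psi φ ξ - ghat h₀ ξ * psi φ ξ := i1.sub i2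
      simp_rw [e]
      rw [integral_add i12 (hi (psi φ)), integral_sub i1 i2,
        ← integral_L2_mul_of_ae (hγ t ht), ← integral_L2_mul_of_ae (Filter.EventuallyEq.refl _ _),
        ((heq φ t ht).2), intervalIntegral.integral_of_le ht]
      simp_rw [← integral_mul_const]
      rw [← integral_integral_swap (hF (psi φ))]
      have e2 : ∀ τ ∈ Ioc 0 t, ∫ ξ, rhs (γ τ) ξ * psi φ ξ =
          -((∫ x, Real.exp (-(u τ x)) * Laplacian.laplacian φ x : ℝ) : ℂ) := fun τ hτ => by
        have hgτ := measurable_cslice hγm τ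
        have hci := integrable_cwt hgτ (hM τ (Ioc_subset_Icc_self hτ))
        rw [integral_exp_mul_laplacian hgτ hci (u τ)
          ((isLaplacian_iff (hγ τ hτ.1.le) hci (u τ)).1 (hu τ hτ.1.le)), neg_neg]
        rfl
      rw [setIntegral_congr_fun measurableSet_Ioc e2, integral_neg, integral_complex_ofReal]
      push_cast
      ring
  have hsame := fun (s t : ℝ) (ht : 0 ≤ t) => lintegral_wt_congr (hgγ t ht) s
  refine ⟨g, ⟨hgm, fun T hT => ?_, fun T hT => ?_, ?_⟩, fun t ht => (hgγ t ht).trans (hγ t ht)⟩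
  · obtain ⟨M, hM⟩ := hb T hT
    exact ⟨M, fun t ht => by rw [hsame 2 t ht.1]; exact hM t ht⟩
  · refine lt_of_le_of_lt ?_ (hs.locally_integrable T hT)
    refine (setLIntegral_mono' measurableSet_Ioc fun τ hτ => ?_).trans
      (lintegral_mono_set Ioc_subset_Icc_self)
    rw [hsame 6 τ hτ.1.le]
    exact hle 6 τ hτ.1.le
  · have h1 : ∀ᵐ τ ∂volume.restrict (Ioi (0 : ℝ)), ∀ᵐ ξ, rhs (γ τ) ξ = rhs (g τ) ξ := by
      filter_upwards [ae_restrict_mem measurableSet_Ioi] with τ hτ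
      exact rhs_congr (hgγ τ (le_of_lt hτ)).symm
    have hms : MeasurableSet {p : ℝ × E d | rhs (γ p.1) p.2 = rhs (g p.1) p.2} :=
      measurableSet_eq_fun (measurable_rhs hγm) (measurable_rhs hgm)
    filter_upwards [(Measure.ae_ae_comm hms).1 h1] with ξ h2 t ht
    have h3 : ∀ᵐ τ ∂volume.restrict (Ioc 0 t), rhs (γ τ) ξ = rhs (g τ) ξ :=
      ae_restrict_of_ae_restrict_of_subset (fun x hx => hx.1) h2
    have h4 := integral_congr_ae h3
    rw [hg] at h4 ⊢
    simp only at h4 ⊢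
    rw [h4]
    rfl

end

section

/-! ### Construction of the solution -/

open scoped FourierTransform

variable {d : ℕ}

lemma integral_mul_psi_conj {g : E d → ℂ} (hg : ∀ᵐ ξ, g (-ξ) = star (g ξ)) (φ : 𝓢(E d, ℝ)) :
    star (∫ ξ, g ξ * psi φ ξ) = ∫ ξ, g ξ * psi φ ξ := by
  rw [RCLike.star_def, ← integral_conj,
    ← integral_neg_eq_self (fun ξ => g ξ * psi φ ξ) (volume : Measure (E d))]
  refine integral_congr_ae ?_
  filter_upwards [hg] with ξ hξ
  rw [hξ, psi_neg]
  simp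

/-- The Fourier transform of a real function is Hermitian. -/
lemma ghat_neg (h : L2 d) : ∀ᵐ ξ, ghat h (-ξ) = star (ghat h ξ) := by
  have hi : ∀ φ : 𝓢(E d, ℂ), Integrable fun ξ => ghat h ξ * φ ξ := fun φ =>
    integrable_ghat_mul (Filter.EventuallyEq.refl _ _) φ
  have hm : MemLp (fun ξ => star (ghat h (-ξ))) 2 (volume : Measure (E d)) := by
    have h1 : MemLp (ghat h) 2 (volume : Measure (E d)) := Lp.memLp _
    have h2 := h1.comp_measurePreserving (Measure.measurePreserving_neg (volume : Measure (E d)))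
    exact h2.star
  have hq := ae_eq_zero_of_integral_psi (q := fun ξ => ghat h ξ - star (ghat h (-ξ)))
    (fun φ => by
      refine ((hi φ).sub (hm.integrable_mul (φ.memLp 2 volume))).congr
        (Filter.Eventually.of_forall fun ξ => ?_)
      simp [sub_mul])
    (fun φ => by
      simp_rw [sub_mul]
      have hi2 : Integrable fun ξ => star (ghat h (-ξ)) * psi φ ξ :=
        hm.integrable_mul ((psi φ).memLp 2 volume)
      rw [integral_sub (hi _) hi2]
      have e : ∫ ξ, star (ghat h (-ξ)) * psi φ ξ = star (∫ ξ, ghat h ξ * psi φ ξ) := by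
        rw [← integral_neg_eq_self
          (fun ξ => star (ghat h (-ξ)) * psi φ ξ) (volume : Measure (E d)), RCLike.star_def,
          ← integral_conj]
        refine integral_congr_ae (Filter.Eventually.of_forall fun ξ => ?_)
        simp [psi_neg]
      rw [e, ← integral_L2_mul_of_ae (Filter.EventuallyEq.refl _ (ghat h))]
      simp)
  filter_upwards [hq] with ξ hξ
  rw [sub_eq_zero.1 hξ, star_star]

/-- A square integrable function with Hermitian Fourier transform is real. -/
lemma toComplex_re {F : Lp ℂ 2 (volume : Measure (E d))}
    (hF : ∀ᵐ ξ, (𝓕 F : Lp ℂ 2 (volume : Measure (E d))) (-ξ) =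
      star ((𝓕 F : Lp ℂ 2 (volume : Measure (E d))) ξ)) :
    toComplex (Complex.reCLM.compLp F) = F := by
  have hloc : LocallyIntegrable (fun x => (F x).im) (volume : Measure (E d)) :=
    ((Lp.memLp F).im).locallyIntegrable (by norm_num)
  have him : ∀ᵐ x, (F x).im = 0 := by
    refine ae_eq_zero_of_integral_contDiff_smul_eq_zero hloc fun χ hχ hc => ?_
    obtain ⟨φ, hφ⟩ : ∃ φ : 𝓢(E d, ℝ), φ = hc.toSchwartzMap hχ := ⟨_, rfl⟩
    have hφx : ∀ x, χ x = φ x := fun x => by rw [hφ]; rfl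
    have h1 := integral_mul_psi_conj hF φ
    rw [psi, ← integral_mul_schwartz] at h1
    have hi : Integrable fun x => F x * toC φ x := (Lp.memLp F).integrable_mul ((toC φ).memLp 2 volume)
    have h2 := congrArg Complex.im h1
    simp only [RCLike.star_def, Complex.conj_im] at h2
    have h3 : (∫ x, F x * toC φ x).im = 0 := by linarith
    have h4 := integral_im hi
    simp only [RCLike.im_to_complex] at h4
    rw [h3] at h4
    rw [← h4]
    refine integral_congr_ae (Filter.Eventually.of_forall fun x => ?_)
    simp [toC_apply, hφx, mul_comm]
  refine Lp.ext ?_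
  filter_upwards [coeFn_toComplex (Complex.reCLM.compLp F), Complex.reCLM.coeFn_compLp F, him]
    with x h1 h2 h3
  rw [h1, h2]
  apply Complex.ext <;> simp [h3]

lemma toComplex_injective : Function.Injective (toComplex : L2 d → _) := fun f g hfg => by
  refine Lp.ext ?_
  filter_upwards [coeFn_toComplex f, coeFn_toComplex g] with x h1 h2
  rw [hfg, h2] at h1
  exact_mod_cast h1.symm

lemma eq_of_ghat_ae_eq {f g : L2 d} (h : ghat f =ᵐ[volume] ghat g) : f = g := by
  refine toComplex_injective ?_
  have h1 : (𝓕 (toComplex f) : Lp ℂ 2 (volume : Measure (E d))) = 𝓕 (toComplex g) := Lp.ext h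
  have h2 := congrArg (fun F : Lp ℂ 2 (volume : Measure (E d)) => 𝓕⁻ F) h1
  simpa only [FourierTransform.fourierInv_fourier_eq] using h2

lemma fourierInv_herm {f f' : E d → ℂ} (hf : Herm f') (h : f =ᵐ[volume] f') (x : E d) :
    star (𝓕⁻ f x) = 𝓕⁻ f x := by
  rw [Real.fourierInv_congr_ae h, Real.fourierInv_eq', RCLike.star_def, ← integral_conj,
    ← integral_neg_eq_self _ (volume : Measure (E d))]
  refine integral_congr_ae (Filter.Eventually.of_forall fun ξ => ?_)
  simp [hf ξ, ← Complex.exp_conj, Complex.conj_ofNat]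

/-- The bounded continuous function `-Re 𝓕⁻ f`. -/
def lapl {f : E d → ℂ} (hf : Integrable f) : E d →ᵇ ℝ :=
  BoundedContinuousFunction.ofNormedAddCommGroup (fun x => -(𝓕⁻ f x).re)
    (Complex.continuous_re.comp (fourierInv_continuous hf)).neg (∫ ξ, ‖f ξ‖) fun x => by
      rw [norm_neg]
      exact (Complex.abs_re_le_norm _).trans
        (VectorFourier.norm_fourierIntegral_le_integral_norm _ _ _ _ _)

lemma lapl_apply {f f' : E d → ℂ} (hi : Integrable f) (hf : Herm f') (h : f =ᵐ[volume] f')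
    (x : E d) : (lapl hi x : ℂ) = -𝓕⁻ f x := by
  have h1 := fourierInv_herm hf h x
  have h2 : ((𝓕⁻ f x).re : ℂ) = 𝓕⁻ f x := Complex.conj_eq_iff_re.1 h1
  simp only [lapl, BoundedContinuousFunction.coe_ofNormedAddCommGroup]
  push_cast
  rw [h2]

/-- Existence of the solution for small data, together with the majorant of its Fourier transform. -/
theorem exists_isSolution (hd : 1 ≤ d) (h₀ : L2 d)
    (h1 : ∫⁻ ξ, wt 2 (fun ξ => ‖ghat h₀ ξ‖ₑ) ξ ≤ 1 / 16)
    (h2 : f2e (∫⁻ ξ, wt 2 (fun ξ => ‖ghat h₀ ξ‖ₑ) ξ) ≤ 1 / 2) :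
    ∃ h : ℝ → L2 d, IsSolution h₀ h ∧ ∃ g₀ : E d → ℂ, Measurable g₀ ∧ g₀ =ᵐ[volume] ghat h₀ ∧
      ∀ t, 0 ≤ t → ∀ᵐ ξ, ‖ghat (h t) ξ‖ₑ ≤ majLim (fun ξ => ‖g₀ ξ‖ₑ) t ξ := by
  -- a representative of the Fourier transform that is Hermitian at every frequency
  obtain ⟨g₀, hg₀⟩ : ∃ g₀ : E d → ℂ, g₀ = fun ξ => (ghat h₀ ξ + star (ghat h₀ (-ξ))) / 2 := ⟨_, rfl⟩
  have hm₀ : Measurable g₀ := by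
    have := measurable_ghat h₀
    have h3 : Measurable fun ξ => star (ghat h₀ (-ξ)) :=
      continuous_star.measurable.comp (this.comp measurable_neg)
    rw [hg₀]
    exact (this.add h3).div_const 2
  have hH : Herm g₀ := fun ξ => by
    rw [hg₀]; simp [add_comm]
  have hae : g₀ =ᵐ[volume] ghat h₀ := by
    filter_upwards [ghat_neg h₀] with ξ hξ
    rw [hg₀]; simp only; rw [hξ, star_star]; ring
  rw [← lintegral_wt_congr hae] at h1 h2
  have h2' : f2e (∫⁻ ξ, wt 2 (fun ξ => ‖g₀ ξ‖ₑ) ξ) < 1 := h2.trans_lt (by simp)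
  have h1t : ∫⁻ ξ, wt 2 (fun ξ => ‖g₀ ξ‖ₑ) ξ ≠ ⊤ := ne_top_of_le_ne_top (by simp) h1
  obtain ⟨g, hgm, hgle, hgeq, hgH⟩ := exists_mild hd hm₀ h1t h2' hH
  obtain ⟨hsol, hcont⟩ := fourierSol_of_mild hd hm₀ h1t h2' hgm hgle hgeq
  have hsq : ∫⁻ ξ, ‖g₀ ξ‖ₑ ^ (2 : ℝ) ≠ ⊤ := by
    have e : ∫⁻ ξ, ‖g₀ ξ‖ₑ ^ (2 : ℝ) = ∫⁻ ξ, ‖ghat h₀ ξ‖ₑ ^ (2 : ℝ) := by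
      refine lintegral_congr_ae ?_
      filter_upwards [hae] with ξ hξ
      rw [hξ]
    rw [e, ghat, lintegral_enorm_sq]
    exact ENNReal.rpow_ne_top_of_nonneg (by norm_num) enorm_ne_top
  have hmem : ∀ t : ℝ, MemLp (g (max t 0)) 2 (volume : Measure (E d)) := fun t => by
    obtain ⟨D, -, hDi, hD⟩ := exists_sq_majLim_le hd hm₀.enorm h1 h2 hsq (le_max_right t 0)
    refine ⟨(measurable_cslice hgm _).aestronglyMeasurable, ?_⟩
    rw [eLpNorm_lt_top_iff_lintegral_rpow_enorm_lt_top (by simp) (by simp), ENNReal.toReal_ofNat]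
    refine (lintegral_mono_ae ?_).trans_lt (lt_top_iff_ne_top.2 hDi)
    filter_upwards [hD] with ξ hξ
    exact (ENNReal.rpow_le_rpow (hgle _ ξ) (by norm_num)).trans (hξ _ ⟨le_max_right t 0, le_rfl⟩)
  obtain ⟨F, hF⟩ : ∃ F : ℝ → Lp ℂ 2 (volume : Measure (E d)), F = fun t => (hmem t).toLp _ :=
    ⟨_, rfl⟩
  have hFae : ∀ t, 0 ≤ t → F t =ᵐ[volume] g t := fun t ht => by
    have := (hmem t).coeFn_toLp
    rw [hF]
    simpa only [max_eq_left ht] using this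
  have hFH : ∀ t, 0 ≤ t → ∀ᵐ ξ, F t (-ξ) = star (F t ξ) := fun t ht => by
    obtain ⟨g', hg', hgg'⟩ := hgH t ht
    have h3 := (hFae t ht).trans hgg'
    have h4 := (Measure.measurePreserving_neg
      (volume : Measure (E d))).quasiMeasurePreserving.ae_eq_comp h3
    filter_upwards [h3, h4] with ξ h5 h6
    simp only [Function.comp_apply] at h6
    rw [h6, h5, hg' ξ]
  obtain ⟨h, hh⟩ : ∃ h : ℝ → L2 d, h = fun t => Complex.reCLM.compLp (𝓕⁻ (F t)) := ⟨_, rfl⟩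
  have hhat : ∀ t, 0 ≤ t → g t =ᵐ[volume] ghat (h t) := fun t ht => by
    have h3 : toComplex (h t) = 𝓕⁻ (F t) := by
      rw [hh]
      refine toComplex_re ?_
      rw [FourierTransform.fourier_fourierInv_eq]
      exact hFH t ht
    rw [ghat, h3, FourierTransform.fourier_fourierInv_eq]
    exact (hFae t ht).symm
  have hci : ∀ t, 0 ≤ t → Integrable (cwt (g t)) := fun t ht => by
    obtain ⟨M, hM⟩ := hsol.bounded t ht
    exact integrable_cwt (measurable_cslice hgm t) (hM t ⟨ht, le_rfl⟩)
  obtain ⟨u, hu⟩ : ∃ u : ℝ → (E d →ᵇ ℝ), ∀ t, 0 ≤ t → ∀ x, (u t x : ℂ) = -𝓕⁻ (cwt (g t)) x := by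
    classical
    refine ⟨fun t => if ht : 0 ≤ t then lapl (hci t ht) else 0, fun t ht x => ?_⟩
    obtain ⟨g', hg', hgg'⟩ := hgH t ht
    beta_reduce
    rw [dif_pos ht]
    refine lapl_apply (hci t ht) hg'.cwt ?_ x
    filter_upwards [hgg'] with ξ hξ
    simp only [cwt, hξ]
  have hs : ∀ (s t : ℝ), 0 ≤ t →
      sNorm s (h t) = normConst d * ∫⁻ ξ, wt s (fun ξ => ‖g t ξ‖ₑ) ξ := fun s t ht => by
    rw [sNorm_eq, lintegral_wt_congr (hhat t ht)]
  refine ⟨h, ⟨?_, ?_, fun T hT => ?_, fun T hT => ?_, u, fun t ht => ?_, fun φ t ht => ?_⟩, g₀, hm₀,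
    hae, fun t ht => ?_⟩
  · -- continuity in `L²`
    have hFc : ContinuousOn F (Ici 0) := fun t₀ ht₀ => by
      have h3 := tendsto_lintegral_sub_sq hd hm₀.enorm h1 h2 hsq hgm hgle hcont ht₀
      rw [ContinuousWithinAt, tendsto_iff_edist_tendsto_0]
      have h4 := ((ENNReal.continuous_rpow_const (y := 1 / 2)).tendsto 0).comp h3
      simp only [Function.comp_def] at h4
      norm_num at h4
      refine h4.congr' ?_
      filter_upwards [self_mem_nhdsWithin] with t ht
      have e : ∫⁻ ξ, ‖g t ξ - g t₀ ξ‖ₑ ^ (2 : ℝ) = ‖F t - F t₀‖ₑ ^ (2 : ℝ) := by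
        rw [← lintegral_enorm_sq]
        refine lintegral_congr_ae ?_
        filter_upwards [Lp.coeFn_sub (F t) (F t₀), hFae t ht, hFae t₀ ht₀] with ξ a1 a2 a3
        rw [a1, Pi.sub_apply, a2, a3]
      rw [edist_eq_enorm_sub]
      have e' : ∫⁻ ξ, ‖g t ξ - g t₀ ξ‖ₑ ^ 2 = ‖F t - F t₀‖ₑ ^ (2 : ℝ) := by
        rw [← e]; norm_num
      rw [e', ← ENNReal.rpow_mul]
      norm_num
    rw [hh]
    exact (ContinuousLinearMap.compLpL 2 volume Complex.reCLM).continuous.comp_continuousOn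
      ((FourierTransform.continuous_fourierInv).comp_continuousOn hFc)
  · refine eq_of_ghat_ae_eq ((hhat 0 le_rfl).symm.trans (Filter.EventuallyEq.trans ?_ hae))
    filter_upwards [hsol.eq] with ξ hξ
    rw [hξ 0 le_rfl]; simp
  · obtain ⟨M, hM⟩ := hsol.bounded T hT
    refine ⟨(normConst d * M).toNNReal, fun t ht => ?_⟩
    rw [ENNReal.coe_toNNReal (ENNReal.mul_ne_top (normConst_ne_top d) (by simp)), hs 2 t ht.1]
    gcongr
    exact hM t ht
  · rw [restrict_Ioc_eq_restrict_Icc.symm]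
    have e : ∫⁻ t in Ioc 0 T, sNorm 6 (h t) =
        ∫⁻ t in Ioc 0 T, normConst d * ∫⁻ ξ, wt 6 (fun ξ => ‖g t ξ‖ₑ) ξ :=
      setLIntegral_congr_fun measurableSet_Ioc fun t ht => hs 6 t ht.1.le
    rw [e, lintegral_const_mul' _ _ (normConst_ne_top d)]
    exact ENNReal.mul_lt_top (lt_top_iff_ne_top.2 (normConst_ne_top d)) (hsol.integrable T hT)
  · exact (isLaplacian_iff (hhat t ht) (hci t ht) (u t)).2 (hu t ht)
  · -- the equation
    obtain ⟨M, hM⟩ := hsol.bounded t ht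
    have hF := integrable_rhs_mul hgm (fun τ hτ => hM τ (Ioc_subset_Icc_self hτ)) (psi φ)
    have e2 : ∀ τ ∈ Ioc 0 t, ∫ ξ, rhs (g τ) ξ * psi φ ξ =
        -((∫ x, Real.exp (-(u τ x)) * Laplacian.laplacian φ x : ℝ) : ℂ) := fun τ hτ => by
      rw [integral_exp_mul_laplacian (measurable_cslice hgm τ) (hci τ hτ.1.le) (u τ)
        (hu τ hτ.1.le), neg_neg]
      rfl
    have hi : Integrable (fun ξ => (∫ r in Ioc 0 t, rhs (g r) ξ) * psi φ ξ) := by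
      refine hF.integral_prod_right.congr (Filter.Eventually.of_forall fun ξ => ?_)
      simp only [Function.uncurry]
      rw [integral_mul_const]
    have hint : IntegrableOn (fun τ => ((∫ x, Real.exp (-(u τ x)) * Laplacian.laplacian φ x : ℝ) : ℂ))
        (Ioc 0 t) := by
      refine hF.integral_prod_left.neg.congr ?_
      filter_upwards [ae_restrict_mem measurableSet_Ioc] with τ hτ
      simp only [Function.uncurry, Pi.neg_apply]
      rw [e2 τ hτ, neg_neg]
    refine ⟨?_, ?_⟩
    · rw [intervalIntegrable_iff_integrableOn_Ioc_of_le ht]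
      have := hint.re
      exact this
    · rw [intervalIntegral.integral_of_le ht]
      have i1 := integrable_ghat_mul hae (psi φ)
      have e3 : ((∫ x, h t x * φ x : ℝ) : ℂ) = ((∫ x, h₀ x * φ x : ℝ) : ℂ) +
          ((∫ τ in Ioc 0 t, ∫ x, Real.exp (-(u τ x)) * Laplacian.laplacian φ x : ℝ) : ℂ) := by
        rw [integral_L2_mul_of_ae (hhat t ht), integral_L2_mul_of_ae hae, ← integral_complex_ofReal]
        have e4 : ∫ τ in Ioc 0 t, ((∫ x, Real.exp (-(u τ x)) * Laplacian.laplacian φ x : ℝ) : ℂ) =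
            -∫ ξ, (∫ r in Ioc 0 t, rhs (g r) ξ) * psi φ ξ := by
          simp_rw [← integral_mul_const]
          rw [← integral_integral_swap hF, setIntegral_congr_fun measurableSet_Ioc e2, integral_neg,
            neg_neg]
        rw [e4, ← sub_eq_add_neg, ← integral_sub i1 hi]
        refine integral_congr_ae ?_
        filter_upwards [hsol.eq] with ξ hξ
        rw [hξ t ht, sub_mul]
        rfl
      exact_mod_cast e3
  · filter_upwards [hhat t ht] with ξ hξ
    rw [← hξ]
    exact hgle t ξ

end

section

/-! ### Well-posedness and uniform bounds -/

variable {d : ℕ}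

/-- The smallness used throughout, with `f2e` the function `f₂` on `[0, ∞]`: it follows from `‖h₀‖_2 < y_*`, and it is inherited by the solution
at later times. -/
def Small (h₀ : L2 d) : Prop :=
  ∫⁻ ξ, wt 2 (fun ξ => ‖ghat h₀ ξ‖ₑ) ξ ≤ 1 / 16 ∧
    f2e (∫⁻ ξ, wt 2 (fun ξ => ‖ghat h₀ ξ‖ₑ) ξ) ≤ 1 / 2

lemma f2e_ofReal {y : ℝ} (hy : 0 ≤ y) :
    Summable (fun j : ℕ => ((j : ℝ) + 2) ^ 3 / ((j + 1).factorial : ℝ) * y ^ (j + 1)) ∧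
      f2e (ENNReal.ofReal y) = ENNReal.ofReal (f2 y) := by
  have e : ∀ j : ℕ, ((j : ℝ≥0∞) + 2) ^ 3 * ((j + 1).factorial : ℝ≥0∞)⁻¹ *
      ENNReal.ofReal y ^ (j + 1) =
      ENNReal.ofReal (((j : ℝ) + 2) ^ 3 / ((j + 1).factorial : ℝ) * y ^ (j + 1)) := fun j => by
    rw [ENNReal.ofReal_mul (by positivity), ENNReal.ofReal_div_of_pos (by positivity),
      ENNReal.ofReal_pow (by positivity), ENNReal.ofReal_pow hy, ENNReal.ofReal_add (by positivity)
      (by norm_num), ENNReal.ofReal_natCast, ENNReal.ofReal_natCast, ENNReal.ofReal_ofNat,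
      div_eq_mul_inv]
  have hpos : ∀ j : ℕ, 0 ≤ ((j : ℝ) + 2) ^ 3 / ((j + 1).factorial : ℝ) * y ^ (j + 1) := fun j => by
    positivity
  have hs : Summable (fun j : ℕ => ((j : ℝ) + 2) ^ 3 / ((j + 1).factorial : ℝ) * y ^ (j + 1)) := by
    have h1 := f2e_ne_top (y := ENNReal.ofReal y) ENNReal.ofReal_ne_top
    refine (ENNReal.summable_toReal h1).congr fun j => ?_
    rw [e, ENNReal.toReal_ofReal (hpos j)]
  refine ⟨hs, ?_⟩
  rw [f2, ENNReal.ofReal_tsum_of_nonneg hpos hs, f2e]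
  exact tsum_congr e

lemma f2_lt_f2 {x y : ℝ} (hx : 0 ≤ x) (hxy : x < y) : f2 x < f2 y := by
  have hy := hx.trans hxy.le
  refine Summable.tsum_lt_tsum (i := 0) (fun j => ?_) ?_ (f2e_ofReal hx).1 (f2e_ofReal hy).1
  · gcongr
  · simpa using hxy

/-- The first term of the series shows that `y_* ≤ 1/8`. -/
lemma eight_mul_le_f2 {y : ℝ} (hy : 0 ≤ y) : 8 * y ≤ f2 y := by
  have h := (f2e_ofReal hy).1.le_tsum 0 fun j _ => by positivity
  norm_num at h
  exact h

lemma f2e_half_le {y z : ℝ≥0∞} (h : 2 * y ≤ z) : 2 * f2e y ≤ f2e z := by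
  unfold f2e
  rw [← ENNReal.tsum_mul_left]
  refine ENNReal.tsum_le_tsum fun n => ?_
  calc 2 * (((n : ℝ≥0∞) + 2) ^ 3 * ((n + 1).factorial : ℝ≥0∞)⁻¹ * y ^ (n + 1))
      = ((n : ℝ≥0∞) + 2) ^ 3 * ((n + 1).factorial : ℝ≥0∞)⁻¹ * (2 * y ^ (n + 1)) := by ring
    _ ≤ ((n : ℝ≥0∞) + 2) ^ 3 * ((n + 1).factorial : ℝ≥0∞)⁻¹ * (2 * y) ^ (n + 1) := by
        gcongr
        rw [mul_pow]
        gcongr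
        exact le_self_pow₀ (by norm_num) (by omega)
    _ ≤ _ := by gcongr

/-- The data below the threshold `y_*` of the theorem are small; the factor `(2π)^(d/2) ≥ 2` between
the two normalisations leaves room in all later estimates. -/
lemma small_of_sNorm_lt (hd : 1 ≤ d) {yStar : ℝ≥0} (hyStar : f2 yStar = 1) {h₀ : L2 d}
    (h : sNorm 2 h₀ < yStar) :
    Small h₀ ∧ f2 (sNorm 2 h₀).toReal < 1 ∧
      f2e (∫⁻ ξ, wt 2 (fun ξ => ‖ghat h₀ ξ‖ₑ) ξ) ≤ ENNReal.ofReal (f2 (sNorm 2 h₀).toReal) := by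
  have hfin : sNorm 2 h₀ ≠ ⊤ := (h.trans_le le_top).ne
  have h2 := lintegral_wt_ghat_le hd 2 h₀
  have hlt : (sNorm 2 h₀).toReal < yStar := by
    have := (ENNReal.toReal_lt_toReal hfin (by simp)).2 h
    simpa using this
  have hf : f2 (sNorm 2 h₀).toReal < 1 := hyStar ▸ f2_lt_f2 ENNReal.toReal_nonneg hlt
  have he := (f2e_ofReal (y := (sNorm 2 h₀).toReal) ENNReal.toReal_nonneg).2
  rw [ENNReal.ofReal_toReal hfin] at he
  have h3 : f2e (sNorm 2 h₀) ≤ 1 := by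
    rw [he]
    exact (ENNReal.ofReal_le_ofReal hf.le).trans (by simp)
  have hy8 : (sNorm 2 h₀).toReal ≤ 1 / 8 := by
    have := eight_mul_le_f2 (y := (sNorm 2 h₀).toReal) ENNReal.toReal_nonneg
    linarith
  refine ⟨⟨?_, ?_⟩, hf, ?_⟩
  · have h4 : sNorm 2 h₀ ≤ 1 / 8 := by
      rw [← ENNReal.toReal_le_toReal hfin (by simp)]
      simpa using hy8
    rw [ENNReal.le_div_iff_mul_le (by simp) (by simp)]
    rw [ENNReal.le_div_iff_mul_le (by simp) (by simp)] at h4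
    calc (∫⁻ ξ, wt 2 (fun ξ => ‖ghat h₀ ξ‖ₑ) ξ) * 16
        = 2 * (∫⁻ ξ, wt 2 (fun ξ => ‖ghat h₀ ξ‖ₑ) ξ) * 8 := by ring
      _ ≤ sNorm 2 h₀ * 8 := by gcongr
      _ ≤ 1 := h4
  · rw [ENNReal.le_div_iff_mul_le (by simp) (by simp), mul_comm]
    exact (f2e_half_le h2).trans h3
  · rw [← he]
    exact f2e_mono (le_trans (le_mul_of_one_le_left' (by norm_num)) h2)

lemma majLim_wt_two_le (hd : 1 ≤ d) {h₀ : L2 d} (hs : Small h₀) {g₀ : E d → ℂ}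
    (hm : Measurable g₀) (hg : g₀ =ᵐ[volume] ghat h₀) {F : ℝ≥0∞}
    (hF : f2e (∫⁻ ξ, wt 2 (fun ξ => ‖ghat h₀ ξ‖ₑ) ξ) ≤ F) (hF1 : F < 1) {t : ℝ} (ht : 0 ≤ t) :
    (∫⁻ ξ, wt 2 (majLim (fun ξ => ‖g₀ ξ‖ₑ) t) ξ) +
      (1 - F) * ∫⁻ r in Ioc 0 t, ∫⁻ ξ, wt 6 (majLim (fun ξ => ‖g₀ ξ‖ₑ) r) ξ ≤
        ∫⁻ ξ, wt 2 (fun ξ => ‖ghat h₀ ξ‖ₑ) ξ := by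
  have h1 := hs.1
  rw [← lintegral_wt_congr hg] at hF h1 ⊢
  exact lintegral_wt_two_majLim_le hd hm.enorm (ne_top_of_le_ne_top (by simp) h1) hF hF1 ht

/-- Existence and uniqueness for small data. Uniqueness compares an arbitrary solution with the
constructed one, which is small in the critical norm at all times. -/
theorem exists_unique_solution (hd : 1 ≤ d) {h₀ : L2 d} (hs : Small h₀) :
    ∃ h : ℝ → L2 d, IsSolution h₀ h ∧
      (∀ h' : ℝ → L2 d, IsSolution h₀ h' → ∀ t : ℝ, 0 ≤ t → h' t = h t) ∧
      ∃ g₀ : E d → ℂ, Measurable g₀ ∧ g₀ =ᵐ[volume] ghat h₀ ∧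
        ∀ t, 0 ≤ t → ∀ᵐ ξ, ‖ghat (h t) ξ‖ₑ ≤ majLim (fun ξ => ‖g₀ ξ‖ₑ) t ξ := by
  obtain ⟨h, hsol, g₀, hm, hg, hle⟩ := exists_isSolution hd h₀ hs.1 hs.2
  refine ⟨h, hsol, fun h' hsol' t ht => ?_, g₀, hm, hg, hle⟩
  obtain ⟨g, hgs, hgh⟩ := hsol.exists_fourierSol hd
  obtain ⟨g', hgs', hgh'⟩ := hsol'.exists_fourierSol hd
  have hsm : ∀ t, 0 ≤ t → ∫⁻ ξ, wt 2 (fun ξ => ‖g t ξ‖ₑ) ξ ≤ 1 / 16 := fun t ht => by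
    rw [lintegral_wt_congr (hgh t ht)]
    refine le_trans (lintegral_mono_ae ?_)
      ((le_self_add.trans (majLim_wt_two_le hd hs hm hg hs.2 (by simp) ht)).trans hs.1)
    filter_upwards [hle t ht] with ξ hξ
    exact mul_le_mul' le_rfl hξ
  exact eq_of_ghat_ae_eq
    (((hgh' t ht).symm.trans (hgs.unique hd hgs' hsm ht)).trans (hgh t ht))

/-- Every solution with small data is dominated by the majorant on the Fourier side. -/
lemma IsSolution.exists_majorant (hd : 1 ≤ d) {h₀ : L2 d} {h : ℝ → L2 d} (hsol : IsSolution h₀ h)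
    (hs : Small h₀) :
    ∃ g₀ : E d → ℂ, Measurable g₀ ∧ g₀ =ᵐ[volume] ghat h₀ ∧
      ∀ t, 0 ≤ t → ∀ᵐ ξ, ‖ghat (h t) ξ‖ₑ ≤ majLim (fun ξ => ‖g₀ ξ‖ₑ) t ξ := by
  obtain ⟨h', -, huniq, g₀, hm, hg, hle⟩ := exists_unique_solution hd hs
  exact ⟨g₀, hm, hg, fun t ht => huniq h hsol t ht ▸ hle t ht⟩

/-- The smallness of the data is inherited by the solution. -/
lemma IsSolution.small (hd : 1 ≤ d) {h₀ : L2 d} {h : ℝ → L2 d} (hsol : IsSolution h₀ h)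
    (hs : Small h₀) {t : ℝ} (ht : 0 ≤ t) : Small (h t) := by
  obtain ⟨g₀, hm, hg, hle⟩ := hsol.exists_majorant hd hs
  have h1 : ∫⁻ ξ, wt 2 (fun ξ => ‖ghat (h t) ξ‖ₑ) ξ ≤ ∫⁻ ξ, wt 2 (fun ξ => ‖ghat h₀ ξ‖ₑ) ξ := by
    refine le_trans (lintegral_mono_ae ?_)
      (le_self_add.trans (majLim_wt_two_le hd hs hm hg hs.2 (by simp) ht))
    filter_upwards [hle t ht] with ξ hξ
    exact mul_le_mul' le_rfl hξ
  exact ⟨h1.trans hs.1, (f2e_mono h1).trans hs.2⟩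

/-- The dissipation inequality for the critical norm. -/
lemma IsSolution.dissipation (hd : 1 ≤ d) {h₀ : L2 d} {h : ℝ → L2 d} (hsol : IsSolution h₀ h)
    (hs : Small h₀) {F : ℝ≥0∞} (hF : f2e (∫⁻ ξ, wt 2 (fun ξ => ‖ghat h₀ ξ‖ₑ) ξ) ≤ F) (hF1 : F < 1)
    {t : ℝ} (ht : 0 ≤ t) :
    sNorm 2 (h t) + (1 - F) * ∫⁻ τ in Icc 0 t, sNorm 6 (h τ) ≤ sNorm 2 h₀ := by
  obtain ⟨g₀, hm, hg, hle⟩ := hsol.exists_majorant hd hs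
  have h1 : ∀ (s τ : ℝ), 0 ≤ τ → sNorm s (h τ) ≤
      normConst d * ∫⁻ ξ, wt s (majLim (fun ξ => ‖g₀ ξ‖ₑ) τ) ξ := fun s τ hτ => by
    rw [sNorm_eq]
    refine mul_le_mul' le_rfl (lintegral_mono_ae ?_)
    filter_upwards [hle τ hτ] with ξ hξ
    exact mul_le_mul' le_rfl hξ
  have h2 : ∫⁻ τ in Icc 0 t, sNorm 6 (h τ) ≤
      normConst d * ∫⁻ r in Ioc 0 t, ∫⁻ ξ, wt 6 (majLim (fun ξ => ‖g₀ ξ‖ₑ) r) ξ := by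
    rw [← restrict_Ioc_eq_restrict_Icc, ← lintegral_const_mul' _ _ (normConst_ne_top d)]
    exact setLIntegral_mono' measurableSet_Ioc fun τ hτ => h1 6 τ hτ.1.le
  calc sNorm 2 (h t) + (1 - F) * ∫⁻ τ in Icc 0 t, sNorm 6 (h τ)
      ≤ normConst d * (∫⁻ ξ, wt 2 (majLim (fun ξ => ‖g₀ ξ‖ₑ) t) ξ) + (1 - F) *
        (normConst d * ∫⁻ r in Ioc 0 t, ∫⁻ ξ, wt 6 (majLim (fun ξ => ‖g₀ ξ‖ₑ) r) ξ) := by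
        gcongr; exact h1 2 t ht
    _ = normConst d * ((∫⁻ ξ, wt 2 (majLim (fun ξ => ‖g₀ ξ‖ₑ) t) ξ) + (1 - F) *
        ∫⁻ r in Ioc 0 t, ∫⁻ ξ, wt 6 (majLim (fun ξ => ‖g₀ ξ‖ₑ) r) ξ) := by ring
    _ ≤ normConst d * ∫⁻ ξ, wt 2 (fun ξ => ‖ghat h₀ ξ‖ₑ) ξ := by
        gcongr; exact majLim_wt_two_le hd hs hm hg hF hF1 ht
    _ = sNorm 2 h₀ := (sNorm_eq 2 h₀).symm

/-- The smoothing estimate in the `s`-norms. -/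
lemma exists_sNorm_smoothing (hd : 1 ≤ d) {s : ℝ} (hs2 : -2 ≤ s) :
    ∃ C : ℝ≥0, ∀ (h₀ : L2 d) (h : ℝ → L2 d), IsSolution h₀ h → Small h₀ → ∀ t : ℝ, 0 ≤ t →
      sNorm s (h t) + ∫⁻ r in Ioc 0 t, sNorm (s + 4) (h r) ≤ C * sNorm s h₀ := by
  obtain ⟨C, hC⟩ := exists_energy_majLim_le hd (s := s) (p := 1) le_rfl (by norm_num)
    (by linarith)
  refine ⟨C, fun h₀ h hsol hs t ht => ?_⟩
  obtain ⟨g₀, hm, hg, hle⟩ := hsol.exists_majorant hd hs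
  have h1 : ∀ (s τ : ℝ), 0 ≤ τ → sNorm s (h τ) ≤
      normConst d * ∫⁻ ξ, wt s (majLim (fun ξ => ‖g₀ ξ‖ₑ) τ) ξ := fun s τ hτ => by
    rw [sNorm_eq]
    refine mul_le_mul' le_rfl (lintegral_mono_ae ?_)
    filter_upwards [hle τ hτ] with ξ hξ
    exact mul_le_mul' le_rfl hξ
  have h2 := hC (fun ξ => ‖g₀ ξ‖ₑ) hm.enorm (by rw [lintegral_wt_congr hg]; exact hs.1)
    (by rw [lintegral_wt_congr hg]; exact hs.2) t ht
  simp only [energy, ENNReal.rpow_one, div_one] at h2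
  rw [lintegral_wt_congr hg] at h2
  have h3 : ∫⁻ r in Ioc 0 t, sNorm (s + 4) (h r) ≤
      normConst d * ∫⁻ r in Ioc 0 t, ∫⁻ ξ, wt (s + 4) (majLim (fun ξ => ‖g₀ ξ‖ₑ) r) ξ := by
    rw [← lintegral_const_mul' _ _ (normConst_ne_top d)]
    exact setLIntegral_mono' measurableSet_Ioc fun τ hτ => h1 (s + 4) τ hτ.1.le
  calc sNorm s (h t) + ∫⁻ r in Ioc 0 t, sNorm (s + 4) (h r)
      ≤ normConst d * (∫⁻ ξ, wt s (majLim (fun ξ => ‖g₀ ξ‖ₑ) t) ξ) +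
        normConst d * ∫⁻ r in Ioc 0 t, ∫⁻ ξ, wt (s + 4) (majLim (fun ξ => ‖g₀ ξ‖ₑ) r) ξ :=
        add_le_add (h1 s t ht) h3
    _ = normConst d * ((∫⁻ ξ, wt s (majLim (fun ξ => ‖g₀ ξ‖ₑ) t) ξ) +
        ∫⁻ r in Ioc 0 t, ∫⁻ ξ, wt (s + 4) (majLim (fun ξ => ‖g₀ ξ‖ₑ) r) ξ) := by ring
    _ ≤ normConst d * (C * ∫⁻ ξ, wt s (fun ξ => ‖ghat h₀ ξ‖ₑ) ξ) := by gcongr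
    _ = C * sNorm s h₀ := by rw [sNorm_eq]; ring

/-- The uniform bounds in the spaces `Ḟ^{s,p}`. -/
lemma exists_fNorm_le (hd : 1 ≤ d) {s p : ℝ} (hs0 : 0 ≤ s) (hp : 1 < p) (hp2 : p ≤ 2) :
    ∃ C : ℝ≥0, ∀ (h₀ : L2 d) (h : ℝ → L2 d), IsSolution h₀ h → Small h₀ → ∀ t : ℝ, 0 ≤ t →
      fNorm s p (h t) ≤ C * fNorm s p h₀ := by
  have hp0 : 0 < p := by linarith
  have hq : 2 ≤ 4 / p := by rw [le_div_iff₀ hp0]; linarith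
  obtain ⟨C, hC⟩ := exists_energy_majLim_le hd (s := s) (p := p) hp.le hp2 (by linarith)
  refine ⟨C ^ (1 / p), fun h₀ h hsol hs t ht => ?_⟩
  obtain ⟨g₀, hm, hg, hle⟩ := hsol.exists_majorant hd hs
  have h2 := hC (fun ξ => ‖g₀ ξ‖ₑ) hm.enorm (by rw [lintegral_wt_congr hg]; exact hs.1)
    (by rw [lintegral_wt_congr hg]; exact hs.2) t ht
  have h3 : ∫⁻ ξ, wt s (fun ξ => ‖ghat (h t) ξ‖ₑ) ξ ^ p ≤
      C * ∫⁻ ξ, wt s (fun ξ => ‖ghat h₀ ξ‖ₑ) ξ ^ p := by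
    have e : ∫⁻ ξ, wt s (fun ξ => ‖ghat h₀ ξ‖ₑ) ξ ^ p = ∫⁻ ξ, wt s (fun ξ => ‖g₀ ξ‖ₑ) ξ ^ p := by
      refine lintegral_congr_ae ?_
      filter_upwards [hg] with ξ hξ
      simp only [wt, hξ]
    rw [e]
    refine (lintegral_mono_ae ?_).trans (le_self_add.trans h2)
    filter_upwards [hle t ht] with ξ hξ
    exact ENNReal.rpow_le_rpow (mul_le_mul' le_rfl hξ) hp0.le
  rw [fNorm_eq s hp0, fNorm_eq s hp0, ENNReal.coe_rpow_of_nonneg _ (by positivity)]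
  refine (mul_le_mul' le_rfl (ENNReal.rpow_le_rpow h3 (by positivity))).trans_eq ?_
  rw [ENNReal.mul_rpow_of_nonneg (C : ℝ≥0∞) _ (by positivity)]
  ring

end

section

/-! ### Low frequencies for large times -/

variable {d : ℕ}

/-- The majorant exceeds its initial value by at most a multiple of `‖·‖_{Ḟ^{0,2}}² + ‖·‖_{Ḟ^{2,2}}²`,
uniformly in time and frequency: the pointwise bound for the nonlinearity is square integrable in
time by parabolic regularity at the exponents `s = 0` and `s = 2`. -/
lemma exists_majLim_le_add (hd : 1 ≤ d) : ∃ C : ℝ≥0, ∀ G : E d → ℝ≥0∞, Measurable G →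
    ∫⁻ ξ, wt 2 G ξ ≤ 1 / 16 → f2e (∫⁻ ξ, wt 2 G ξ) ≤ 1 / 2 → ∀ t : ℝ, 0 ≤ t → ∀ ξ,
    majLim G t ξ ≤ G ξ +
      C * ((∫⁻ ξ, wt 0 G ξ ^ (2 : ℝ)) + ∫⁻ ξ, wt 2 G ξ ^ (2 : ℝ)) := by
  obtain ⟨C₀, hC₀⟩ := exists_energy_majLim_le hd (s := 0) (p := 2) (by norm_num) le_rfl (by norm_num)
  obtain ⟨C₂, hC₂⟩ := exists_energy_majLim_le hd (s := 2) (p := 2) (by norm_num) le_rfl (by norm_num)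
  obtain ⟨κ, hκ⟩ : ∃ κ : ℝ≥0, tailConst = κ :=
    ⟨tailConst.toNNReal, (ENNReal.coe_toNNReal tailConst_ne_top).symm⟩
  refine ⟨κ * (C₀ + C₂), fun G hG h1 h2 t ht ξ => ?_⟩
  have hm := measurable_majLim hG
  have h0 := le_add_self.trans (hC₀ G hG h1 h2 t ht)
  have h3 := le_add_self.trans (hC₂ G hG h1 h2 t ht)
  have hheat : ∀ {r : ℝ}, 0 ≤ r → ENNReal.ofReal (heat r ξ) ≤ 1 := fun hr => by
    refine ENNReal.ofReal_le_one.2 (Real.exp_le_one_iff.2 ?_)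
    have := symb_nonneg ξ
    nlinarith
  have hbound : ∀ τ ∈ Ioc 0 t, ENNReal.ofReal (heat (t - τ) ξ) *
      wt 2 (expTail (wt 2 (majLim G τ))) ξ ≤ tailConst *
        ((∫⁻ η, wt (2 + 4 / 2) (majLim G τ) η ^ (2 : ℝ)) +
          ∫⁻ η, wt (0 + 4 / 2) (majLim G τ) η ^ (2 : ℝ)) := fun τ hτ => by
    have hle1 : ∫⁻ ξ, wt 2 (majLim G τ) ξ ≤ 1 :=
      (le_self_add.trans (lintegral_wt_two_majLim_le hd hG (ne_top_of_le_ne_top (by simp) h1) h2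
        (by simp) hτ.1.le)).trans (h1.trans (by simp))
    refine (mul_le_of_le_one_left' (hheat (sub_nonneg.2 hτ.2))).trans ((wt_two_expTail_le
      (measurable_wt 2 (measurable_slice hm τ)) hle1 ξ).trans ?_)
    gcongr tailConst * (?_ + ?_)
    · refine lintegral_mono_ae ?_
      filter_upwards [ae_rho_ne_zero hd] with η hη
      rw [wt_wt hη, ENNReal.rpow_two]
      norm_num
    · refine lintegral_mono fun η => ?_
      simp only [ENNReal.rpow_two]
      norm_num
  rw [majLim_eq hG, duhE]
  refine add_le_add (mul_le_of_le_one_left' (hheat ht)) ?_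
  calc _ ≤ ∫⁻ τ in Ioc 0 t, tailConst *
        ((∫⁻ η, wt (2 + 4 / 2) (majLim G τ) η ^ (2 : ℝ)) +
          ∫⁻ η, wt (0 + 4 / 2) (majLim G τ) η ^ (2 : ℝ)) :=
        setLIntegral_mono' measurableSet_Ioc hbound
    _ = tailConst * ((∫⁻ τ in Ioc 0 t, ∫⁻ η, wt (2 + 4 / 2) (majLim G τ) η ^ (2 : ℝ)) +
          ∫⁻ τ in Ioc 0 t, ∫⁻ η, wt (0 + 4 / 2) (majLim G τ) η ^ (2 : ℝ)) := by
        rw [lintegral_const_mul' _ _ tailConst_ne_top, lintegral_add_left]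
        exact ((measurable_wt_param _ hm).pow_const _).lintegral_prod_right'
    _ ≤ tailConst * (C₂ * (∫⁻ ξ, wt 2 G ξ ^ (2 : ℝ)) + C₀ * ∫⁻ ξ, wt 0 G ξ ^ (2 : ℝ)) := by
        gcongr
    _ ≤ tailConst * ((C₀ + C₂) * (∫⁻ ξ, wt 2 G ξ ^ (2 : ℝ)) +
          (C₀ + C₂) * ∫⁻ ξ, wt 0 G ξ ^ (2 : ℝ)) := by
        gcongr
        · exact le_add_self
        · exact le_self_add
    _ = _ := by rw [hκ]; push_cast; ring

/-- By Plancherel's theorem the two normalisations agree at `p = 2`. -/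
lemma fNorm_two_eq (s : ℝ) (h : L2 d) :
    fNorm s 2 h ^ (2 : ℝ) = ∫⁻ ξ, wt s (fun ξ => ‖ghat h ξ‖ₑ) ξ ^ (2 : ℝ) := by
  have hpi : (0 : ℝ) < 2 * Real.pi := by positivity
  have h1 : ENNReal.ofReal ((2 * Real.pi) ^ d) *
      ENNReal.ofReal ((2 * Real.pi) ^ (-(d : ℝ) / 2)) ^ (2 : ℝ) = 1 := by
    rw [ENNReal.ofReal_rpow_of_nonneg (by positivity) (by norm_num),
      ← ENNReal.ofReal_mul (by positivity), ← Real.rpow_mul hpi.le, ← Real.rpow_natCast,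
      ← Real.rpow_add hpi]
    simp
  rw [fNorm_eq s two_pos, h1, ENNReal.one_rpow, one_mul, ← ENNReal.rpow_mul]
  norm_num

/-- Rescaling the frequency preserves null sets. -/
lemma ae_inv_two_pi_smul {p : E d → Prop} (hp : ∀ᵐ ξ, p ξ) :
    ∀ᵐ ξ : E d, p ((2 * Real.pi)⁻¹ • ξ) := by
  have h := Measure.map_addHaar_smul (volume : Measure (E d)) (r := (2 * Real.pi)⁻¹) (by positivity)
  refine ae_of_ae_map (μ := volume) (f := fun ξ : E d => (2 * Real.pi)⁻¹ • ξ) (by fun_prop) ?_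
  rw [h]
  exact Measure.ae_smul_measure hp _

/-- The nonlinear part of the Fourier transform of a small solution is bounded uniformly in time and
frequency. -/
lemma exists_enorm_fhat_le (hd : 1 ≤ d) (M₀ M₂ : ℝ≥0) : ∃ Λ : ℝ≥0, ∀ (h₀ : L2 d) (h : ℝ → L2 d),
    IsSolution h₀ h → Small h₀ → fNorm 0 2 h₀ ≤ M₀ → fNorm 2 2 h₀ ≤ M₂ → ∀ t : ℝ, 0 ≤ t →
    ∀ᵐ ξ, ‖fhat (h t) ξ‖ₑ ≤ ‖fhat h₀ ξ‖ₑ + Λ := by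
  obtain ⟨C, hC⟩ := exists_majLim_le_add hd
  refine ⟨Real.toNNReal ((2 * Real.pi) ^ (-(d : ℝ) / 2)) * (C * (M₀ ^ (2 : ℝ) + M₂ ^ (2 : ℝ))),
    fun h₀ h hsol hs h0 h2 t ht => ?_⟩
  obtain ⟨g₀, hm, hg, hle⟩ := hsol.exists_majorant hd hs
  have e : ∀ s : ℝ, ∫⁻ ξ, wt s (fun ξ => ‖g₀ ξ‖ₑ) ξ ^ (2 : ℝ) = fNorm s 2 h₀ ^ (2 : ℝ) :=
      fun s => by
    rw [fNorm_two_eq]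
    refine lintegral_congr_ae ?_
    filter_upwards [hg] with ξ hξ
    simp only [wt, hξ]
  have h3 := hC (fun ξ => ‖g₀ ξ‖ₑ) hm.enorm (by rw [lintegral_wt_congr hg]; exact hs.1)
    (by rw [lintegral_wt_congr hg]; exact hs.2) t ht
  simp only [e] at h3
  filter_upwards [ae_inv_two_pi_smul (hle t ht), ae_inv_two_pi_smul hg] with ξ h4 h5
  rw [enorm_fhat, enorm_fhat, ← h5]
  push_cast
  rw [← ENNReal.ofReal, ← mul_add, ENNReal.coe_rpow_of_nonneg _ (by norm_num),
    ENNReal.coe_rpow_of_nonneg _ (by norm_num)]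
  gcongr
  refine h4.trans ((h3 _).trans ?_)
  gcongr

end

section

/-! ### Interpolation between dyadic shells and high frequencies -/

variable {d : ℕ}

lemma measurableSet_shell (k : ℤ) : MeasurableSet (shell d k) := by
  have h : shell d k = {ξ | (2 : ℝ) ^ (k - 1) ≤ ‖ξ‖} ∩ {ξ | ‖ξ‖ < (2 : ℝ) ^ k} := rfl
  rw [h]
  exact (measurableSet_le (by fun_prop) (by fun_prop)).inter
    (measurableSet_lt (by fun_prop) (by fun_prop))

lemma lintegral_shell_rpow_le (k : ℤ) :
    ∫⁻ ξ in shell d k, ‖ξ‖ₑ ^ (-(d : ℝ)) ≤ 2 ^ d * volume (Metric.ball (0 : E d) 1) := by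
  have hk : (0 : ℝ) < 2 ^ (k - 1) := by positivity
  have hk' : (0 : ℝ) < 2 ^ k := by positivity
  have h1 : ∀ ξ ∈ shell d k, ‖ξ‖ₑ ^ (-(d : ℝ)) ≤ ENNReal.ofReal ((2 ^ (k - 1)) ^ (-(d : ℝ))) :=
      fun ξ hξ => by
    have h0 : 0 < ‖ξ‖ := hk.trans_le hξ.1
    rw [← ofReal_norm, ENNReal.ofReal_rpow_of_pos h0]
    exact ENNReal.ofReal_le_ofReal (Real.rpow_le_rpow_of_nonpos hk hξ.1 (by simp))
  calc ∫⁻ ξ in shell d k, ‖ξ‖ₑ ^ (-(d : ℝ))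
      ≤ ∫⁻ _ in shell d k, ENNReal.ofReal ((2 ^ (k - 1)) ^ (-(d : ℝ))) :=
        setLIntegral_mono' (measurableSet_shell k) h1
    _ = ENNReal.ofReal ((2 ^ (k - 1)) ^ (-(d : ℝ))) * volume (shell d k) := by simp
    _ ≤ ENNReal.ofReal ((2 ^ (k - 1)) ^ (-(d : ℝ))) * volume (Metric.ball (0 : E d) (2 ^ k)) := by
        gcongr
        exact fun ξ hξ => by simpa using hξ.2
    _ = 2 ^ d * volume (Metric.ball (0 : E d) 1) := by
        rw [Measure.addHaar_ball_of_pos volume (0 : E d) hk', finrank_euclideanSpace_fin, ← mul_assoc,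
          ← ENNReal.ofReal_mul (by positivity), Real.rpow_neg hk.le, Real.rpow_natCast,
          ← inv_pow, ← mul_pow, zpow_sub_one₀ (by norm_num)]
        congr 1
        rw [mul_inv, inv_inv, mul_right_comm, inv_mul_cancel₀ hk'.ne', one_mul,
          ENNReal.ofReal_pow (by norm_num)]
        norm_num

/-- Splitting the frequencies at `|ξ| = 2^K`, the low ones are summed over dyadic shells and the high
ones absorb four derivatives. -/
lemma exists_lintegral_rpow_mul_le (hd : 1 ≤ d) {s : ℝ} (hs : 0 < s + d) :
    ∃ D : ℝ≥0, ∀ (g : E d → ℝ≥0∞) (B : ℝ≥0∞),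
      (∀ k, ∫⁻ ξ in shell d k, ‖ξ‖ₑ ^ (-(d : ℝ)) * g ξ ≤ B) → ∀ K : ℤ,
      ∫⁻ ξ, ‖ξ‖ₑ ^ s * g ξ ≤ D * B * ENNReal.ofReal (((16 : ℝ) ^ K) ^ ((s + d) / 4)) +
        ENNReal.ofReal ((16 : ℝ) ^ K)⁻¹ * ∫⁻ ξ, ‖ξ‖ₑ ^ (s + 4) * g ξ := by
  have hq : ((1 / 2 : ℝ)) ^ (s + d) < 1 := Real.rpow_lt_one (by norm_num) (by norm_num) hs
  refine ⟨Real.toNNReal (1 - (1 / 2 : ℝ) ^ (s + d))⁻¹, fun g B hB K => ?_⟩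
  have h2K : (0 : ℝ) < 2 ^ K := by positivity
  have h16 : (16 : ℝ) ^ K = (2 ^ K) ^ 4 := by
    rw [← zpow_natCast, ← zpow_mul, mul_comm, zpow_mul]; norm_num
  have hshell : ∀ n : ℕ, ∫⁻ ξ in shell d (K - n), ‖ξ‖ₑ ^ s * g ξ ≤
      ENNReal.ofReal (((16 : ℝ) ^ K) ^ ((s + d) / 4)) *
        ENNReal.ofReal ((1 / 2 : ℝ) ^ (s + d)) ^ n * B := fun n => by
    have h2n : (0 : ℝ) < 2 ^ (K - n) := by positivity
    have e : ENNReal.ofReal (((16 : ℝ) ^ K) ^ ((s + d) / 4)) *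
        ENNReal.ofReal ((1 / 2 : ℝ) ^ (s + d)) ^ n = ENNReal.ofReal ((2 ^ (K - n)) ^ (s + d)) := by
      have e1 : ((16 : ℝ) ^ K) ^ ((s + d) / 4) = (2 ^ K) ^ (s + d) := by
        rw [h16, ← Real.rpow_natCast, ← Real.rpow_mul h2K.le]
        congr 1; push_cast; ring
      have e2 : ((1 / 2 : ℝ) ^ (s + d)) ^ n = ((1 / 2 : ℝ) ^ n) ^ (s + d) := by
        rw [← Real.rpow_natCast, ← Real.rpow_mul (by norm_num), mul_comm,
          Real.rpow_mul (by norm_num), Real.rpow_natCast]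
      rw [← ENNReal.ofReal_pow (by positivity), ← ENNReal.ofReal_mul (by positivity), e1, e2,
        ← Real.mul_rpow h2K.le (by positivity), zpow_sub₀ (by norm_num), zpow_natCast,
        div_eq_mul_inv (_ ^ K), one_div, inv_pow]
    rw [e]
    calc ∫⁻ ξ in shell d (K - n), ‖ξ‖ₑ ^ s * g ξ
        ≤ ∫⁻ ξ in shell d (K - n), ENNReal.ofReal ((2 ^ (K - n)) ^ (s + d)) *
          (‖ξ‖ₑ ^ (-(d : ℝ)) * g ξ) := by
          refine setLIntegral_mono' (measurableSet_shell _) fun ξ hξ => ?_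
          have h0 : 0 < ‖ξ‖ := lt_of_lt_of_le (by positivity) hξ.1
          have h0e : ‖ξ‖ₑ ≠ 0 := by simpa using norm_pos_iff.1 h0
          rw [← mul_assoc]
          gcongr
          calc ‖ξ‖ₑ ^ s = ‖ξ‖ₑ ^ (s + d) * ‖ξ‖ₑ ^ (-(d : ℝ)) := by
                rw [← ENNReal.rpow_add _ _ h0e (by simp)]; congr 1; ring
            _ ≤ _ := by
                gcongr
                rw [← ofReal_norm, ENNReal.ofReal_rpow_of_pos h0]
                exact ENNReal.ofReal_le_ofReal (Real.rpow_le_rpow h0.le hξ.2.le hs.le)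
      _ = ENNReal.ofReal ((2 ^ (K - n)) ^ (s + d)) *
          ∫⁻ ξ in shell d (K - n), ‖ξ‖ₑ ^ (-(d : ℝ)) * g ξ :=
          lintegral_const_mul' _ _ ENNReal.ofReal_ne_top
      _ ≤ _ := by gcongr; exact hB _
  have hlow : ∫⁻ ξ in {ξ : E d | ‖ξ‖ < 2 ^ K}, ‖ξ‖ₑ ^ s * g ξ ≤
      ENNReal.ofReal ((1 - (1 / 2 : ℝ) ^ (s + d))⁻¹) * B *
        ENNReal.ofReal (((16 : ℝ) ^ K) ^ ((s + d) / 4)) := by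
    have hsub : {ξ : E d | ‖ξ‖ < 2 ^ K} ≤ᵐ[volume] (⋃ n : ℕ, shell d (K - n) : Set (E d)) := by
      filter_upwards [ae_rho_ne_zero hd] with ξ hξ hlt
      rw [Ne, rho_eq_zero_iff] at hξ
      obtain ⟨j, hj1, hj2⟩ := exists_mem_Ico_zpow (norm_pos_iff.2 hξ) (one_lt_two (α := ℝ))
      have hjK : j < K := (zpow_lt_zpow_iff_right₀ (one_lt_two (α := ℝ))).1 (hj1.trans_lt hlt)
      refine mem_iUnion.2 ⟨(K - (j + 1)).toNat, ?_⟩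
      have e : K - ((K - (j + 1)).toNat : ℤ) = j + 1 := by omega
      rw [e]
      exact ⟨by simpa using hj1, hj2⟩
    calc ∫⁻ ξ in {ξ : E d | ‖ξ‖ < 2 ^ K}, ‖ξ‖ₑ ^ s * g ξ
        ≤ ∫⁻ ξ in ⋃ n : ℕ, shell d (K - n), ‖ξ‖ₑ ^ s * g ξ := lintegral_mono_set' hsub
      _ ≤ ∑' n : ℕ, ∫⁻ ξ in shell d (K - n), ‖ξ‖ₑ ^ s * g ξ := lintegral_iUnion_le _ _
      _ ≤ ∑' n : ℕ, ENNReal.ofReal (((16 : ℝ) ^ K) ^ ((s + d) / 4)) *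
          ENNReal.ofReal ((1 / 2 : ℝ) ^ (s + d)) ^ n * B := ENNReal.tsum_le_tsum hshell
      _ = _ := by
          rw [ENNReal.tsum_mul_right, ENNReal.tsum_mul_left, ENNReal.tsum_geometric,
            ENNReal.ofReal_inv_of_pos (by linarith), ENNReal.ofReal_sub _ (by positivity),
            ENNReal.ofReal_one]
          ring
  have hhigh : ∫⁻ ξ in {ξ : E d | ‖ξ‖ < 2 ^ K}ᶜ, ‖ξ‖ₑ ^ s * g ξ ≤
      ENNReal.ofReal ((16 : ℝ) ^ K)⁻¹ * ∫⁻ ξ, ‖ξ‖ₑ ^ (s + 4) * g ξ := by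
    have hms : MeasurableSet {ξ : E d | ‖ξ‖ < 2 ^ K} := measurableSet_lt (by fun_prop) (by fun_prop)
    rw [← lintegral_const_mul' _ _ ENNReal.ofReal_ne_top]
    refine (setLIntegral_mono' hms.compl fun ξ hξ => ?_).trans (setLIntegral_le_lintegral _ _)
    have hξ' : (2 : ℝ) ^ K ≤ ‖ξ‖ := not_lt.1 hξ
    have h0 : 0 < ‖ξ‖ := h2K.trans_le hξ'
    rw [← mul_assoc, ← ofReal_norm, ENNReal.ofReal_rpow_of_pos h0, ENNReal.ofReal_rpow_of_pos h0,
      ← ENNReal.ofReal_mul (by positivity)]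
    gcongr
    rw [Real.rpow_add h0, show (4 : ℝ) = ((4 : ℕ) : ℝ) by norm_num, Real.rpow_natCast, h16,
      ← div_eq_inv_mul, le_div_iff₀ (by positivity)]
    gcongr
  rw [← lintegral_add_compl _ (measurableSet_lt (by fun_prop) (by fun_prop) :
    MeasurableSet {ξ : E d | ‖ξ‖ < 2 ^ K})]
  exact add_le_add hlow hhigh

/-- The Besov norm of a perturbation of `h₀` that is bounded on the Fourier side. -/
lemma lintegral_shell_fhat_le {h₀ h : L2 d} {Λ : ℝ≥0}
    (hle : ∀ᵐ ξ, ‖fhat h ξ‖ₑ ≤ ‖fhat h₀ ξ‖ₑ + Λ) (k : ℤ) :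
    ∫⁻ ξ in shell d k, ‖ξ‖ₑ ^ (-(d : ℝ)) * ‖fhat h ξ‖ₑ ≤
      besovNorm (-(d : ℝ)) h₀ + Λ * (2 ^ d * volume (Metric.ball (0 : E d) 1)) := by
  calc ∫⁻ ξ in shell d k, ‖ξ‖ₑ ^ (-(d : ℝ)) * ‖fhat h ξ‖ₑ
      ≤ ∫⁻ ξ in shell d k, (‖ξ‖ₑ ^ (-(d : ℝ)) * ‖fhat h₀ ξ‖ₑ + Λ * ‖ξ‖ₑ ^ (-(d : ℝ))) := by
        refine lintegral_mono_ae ?_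
        filter_upwards [ae_restrict_of_ae hle] with ξ hξ
        rw [mul_comm (Λ : ℝ≥0∞), ← mul_add]
        gcongr
    _ = (∫⁻ ξ in shell d k, ‖ξ‖ₑ ^ (-(d : ℝ)) * ‖fhat h₀ ξ‖ₑ) +
        Λ * ∫⁻ ξ in shell d k, ‖ξ‖ₑ ^ (-(d : ℝ)) := by
        rw [lintegral_add_right _ (by fun_prop), lintegral_const_mul' _ _ ENNReal.coe_ne_top]
    _ ≤ _ := by
        gcongr
        · exact le_iSup (fun k => ∫⁻ ξ in shell d k, ‖ξ‖ₑ ^ (-(d : ℝ)) * ‖fhat h₀ ξ‖ₑ) k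
        · exact lintegral_shell_rpow_le k

end

section

/-! ### Decay for large times -/

variable {d : ℕ}

/-- The equation is autonomous: a solution may be restarted at any time. -/
lemma IsSolution.shift {h₀ : L2 d} {h : ℝ → L2 d} (hsol : IsSolution h₀ h) {a : ℝ} (ha : 0 ≤ a) :
    IsSolution (h a) fun t => h (t + a) where
  continuousOn := hsol.continuousOn.comp (by fun_prop) fun t ht => add_nonneg ht ha
  initial := by simp
  locally_bounded T hT := by
    obtain ⟨M, hM⟩ := hsol.locally_bounded (T + a) (by positivity)
    exact ⟨M, fun t ht => hM _ ⟨add_nonneg ht.1 ha, by linarith [ht.2]⟩⟩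
  locally_integrable T hT := by
    refine lt_of_le_of_lt ?_ (hsol.locally_integrable (T + a) (by positivity))
    rw [← lintegral_indicator measurableSet_Icc, ← lintegral_indicator measurableSet_Icc,
      ← lintegral_add_right_eq_self (indicator (Icc 0 (T + a)) fun t => sNorm 6 (h t)) a]
    refine lintegral_mono fun t => ?_
    by_cases ht : t ∈ Icc 0 T
    · have h1 : t + a ∈ Icc 0 (T + a) := ⟨add_nonneg ht.1 ha, by linarith [ht.2]⟩
      simp only [indicator_of_mem ht, indicator_of_mem h1, le_refl]
    · simp [indicator_of_notMem ht]
  equation := by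
    obtain ⟨u, hu, heq⟩ := hsol.equation
    refine ⟨fun t => u (t + a), fun t ht => hu _ (by positivity), fun φ t ht => ?_⟩
    obtain ⟨hi1, he1⟩ := heq φ (t + a) (by positivity)
    obtain ⟨hi2, he2⟩ := heq φ a ha
    have hi3 := hi2.symm.trans hi1
    constructor
    · have := hi3.comp_add_right a
      simpa using this
    · rw [intervalIntegral.integral_comp_add_right (fun τ =>
        ∫ x, Real.exp (-(u τ x)) * Laplacian.laplacian φ x) a, he1, he2, zero_add, add_assoc,
        intervalIntegral.integral_add_adjacent_intervals hi2 hi3]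

/-- Iteration over the times `t, t/2, t/4, …`. -/
lemma le_rpow_of_le_half {φ : ℝ → ℝ≥0∞} {D P : ℝ≥0} {σ : ℝ} (hσ : 0 < σ)
    (hP : ∀ t, 0 ≤ t → φ t ≤ P)
    (hD : ∀ t, 0 < t → φ t ≤ D * ENNReal.ofReal (t ^ (-σ)) +
      ENNReal.ofReal (1 / 2 * 2 ^ (-σ)) * φ (t / 2)) {t : ℝ} (ht : 0 ≤ t) :
    φ t ≤ (2 * D + P) * ENNReal.ofReal (2 ^ σ) * ENNReal.ofReal ((1 + t) ^ (-σ)) := by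
  have hind : ∀ n : ℕ, ∀ t : ℝ, 0 < t → t ≤ 2 ^ n →
      φ t ≤ (2 * D + P) * ENNReal.ofReal (t ^ (-σ)) := fun n => by
    induction n with
    | zero =>
      intro t ht ht1
      have h1 : 1 ≤ ENNReal.ofReal (t ^ (-σ)) := by
        rw [ENNReal.one_le_ofReal]
        exact Real.one_le_rpow_of_pos_of_le_one_of_nonpos ht (by simpa using ht1) (by linarith)
      calc φ t ≤ P := hP t ht.le
        _ ≤ (2 * D + P) * 1 := by rw [mul_one]; exact le_add_self
        _ ≤ _ := by gcongr
    | succ n ih =>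
      intro t ht ht1
      have h1 := ih (t / 2) (by positivity) (by rw [div_le_iff₀ two_pos, ← pow_succ]; exact ht1)
      have h2 : ENNReal.ofReal (1 / 2 * 2 ^ (-σ)) * ENNReal.ofReal ((t / 2) ^ (-σ)) =
          2⁻¹ * ENNReal.ofReal (t ^ (-σ)) := by
        have h3 : (0 : ℝ) < 2 ^ (-σ) := by positivity
        rw [← ENNReal.ofReal_mul (by positivity), Real.div_rpow ht.le two_pos.le, mul_assoc,
          mul_div_cancel₀ _ h3.ne', ENNReal.ofReal_mul (by positivity)]
        congr 1
        rw [one_div, ENNReal.ofReal_inv_of_pos two_pos, ENNReal.ofReal_ofNat]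
      calc φ t ≤ D * ENNReal.ofReal (t ^ (-σ)) +
            ENNReal.ofReal (1 / 2 * 2 ^ (-σ)) * φ (t / 2) := hD t ht
        _ ≤ D * ENNReal.ofReal (t ^ (-σ)) + ENNReal.ofReal (1 / 2 * 2 ^ (-σ)) *
            ((2 * D + P) * ENNReal.ofReal ((t / 2) ^ (-σ))) := by gcongr
        _ = D * ENNReal.ofReal (t ^ (-σ)) + (2 * D + P) *
            (ENNReal.ofReal (1 / 2 * 2 ^ (-σ)) * ENNReal.ofReal ((t / 2) ^ (-σ))) := by ring
        _ = (D + (2⁻¹ * 2) * D + 2⁻¹ * P) * ENNReal.ofReal (t ^ (-σ)) := by rw [h2]; ring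
        _ ≤ (D + 1 * D + 1 * P) * ENNReal.ofReal (t ^ (-σ)) := by
            rw [ENNReal.inv_mul_cancel (by simp) (by simp)]
            gcongr
            simp
        _ = _ := by ring
  rw [mul_assoc, ← ENNReal.ofReal_mul (by positivity)]
  have h2 : (2 : ℝ) ^ σ = (1 / 2) ^ (-σ) := by
    rw [one_div, Real.inv_rpow two_pos.le, Real.rpow_neg two_pos.le, inv_inv]
  rw [h2, ← Real.mul_rpow (by norm_num) (by positivity)]
  rcases le_total t 1 with h1 | h1
  · have h3 : 1 ≤ ENNReal.ofReal ((1 / 2 * (1 + t)) ^ (-σ)) := by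
      rw [ENNReal.one_le_ofReal]
      exact Real.one_le_rpow_of_pos_of_le_one_of_nonpos (by positivity) (by linarith) (by linarith)
    calc φ t ≤ P := hP t ht
      _ ≤ (2 * D + P) * 1 := by rw [mul_one]; exact le_add_self
      _ ≤ _ := by gcongr
  · obtain ⟨n, hn⟩ := pow_unbounded_of_one_lt t (one_lt_two (α := ℝ))
    refine (hind n t (by linarith) hn.le).trans ?_
    exact mul_le_mul' le_rfl (ENNReal.ofReal_le_ofReal
      (Real.rpow_le_rpow_of_nonpos (by positivity) (by linarith) (by linarith)))

/-- Averaging the smoothing estimate over `[t/2, t]`. -/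
lemma sNorm_le_half (hd : 1 ≤ d) {s : ℝ} {C D : ℝ≥0} {B : ℝ≥0∞}
    (hC : ∀ (h₀ : L2 d) (h : ℝ → L2 d), IsSolution h₀ h → Small h₀ → ∀ t : ℝ, 0 ≤ t →
      sNorm s (h t) + ∫⁻ r in Ioc 0 t, sNorm (s + 4) (h r) ≤ C * sNorm s h₀)
    (hD : ∀ (g : E d → ℝ≥0∞) (B : ℝ≥0∞),
      (∀ k, ∫⁻ ξ in shell d k, ‖ξ‖ₑ ^ (-(d : ℝ)) * g ξ ≤ B) → ∀ K : ℤ,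
      ∫⁻ ξ, ‖ξ‖ₑ ^ s * g ξ ≤ D * B * ENNReal.ofReal (((16 : ℝ) ^ K) ^ ((s + d) / 4)) +
        ENNReal.ofReal ((16 : ℝ) ^ K)⁻¹ * ∫⁻ ξ, ‖ξ‖ₑ ^ (s + 4) * g ξ)
    {h₀ : L2 d} {h : ℝ → L2 d} (hsol : IsSolution h₀ h) (hs : Small h₀)
    (hB : ∀ t, 0 ≤ t → ∀ k, ∫⁻ ξ in shell d k, ‖ξ‖ₑ ^ (-(d : ℝ)) * ‖fhat (h t) ξ‖ₑ ≤ B)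
    (K : ℤ) {t : ℝ} (ht : 0 < t) :
    sNorm s (h t) ≤ C * (D * B * ENNReal.ofReal (((16 : ℝ) ^ K) ^ ((s + d) / 4))) +
      C ^ 2 * ENNReal.ofReal (2 * (t * 16 ^ K)⁻¹) * sNorm s (h (t / 2)) := by
  obtain ⟨a, ha⟩ : ∃ a, a = t / 2 := ⟨_, rfl⟩
  have ha0 : 0 < a := by rw [ha]; positivity
  have hta : t = a + a := by rw [ha]; ring
  obtain ⟨A, hA⟩ : ∃ A, A = D * B * ENNReal.ofReal (((16 : ℝ) ^ K) ^ ((s + d) / 4)) := ⟨_, rfl⟩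
  have h1 : ∀ r ∈ Ioc 0 a, sNorm s (h t) ≤
      C * A + C * ENNReal.ofReal ((16 : ℝ) ^ K)⁻¹ * sNorm (s + 4) (h (r + a)) := fun r hr => by
    have hra : 0 ≤ r + a := by linarith [hr.1]
    have h2 := le_self_add.trans (hC _ _ (hsol.shift hra) (hsol.small hd hs hra) (a - r)
      (by linarith [hr.2]))
    simp only [show a - r + (r + a) = t by rw [hta]; ring] at h2
    refine h2.trans ?_
    rw [mul_assoc, ← mul_add, hA]
    gcongr
    exact hD _ B (hB _ hra) K
  have h3 : ENNReal.ofReal a * sNorm s (h t) ≤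
      ENNReal.ofReal a * (C * A) + C * ENNReal.ofReal ((16 : ℝ) ^ K)⁻¹ *
        (C * sNorm s (h a)) := by
    calc ENNReal.ofReal a * sNorm s (h t) = ∫⁻ _ in Ioc 0 a, sNorm s (h t) := by
          simp [mul_comm]
      _ ≤ ∫⁻ r in Ioc 0 a, (C * A + C * ENNReal.ofReal ((16 : ℝ) ^ K)⁻¹ *
          sNorm (s + 4) (h (r + a))) := setLIntegral_mono' measurableSet_Ioc h1
      _ = ENNReal.ofReal a * (C * A) + C * ENNReal.ofReal ((16 : ℝ) ^ K)⁻¹ *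
          ∫⁻ r in Ioc 0 a, sNorm (s + 4) (h (r + a)) := by
          rw [lintegral_add_left measurable_const, lintegral_const_mul' _ _
            (ENNReal.mul_ne_top (by simp) (by simp))]
          simp [mul_comm]
      _ ≤ _ := by
          gcongr
          exact le_add_self.trans (hC _ _ (hsol.shift ha0.le) (hsol.small hd hs ha0.le) a ha0.le)
  have ha1 : ENNReal.ofReal a ≠ 0 := by simpa using ha0
  have hinv : (ENNReal.ofReal a)⁻¹ * ENNReal.ofReal a = 1 :=
    ENNReal.inv_mul_cancel ha1 ENNReal.ofReal_ne_top
  have h4 : ENNReal.ofReal (2 * (t * 16 ^ K)⁻¹) =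
      (ENNReal.ofReal a)⁻¹ * ENNReal.ofReal ((16 : ℝ) ^ K)⁻¹ := by
    rw [← ENNReal.ofReal_inv_of_pos ha0, ← ENNReal.ofReal_mul (by positivity), ha]
    congr 1
    field_simp
  rw [← hA, h4, ← ha]
  calc sNorm s (h t) = (ENNReal.ofReal a)⁻¹ * (ENNReal.ofReal a * sNorm s (h t)) := by
        rw [← mul_assoc, hinv, one_mul]
    _ ≤ (ENNReal.ofReal a)⁻¹ * (ENNReal.ofReal a * (C * A) +
        C * ENNReal.ofReal ((16 : ℝ) ^ K)⁻¹ * (C * sNorm s (h a))) := by gcongr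
    _ = ((ENNReal.ofReal a)⁻¹ * ENNReal.ofReal a) * (C * A) + C ^ 2 *
        ((ENNReal.ofReal a)⁻¹ * ENNReal.ofReal ((16 : ℝ) ^ K)⁻¹) * sNorm s (h a) := by ring
    _ = _ := by rw [hinv, one_mul]

/-- Small solutions decay in the `s`-norms at the rate of the linear equation with data in the Besov
space of exponent `-d`. -/
lemma exists_sNorm_decay (hd : 1 ≤ d) {s : ℝ} (hs2 : -2 ≤ s) (hsd : 0 < s + d)
    (B M₀ M₂ S : ℝ≥0) :
    ∃ C : ℝ≥0, ∀ (h₀ : L2 d) (h : ℝ → L2 d), IsSolution h₀ h → Small h₀ →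
      besovNorm (-(d : ℝ)) h₀ ≤ B → fNorm 0 2 h₀ ≤ M₀ → fNorm 2 2 h₀ ≤ M₂ → sNorm s h₀ ≤ S →
      ∀ t : ℝ, 0 ≤ t → sNorm s (h t) ≤ C * ENNReal.ofReal ((1 + t) ^ (-(s + d) / 4)) := by
  obtain ⟨C, hC⟩ := exists_sNorm_smoothing hd hs2
  obtain ⟨D, hD⟩ := exists_lintegral_rpow_mul_le hd hsd
  obtain ⟨Λ, hΛ⟩ := exists_enorm_fhat_le hd M₀ M₂
  obtain ⟨v, hv⟩ : ∃ v : ℝ≥0, volume (Metric.ball (0 : E d) 1) = v :=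
    ⟨_, (ENNReal.coe_toNNReal measure_ball_lt_top.ne).symm⟩
  obtain ⟨σ, hσ⟩ : ∃ σ, σ = (s + d) / 4 := ⟨_, rfl⟩
  have hσ0 : 0 < σ := by rw [hσ]; positivity
  -- the cut-off frequency `2^K ≈ (lam / t)^(1/4)` makes the coefficient of `‖h(t/2)‖_s` small
  -- enough for the iteration over dyadic times
  obtain ⟨lam, hlam⟩ : ∃ lam : ℝ, lam = 4 * (C : ℝ) ^ 2 * 2 ^ σ + 1 := ⟨_, rfl⟩
  have hlam0 : 0 < lam := by rw [hlam]; positivity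
  obtain ⟨D', hD'⟩ : ∃ D' : ℝ≥0,
    D' = C * (D * (B + Λ * (2 ^ d * v))) * Real.toNNReal ((16 * lam) ^ σ) := ⟨_, rfl⟩
  refine ⟨(2 * D' + C * S) * Real.toNNReal (2 ^ σ), fun h₀ h hsol hs hB h0 h2 hS t ht => ?_⟩
  have hBt : ∀ t, 0 ≤ t → ∀ k, ∫⁻ ξ in shell d k, ‖ξ‖ₑ ^ (-(d : ℝ)) * ‖fhat (h t) ξ‖ₑ ≤
      ((B + Λ * (2 ^ d * v) : ℝ≥0) : ℝ≥0∞) := fun t ht k => by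
    refine (lintegral_shell_fhat_le (hΛ h₀ h hsol hs h0 h2 t ht) k).trans ?_
    push_cast
    rw [hv]
    gcongr
  have key := le_rpow_of_le_half (φ := fun t => sNorm s (h t)) (D := D') (P := C * S) hσ0
    (fun t ht => (le_self_add.trans (hC h₀ h hsol hs t ht)).trans (by push_cast; gcongr))
    (fun t ht => by
      obtain ⟨n, hn1, hn2⟩ := exists_mem_Ico_zpow (div_pos hlam0 ht)
        (by norm_num : (1 : ℝ) < 16)
      have hn0 : (0 : ℝ) < 16 ^ (n + 1) := by positivity
      rw [div_lt_iff₀ ht] at hn2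
      have hn3 : (16 : ℝ) ^ (n + 1) ≤ 16 * lam * t⁻¹ := by
        rw [zpow_add_one₀ (by norm_num), mul_assoc, ← div_eq_mul_inv]; linarith
      refine (sNorm_le_half hd hC hD hsol hs hBt (n + 1) ht).trans ?_
      rw [← hσ]
      refine add_le_add ?_ (mul_le_mul' ?_ le_rfl)
      · have h5 : ENNReal.ofReal (((16 : ℝ) ^ (n + 1)) ^ σ) ≤
            ENNReal.ofReal ((16 * lam) ^ σ) * ENNReal.ofReal (t ^ (-σ)) := by
          rw [← ENNReal.ofReal_mul (by positivity), Real.rpow_neg ht.le, ← Real.inv_rpow ht.le,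
            ← Real.mul_rpow (by positivity) (by positivity)]
          exact ENNReal.ofReal_le_ofReal (Real.rpow_le_rpow hn0.le hn3 hσ0.le)
        rw [hD']
        push_cast
        rw [← ENNReal.ofReal, mul_assoc _ (ENNReal.ofReal _), ← mul_assoc (C : ℝ≥0∞)]
        gcongr
      · rw [← ENNReal.ofReal_coe_nnreal, ← ENNReal.ofReal_pow (by positivity),
          ← ENNReal.ofReal_mul (by positivity)]
        refine ENNReal.ofReal_le_ofReal ?_
        have h6 : (2 : ℝ) ^ σ * 2 ^ (-σ) = 1 := by
          rw [← Real.rpow_add two_pos]; simp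
        have h7 : (0 : ℝ) < 2 ^ (-σ) := by positivity
        rw [← mul_assoc, ← div_eq_mul_inv, div_le_iff₀ (by positivity)]
        calc (C : ℝ) ^ 2 * 2 = 1 / 2 * 2 ^ (-σ) * (4 * (C : ℝ) ^ 2 * 2 ^ σ) := by
              linear_combination (-2 * (C : ℝ) ^ 2) * h6
          _ ≤ 1 / 2 * 2 ^ (-σ) * lam := by gcongr; rw [hlam]; linarith
          _ ≤ _ := by gcongr; linarith) ht
  rw [neg_div, ← hσ]
  refine key.trans_eq ?_
  push_cast
  rfl

end

end ExpPDE

end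

theorem theorem1p2 (d : ℕ) (hd : 1 ≤ d) (yStar : ℝ≥0) (hyStar_pos : 0 < yStar)
    (hyStar : f2 yStar = 1) :
    -- the solution exists, is unique, and dissipates the critical norm
    (∀ h₀ : L2 d, sNorm 2 h₀ < yStar →
      ∃ h : ℝ → L2 d, IsSolution h₀ h ∧
        (∀ h' : ℝ → L2 d, IsSolution h₀ h' → ∀ t : ℝ, 0 ≤ t → h' t = h t) ∧
        (0 < 1 - f2 (sNorm 2 h₀).toReal) ∧
        (∀ t : ℝ, 0 ≤ t →
          sNorm 2 (h t) + ENNReal.ofReal (1 - f2 (sNorm 2 h₀).toReal) *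
            ∫⁻ τ in Icc 0 t, sNorm 6 (h τ) ≤ sNorm 2 h₀)) ∧
    -- uniform bounds in the `s`-norms
    (∀ s : ℝ, max (-2) (-(d : ℝ)) < s → ∀ A B : ℝ≥0, A < yStar → ∃ C : ℝ≥0,
      ∀ (h₀ : L2 d) (h : ℝ → L2 d), IsSolution h₀ h →
        sNorm 2 h₀ ≤ A → besovNorm (-(d : ℝ)) h₀ ≤ B → sNorm s h₀ < ∞ →
        ∀ t : ℝ, 0 ≤ t → sNorm s (h t) ≤ C * sNorm s h₀) ∧
    -- uniform bounds in the `Ḟ^{s,p}` norms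
    (∀ s p : ℝ, 0 ≤ s → 1 < p → p ≤ 2 → ∀ A B : ℝ≥0, A < yStar → ∃ C : ℝ≥0,
      ∀ (h₀ : L2 d) (h : ℝ → L2 d), IsSolution h₀ h →
        sNorm 2 h₀ ≤ A → besovNorm (-(d : ℝ)) h₀ ≤ B → fNorm s p h₀ < ∞ →
        ∀ t : ℝ, 0 ≤ t → fNorm s p (h t) ≤ C * fNorm s p h₀) ∧
    -- large time decay
    (∀ s : ℝ, max (-2) (-(d : ℝ)) < s → ∀ A B M₀ M₂ S : ℝ≥0, A < yStar → ∃ C : ℝ≥0,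
      ∀ (h₀ : L2 d) (h : ℝ → L2 d), IsSolution h₀ h →
        sNorm 2 h₀ ≤ A → besovNorm (-(d : ℝ)) h₀ ≤ B →
        fNorm 0 2 h₀ ≤ M₀ → fNorm 2 2 h₀ ≤ M₂ → sNorm s h₀ ≤ S →
        ∀ t : ℝ, 0 ≤ t →
          sNorm s (h t) ≤ C * ENNReal.ofReal ((1 + t) ^ (-(s + (d : ℝ)) / 4))) := by
  have hsmall : ∀ {A : ℝ≥0} {h₀ : L2 d}, A < yStar → sNorm 2 h₀ ≤ A → Small h₀ :=
    fun hA h => (small_of_sNorm_lt hd hyStar (h.trans_lt (by exact_mod_cast hA))).1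
  refine ⟨fun h₀ hlt => ?_, fun s hs A B hA => ?_, fun s p hs hp hp2 A B hA => ?_,
    fun s hs A B M₀ M₂ S hA => ?_⟩
  · obtain ⟨hsm, hf1, hF⟩ := small_of_sNorm_lt hd hyStar hlt
    obtain ⟨h, hsol, huniq, -⟩ := exists_unique_solution hd hsm
    refine ⟨h, hsol, huniq, sub_pos.2 hf1, fun t ht => ?_⟩
    have hf0 : 0 ≤ f2 (sNorm 2 h₀).toReal := tsum_nonneg fun j => by positivity
    rw [ENNReal.ofReal_sub _ hf0, ENNReal.ofReal_one]
    exact hsol.dissipation hd hsm hF (ENNReal.ofReal_lt_one.2 hf1) ht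
  · obtain ⟨C, hC⟩ := exists_sNorm_smoothing hd (max_lt_iff.1 hs).1.le
    exact ⟨C, fun h₀ h hsol hA' _ _ t ht =>
      le_self_add.trans (hC h₀ h hsol (hsmall hA hA') t ht)⟩
  · obtain ⟨C, hC⟩ := exists_fNorm_le hd hs hp hp2
    exact ⟨C, fun h₀ h hsol hA' _ _ t ht => hC h₀ h hsol (hsmall hA hA') t ht⟩
  · obtain ⟨C, hC⟩ := exists_sNorm_decay hd (max_lt_iff.1 hs).1.le
      (neg_lt_iff_pos_add.1 (max_lt_iff.1 hs).2) B M₀ M₂ S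
    exact ⟨C, fun h₀ h hsol hA' hB h0 h2 hS t ht =>
      hC h₀ h hsol (hsmall hA hA') hB h0 h2 hS t ht⟩
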